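/- Let $k\ge 1$ and $r\ge 2$ be integers and let $\varepsilon>0$. There exists $C>0$, depending only on $k$, $r$ and $\varepsilon$, such that the following holds for every sequence $p=p(n)\in[0,1]$ that satisfies $p\ge C(\log n/n)^{1/k}$ for all sufficiently large $n$ and $(\log n)^2/n=o(p)$ as $n\to\infty$. With probability tending to $1$ as $n\to\infty$, the binomial random graph $G=G_{n,p}$ has the following property: for every maximum $r$-cut $(V_1,\dots,V_r)$ of $G$, every set $W$ of $k$ vertices of $G$ and every $i\in\{1,\dots,r\}$, \[ \left(\frac1r-\varepsilon\right)np^k\;\le\;\Bigl|V_i\cap\bigcap_{w\in W}N_G(w)\Bigr|\;\le\;\left(\frac1r+\varepsilon\right)np^k , \] where $N_G(w)$ is the set of neighbours of $w$ in $G$. Here an $r$-cut of $G$ is a partition of its vertex set into $r$ (possibly empty) parts, its size is the number of edges of $G$ with endpoints in different parts, and a maximum $r$-cut is an $r$-cut of the largest size. -/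

import Mathlib

open Filter Topology Asymptotics

namespace MaxCut

variable {V : Type*} {r : ℕ}

/-- The edges of `G` with endpoints in different parts of the `r`-cut `Q`. An `r`-cut of a graph on
`V`, i.e. a partition of `V` into `r` (possibly empty) labelled parts, is given by the map
`Q : V → Fin r` that sends a vertex to the label of its part. -/
def crossingEdges (G : SimpleGraph V) (Q : V → Fin r) : Set (Sym2 V) :=
  {e | e ∈ G.edgeSet ∧ ∃ u v : V, e = s(u, v) ∧ Q u ≠ Q v}

/-- The size of an `r`-cut: the number of edges of `G` between different parts. -/
noncomputable def cutSize (G : SimpleGraph V) (Q : V → Fin r) : ℕ :=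
  (crossingEdges G Q).ncard

/-- `Q` has the largest size among all `r`-cuts of `G`. -/
def IsMaxCut (G : SimpleGraph V) (Q : V → Fin r) : Prop :=
  ∀ Q' : V → Fin r, cutSize G Q' ≤ cutSize G Q

/-- The part of the cut `Q` with label `i`. -/
def part (Q : V → Fin r) (i : Fin r) : Set V :=
  {v | Q v = i}

/-- The set of common neighbours of (all the vertices of) `W`. -/
def commonNbhd (G : SimpleGraph V) (W : Finset V) : Set V :=
  ⋂ w ∈ W, G.neighborSet w

/-- Every maximum `r`-cut of `G` partitions the common neighbourhood of every `k`-set of vertices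
into parts of size between `(1/r - ε) * x` and `(1/r + ε) * x`. -/
def SplitsCommonNbhds (G : SimpleGraph V) (k r : ℕ) (ε x : ℝ) : Prop :=
  ∀ Q : V → Fin r, IsMaxCut G Q → ∀ W : Finset V, W.card = k → ∀ i : Fin r,
    (1 / (r : ℝ) - ε) * x ≤ ((commonNbhd G W ∩ part Q i).ncard : ℝ) ∧
      ((commonNbhd G W ∩ part Q i).ncard : ℝ) ≤ (1 / (r : ℝ) + ε) * x

end MaxCut

/-! The random graph is modelled by a `p`-random set `F` of pairs (loops are included and harmless).
If a maximum cut were independent of the edges at `W`, Chernoff's bound would split the common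
neighbourhood of `W` in proportion to the parts, and the parts are balanced because a maximum cut
minimises the number of edges inside parts. The obstacle is the dependence. It is overcome by
rigidity (`Rigid`): outside a small proportion of the vertices, all cuts within O(log n) of the
maximum agree up to the names of the parts.

Rigidity. For fixed `Q`, the family of `F` whose canonical maximum cut is `Q` is decreasing in the
pairs inside the parts of `Q`. A Russo-type identity (`mean_pivotal`, `sum_mean_pivotalCount`)
therefore equates `p` times the expected number of pivotal inner pairs with the expected deficit of
inner edges, which discrepancy bounds by O(n√(np)). Now suppose that a cut `Q'` within `a` of the
maximum separates `u` from a positive fraction of its non-neighbours in its own part. Adding O(a +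
1) random pairs between `u` and its part lifts `Q'` above `Q` with probability bounded below
(`le_exitProb_of_flips`). For a = O(log n) these additions distort the law by a bounded factor only,
so by `mean_exitProb_le` such vertices are paid for by pivotal pairs. Their expected number is O(n
log n / √(np)), which is o(n) because (log n)² = o(np). By discrepancy, all other vertices are
stable, apart from a few of large inner degree (`Discrepancy.unstable_subset`). This needs `p`
bounded away from 1; nearly complete graphs are treated directly.

Decoupling. The set `W` is built one vertex at a time, and the vertex set is cut into chunks of size
about A log n / p^j at the `j`-th vertex. Hiding the pairs from the new vertex to the current common
neighbours in one chunk removes only O(log n) edges. The canonical maximum cut of what remains is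
independent of the hidden pairs, so Chernoff applies to it; it is also nearly maximum in `F`, so by
rigidity it agrees with every maximum cut off the unstable vertices. The unstable vertices inside
common neighbourhoods are counted by the same device, at the price of some tolerance per vertex of
`W`. Chunks of this size exist because n p^k ≥ A log n. -/

set_option linter.unusedSectionVars false

/-! ### Random subsets of a finite type -/

namespace RandomSubset

open Finset

variable {E : Type*} [Fintype E] [DecidableEq E]

/-- The probability that the `p`-random subset of `E` is `F`. -/
noncomputable def weight (p : ℝ) (F : Finset E) : ℝ :=
  ∏ e, if e ∈ F then p else 1 - p

/-- The expectation of `f` of the `p`-random subset of `E`. -/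
noncomputable def mean (p : ℝ) (f : Finset E → ℝ) : ℝ :=
  ∑ F, weight p F * f F

open Classical in
/-- The indicator of a proposition as a real number. -/
noncomputable def ind (P : Prop) : ℝ := if P then 1 else 0

/-- The probability that the `p`-random subset of `E` satisfies `A`. -/
noncomputable def prob (p : ℝ) (A : Finset E → Prop) : ℝ :=
  mean p fun F => ind (A F)

lemma ind_true {P : Prop} (h : P) : ind P = 1 := by simp [ind, h]
lemma ind_false {P : Prop} (h : ¬ P) : ind P = 0 := by simp [ind, h]

lemma ind_nonneg (P : Prop) : 0 ≤ ind P := by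
  unfold ind; split_ifs <;> norm_num

lemma ind_le_one (P : Prop) : ind P ≤ 1 := by
  unfold ind; split_ifs <;> norm_num

lemma ind_mono {P Q : Prop} (h : P → Q) : ind P ≤ ind Q := by
  by_cases hP : P
  · rw [ind_true hP, ind_true (h hP)]
  · rw [ind_false hP]; exact ind_nonneg _

lemma ind_and (P Q : Prop) : ind (P ∧ Q) = ind P * ind Q := by
  by_cases hP : P <;> by_cases hQ : Q <;> simp [ind, hP, hQ]

variable {p : ℝ}

lemma weight_nonneg (h0 : 0 ≤ p) (h1 : p ≤ 1) (F : Finset E) : 0 ≤ weight p F :=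
  prod_nonneg fun e _ => by split_ifs <;> linarith

lemma weight_eq (F : Finset E) :
    weight p F = p ^ #F * (1 - p) ^ (Fintype.card E - #F) := by
  unfold weight
  rw [prod_ite]
  simp only [prod_const]
  congr 2
  · congr 1; ext; simp
  · rw [← card_univ, ← card_sdiff_of_subset (subset_univ F)]
    congr 1; ext; simp

lemma weight_erase_insert (e : E) (F : Finset E) :
    ∃ c, weight p (F.erase e) = (1 - p) * c ∧ weight p (insert e F) = p * c := by
  refine ⟨∏ x ∈ univ.erase e, if x ∈ F then p else 1 - p, ?_, ?_⟩
  · unfold weight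
    rw [← mul_prod_erase univ _ (mem_univ e)]
    congr 1
    · simp
    · refine prod_congr rfl fun x hx => ?_
      simp [(mem_erase.1 hx).1]
  · unfold weight
    rw [← mul_prod_erase univ _ (mem_univ e)]
    congr 1
    · simp
    · refine prod_congr rfl fun x hx => ?_
      simp [(mem_erase.1 hx).1]

lemma sum_erase_insert (e : E) (g : Finset E → ℝ) :
    ∑ F, g F = ∑ F with e ∉ F, (g F + g (insert e F)) := by
  rw [sum_add_distrib, ← sum_filter_add_sum_filter_not univ (fun F => e ∉ F) g]
  congr 1
  refine sum_nbij' (fun F => F.erase e) (fun F => insert e F) ?_ ?_ ?_ ?_ ?_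
  · intro F; simp
  · intro F; simp
  · intro F hF; simp at hF; exact insert_erase hF
  · intro F hF; simp at hF; exact erase_insert hF
  · intro F hF; simp at hF; rw [insert_erase hF]

/-- Resampling one element does not change the law. -/
lemma mean_resample (e : E) (f : Finset E → ℝ) :
    mean p f = mean p fun F => (1 - p) * f (F.erase e) + p * f (insert e F) := by
  unfold mean
  rw [sum_erase_insert e, sum_erase_insert e]
  refine sum_congr rfl fun F hF => ?_
  simp only [mem_filter, mem_univ, true_and] at hF
  obtain ⟨c, h1, h2⟩ := weight_erase_insert (p := p) e F
  rw [erase_eq_of_notMem hF] at h1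
  simp only [erase_eq_of_notMem hF, erase_insert hF, insert_idem, h1, h2]
  ring

lemma mean_add (f g : Finset E → ℝ) :
    mean p (fun F => f F + g F) = mean p f + mean p g := by
  simp [mean, mul_add, sum_add_distrib]

lemma mean_const_mul (c : ℝ) (f : Finset E → ℝ) :
    mean p (fun F => c * f F) = c * mean p f := by
  simp only [mean, mul_sum]; exact sum_congr rfl fun _ _ => by ring

lemma mean_mul_const (c : ℝ) (f : Finset E → ℝ) :
    mean p (fun F => f F * c) = mean p f * c := by
  simp only [mean, sum_mul]; exact sum_congr rfl fun _ _ => by ring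

lemma mean_sum {ι : Type*} (s : Finset ι) (f : ι → Finset E → ℝ) :
    mean p (fun F => ∑ i ∈ s, f i F) = ∑ i ∈ s, mean p (f i) := by
  simp only [mean, mul_sum]; exact sum_comm

lemma mean_mono (h0 : 0 ≤ p) (h1 : p ≤ 1) {f g : Finset E → ℝ} (h : ∀ F, f F ≤ g F) :
    mean p f ≤ mean p g :=
  sum_le_sum fun F _ => mul_le_mul_of_nonneg_left (h F) (weight_nonneg h0 h1 F)

lemma mean_nonneg (h0 : 0 ≤ p) (h1 : p ≤ 1) {f : Finset E → ℝ} (h : ∀ F, 0 ≤ f F) :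
    0 ≤ mean p f :=
  sum_nonneg fun F _ => mul_nonneg (weight_nonneg h0 h1 F) (h F)

lemma mean_one : mean p (fun _ : Finset E => (1 : ℝ)) = 1 := by
  have h := Finset.prod_add (fun _ : E => p) (fun _ : E => 1 - p) univ
  simp only [add_sub_cancel, prod_const_one, prod_const, powerset_univ] at h
  refine Eq.trans ?_ h.symm
  refine sum_congr rfl fun F _ => ?_
  rw [weight_eq, mul_one, card_sdiff_of_subset (subset_univ F), card_univ]

lemma mean_const (c : ℝ) : mean p (fun _ : Finset E => c) = c := by
  have := mean_const_mul (E := E) (p := p) c (fun _ => 1)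
  simpa [mean_one] using this

lemma prob_nonneg (h0 : 0 ≤ p) (h1 : p ≤ 1) (A : Finset E → Prop) : 0 ≤ prob p A :=
  mean_nonneg h0 h1 fun _ => ind_nonneg _

lemma prob_mono (h0 : 0 ≤ p) (h1 : p ≤ 1) {A B : Finset E → Prop} (h : ∀ F, A F → B F) :
    prob p A ≤ prob p B :=
  mean_mono h0 h1 fun F => ind_mono (h F)

lemma prob_or_le (h0 : 0 ≤ p) (h1 : p ≤ 1) (A B : Finset E → Prop) :
    prob p (fun F => A F ∨ B F) ≤ prob p A + prob p B := by
  unfold prob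
  rw [← mean_add]
  refine mean_mono h0 h1 fun F => ?_
  by_cases hA : A F <;> by_cases hB : B F <;> simp [ind, hA, hB]

lemma prob_exists_le {ι : Type*} (s : Finset ι) (h0 : 0 ≤ p) (h1 : p ≤ 1)
    (A : ι → Finset E → Prop) :
    prob p (fun F => ∃ i ∈ s, A i F) ≤ ∑ i ∈ s, prob p (A i) := by
  unfold prob
  rw [← mean_sum]
  refine mean_mono h0 h1 fun F => ?_
  by_cases h : ∃ i ∈ s, A i F
  · obtain ⟨i, hi, hA⟩ := h
    rw [ind_true ⟨i, hi, hA⟩, ← ind_true hA]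
    exact single_le_sum (f := fun i => ind (A i F)) (fun _ _ => ind_nonneg _) hi
  · rw [ind_false h]; exact sum_nonneg fun _ _ => ind_nonneg _

/-- Markov's inequality. -/
lemma prob_le_of_mean (h0 : 0 ≤ p) (h1 : p ≤ 1) {f : Finset E → ℝ} (hf : ∀ F, 0 ≤ f F)
    {c : ℝ} (hc : 0 < c) : prob p (fun F => c ≤ f F) ≤ mean p f / c := by
  rw [le_div_iff₀ hc]
  unfold prob
  rw [← mean_mul_const]
  refine mean_mono h0 h1 fun F => ?_
  by_cases h : c ≤ f F
  · rw [ind_true h]; linarith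
  · rw [ind_false h]; linarith [hf F]

/-- The moment generating function of the number of random elements in `B`, on an event that
does not depend on `B`. -/
lemma mean_mul_pow_card_inter (B : Finset E) (h : Finset E → ℝ)
    (hB : ∀ F F', F \ B = F' \ B → h F = h F') (c : ℝ) :
    mean p (fun F => h F * c ^ #(F ∩ B)) = mean p h * (1 - p + p * c) ^ #B := by
  induction B using Finset.induction_on generalizing h with
  | empty => simp
  | insert e B he ih =>
    have hh : ∀ F F', F \ B = F' \ B → h F = h F' := fun F F' hF =>
      hB F F' (by
        ext x
        have := Finset.ext_iff.1 hF x
        simp only [Finset.mem_sdiff, mem_insert, not_or] at this ⊢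
        tauto)
    rw [mean_resample e]
    have key : (fun F => (1 - p) * (h (F.erase e) * c ^ #((F.erase e) ∩ insert e B)) +
        p * (h (insert e F) * c ^ #(insert e F ∩ insert e B))) =
        fun F => (1 - p + p * c) * (h F * c ^ #(F ∩ B)) := by
      ext F
      have e1 : h (F.erase e) = h F := hB _ _ (by
        ext x; simp only [Finset.mem_sdiff, mem_insert, mem_erase]; tauto)
      have e2 : h (insert e F) = h F := hB _ _ (by
        ext x; simp only [Finset.mem_sdiff, mem_insert]; tauto)
      have e3 : F.erase e ∩ insert e B = F ∩ B := by
        ext x; simp only [mem_inter, mem_erase, mem_insert]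
        constructor
        · rintro ⟨⟨h1, h2⟩, h3⟩; exact ⟨h2, h3.resolve_left h1⟩
        · rintro ⟨h1, h2⟩; exact ⟨⟨fun h => he (h ▸ h2), h1⟩, Or.inr h2⟩
      have e4 : insert e F ∩ insert e B = insert e (F ∩ B) := by
        ext x; simp only [mem_inter, mem_insert]; tauto
      rw [e1, e2, e3, e4, card_insert_of_notMem (by simp [he])]
      ring
    rw [key, mean_const_mul, ih h hh, card_insert_of_notMem he]
    ring

/-! ### Chernoff bounds for random sets determined by the rest. -/

lemma exp_le_of_abs_le_one {θ : ℝ} (h : |θ| ≤ 1) : Real.exp θ ≤ 1 + θ + θ ^ 2 := by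
  have := Real.abs_exp_sub_one_sub_id_le h
  linarith [(abs_le.1 this).2]

/-- One-sided Chernoff bound on an event that does not depend on `B`. -/
lemma mean_ind_exp_le (h0 : 0 ≤ p) (h1 : p ≤ 1) (B : Finset E) (A : Finset E → Prop)
    (hA : ∀ F F', F \ B = F' \ B → (A F ↔ A F')) {μ θ t : ℝ} (hμ : p * #B ≤ μ) (hθ : |θ| ≤ 1)
    (ht : θ * t = 2 * μ * θ ^ 2) :
    prob p (fun F => A F ∧ t * θ ≤ θ * ((#(F ∩ B) : ℝ) - p * #B)) ≤
      prob p A * Real.exp (-(μ * θ ^ 2)) := by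
  have hmgf := mean_mul_pow_card_inter (p := p) B (fun F => ind (A F))
    (fun F F' h => by rw [propext (hA F F' h)]) (Real.exp θ)
  -- Only the quadratic term is relaxed from `p * #B` to `μ`. The linear term stays exact and
  -- cancels against the centring, so negative `θ` is allowed and gives the lower tail.
  have hbase : (1 - p + p * Real.exp θ) ^ #B ≤ Real.exp (p * #B * θ + μ * θ ^ 2) := by
    have h2 : 1 - p + p * Real.exp θ ≤ Real.exp (p * (θ + θ ^ 2)) := by
      have := Real.add_one_le_exp (p * (θ + θ ^ 2))
      have h3 := mul_le_mul_of_nonneg_left (exp_le_of_abs_le_one hθ) h0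
      linarith
    have h4 : 0 ≤ 1 - p + p * Real.exp θ := by
      have := mul_nonneg h0 (Real.exp_pos θ).le
      linarith
    calc (1 - p + p * Real.exp θ) ^ #B ≤ Real.exp (p * (θ + θ ^ 2)) ^ #B :=
          pow_le_pow_left₀ h4 h2 _
      _ = Real.exp (p * #B * θ + p * #B * θ ^ 2) := by rw [← Real.exp_nat_mul]; ring_nf
      _ ≤ _ := by
          apply Real.exp_le_exp.2
          have := mul_le_mul_of_nonneg_right hμ (sq_nonneg θ)
          linarith
  have hprob : 0 ≤ prob p A := prob_nonneg h0 h1 A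
  calc prob p (fun F => A F ∧ t * θ ≤ θ * ((#(F ∩ B) : ℝ) - p * #B))
      ≤ mean p (fun F => (ind (A F) * Real.exp θ ^ #(F ∩ B)) *
          Real.exp (-(p * #B * θ + 2 * μ * θ ^ 2))) := by
        refine mean_mono h0 h1 fun F => ?_
        rw [ind_and, mul_assoc]
        refine mul_le_mul_of_nonneg_left ?_ (ind_nonneg _)
        rw [← Real.exp_nat_mul, ← Real.exp_add]
        by_cases h : t * θ ≤ θ * ((#(F ∩ B) : ℝ) - p * #B)
        · rw [ind_true h]
          apply Real.one_le_exp
          nlinarith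
        · rw [ind_false h]; exact (Real.exp_pos _).le
    _ = prob p A * (1 - p + p * Real.exp θ) ^ #B *
          Real.exp (-(p * #B * θ + 2 * μ * θ ^ 2)) := by
        rw [mean_mul_const, hmgf]; rfl
    _ ≤ prob p A * Real.exp (p * #B * θ + μ * θ ^ 2) *
          Real.exp (-(p * #B * θ + 2 * μ * θ ^ 2)) := by gcongr
    _ = _ := by rw [mul_assoc, ← Real.exp_add]; ring_nf

/-- Chernoff's bound for the number of random elements of a random set `B F` that is determined
by the random elements outside of it. -/
theorem prob_deviation_le (h0 : 0 ≤ p) (h1 : p ≤ 1) (B : Finset E → Finset E)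
    (hB : ∀ F F', F \ B F = F' \ B F → B F' = B F) {μ t : ℝ} (ht : 0 < t) (htμ : t ≤ 2 * μ) :
    prob p (fun F => p * #(B F) ≤ μ ∧ t < |(#(F ∩ B F) : ℝ) - p * #(B F)|) ≤
      2 * Real.exp (-(t ^ 2 / (4 * μ))) := by
  have hμ : 0 < μ := by linarith
  have hθ : t / (2 * μ) ≤ 1 := by rw [div_le_one (by linarith)]; exact htμ
  have hθ0 : 0 ≤ t / (2 * μ) := by positivity
  have hexp : μ * (t / (2 * μ)) ^ 2 = t ^ 2 / (4 * μ) := by field_simp; ring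
  -- Condition on the value of the random set: by `hB` the event `B F = B₀` depends only on `F`
  -- outside `B₀`, so the elements inside `B₀` are still fresh.
  have key : ∀ B₀ : Finset E,
      prob p (fun F => B F = B₀ ∧ (p * #(B F) ≤ μ ∧ t < |(#(F ∩ B F) : ℝ) - p * #(B F)|)) ≤
      prob p (fun F => B F = B₀) * (2 * Real.exp (-(t ^ 2 / (4 * μ)))) := by
    intro B₀
    have hinv : ∀ F F', F \ B₀ = F' \ B₀ → (B F = B₀ ↔ B F' = B₀) := by
      intro F F' h
      constructor
      · rintro rfl; exact hB F F' h
      · rintro rfl; exact hB F' F h.symm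
    have hP : 0 ≤ prob p (fun F => B F = B₀) := prob_nonneg h0 h1 _
    by_cases hc : p * #B₀ ≤ μ
    · have u1 := mean_ind_exp_le h0 h1 B₀ _ hinv hc (θ := t / (2 * μ)) (t := t)
        (by rw [abs_of_nonneg hθ0]; exact hθ) (by field_simp)
      have u2 := mean_ind_exp_le h0 h1 B₀ _ hinv hc (θ := -(t / (2 * μ))) (t := -t)
        (by rw [abs_neg, abs_of_nonneg hθ0]; exact hθ) (by field_simp)
      rw [neg_sq, hexp] at u2
      rw [hexp] at u1
      refine (prob_mono h0 h1 (B := fun F => (B F = B₀ ∧ t * (t / (2 * μ)) ≤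
        t / (2 * μ) * ((#(F ∩ B₀) : ℝ) - p * #B₀)) ∨ (B F = B₀ ∧ -t * -(t / (2 * μ)) ≤
        -(t / (2 * μ)) * ((#(F ∩ B₀) : ℝ) - p * #B₀))) ?_).trans
        ((prob_or_le h0 h1 _ _).trans (by linarith))
      rintro F ⟨rfl, -, h⟩
      rcases lt_abs.1 h with h | h
      · left
        refine ⟨rfl, ?_⟩
        rw [mul_comm]; exact mul_le_mul_of_nonneg_left h.le hθ0
      · right
        refine ⟨rfl, ?_⟩
        have := mul_le_mul_of_nonneg_left h.le hθ0
        linarith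
    · have : prob p (fun F => B F = B₀ ∧
          (p * #(B F) ≤ μ ∧ t < |(#(F ∩ B F) : ℝ) - p * #(B F)|)) = 0 := by
        unfold prob
        rw [← mean_const (E := E) (p := p) 0]
        congr 1; ext F
        exact ind_false (by rintro ⟨rfl, h, -⟩; exact hc h)
      rw [this]; positivity
  have hsum : ∑ B₀, prob p (fun F => B F = B₀) = 1 := by
    unfold prob
    rw [← mean_sum, ← mean_one (E := E) (p := p)]
    congr 1; ext F
    rw [sum_eq_single (B F)]
    · exact ind_true rfl
    · intro b _ hb; exact ind_false (Ne.symm hb)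
    · simp
  calc _ ≤ prob p (fun F => ∃ B₀ ∈ (univ : Finset (Finset E)), B F = B₀ ∧
          (p * #(B F) ≤ μ ∧ t < |(#(F ∩ B F) : ℝ) - p * #(B F)|)) :=
        prob_mono h0 h1 fun F h => ⟨B F, mem_univ _, rfl, h⟩
    _ ≤ _ := prob_exists_le _ h0 h1 _
    _ ≤ ∑ B₀, prob p (fun F => B F = B₀) * (2 * Real.exp (-(t ^ 2 / (4 * μ)))) :=
        sum_le_sum fun B₀ _ => key B₀
    _ = _ := by rw [← sum_mul, hsum, one_mul]

end RandomSubset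

namespace RandomSubset

open Finset

/-! ### Adding random elements to a random set until it leaves a family -/

variable {E : Type*} [Fintype E] [DecidableEq E] {p : ℝ}

/-- Change of measure for one insertion: adding `e` to a set without it multiplies the weight by p /
(1 - p). This compares the law after a random addition with the original law. -/
lemma mean_insert_swap (e : E) (h : Finset E → ℝ) :
    p * mean p (fun F => ind (e ∉ F) * h (insert e F)) =
      (1 - p) * mean p (fun F => ind (e ∈ F) * h F) := by
  rw [mean_resample e, mean_resample e (fun F => ind (e ∈ F) * h F), ← mean_const_mul,
    ← mean_const_mul]
  congr 1; ext F
  rw [ind_true (notMem_erase e F), ind_false (notMem_erase e F), ind_true (mem_insert_self e F),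
    ind_false (not_not.2 (mem_insert_self e F))]
  have h2 : insert e (F.erase e) = insert e F := by
    ext x; simp only [mem_insert, mem_erase]; tauto
  rw [h2]
  ring

open Classical in
/-- The probability that the set leaves the family `A` within `t` steps when in every step a
uniformly random new element of `M` is added to it. -/
noncomputable def exitProb (A : Finset E → Prop) (M : Finset E) : ℕ → Finset E → ℝ
  | 0, F => ind (¬ A F)
  | t + 1, F => if A F then (∑ e ∈ M \ F, exitProb A M t (insert e F)) / #(M \ F) else 1

variable {A : Finset E → Prop} {M : Finset E}

lemma exitProb_of_not {F : Finset E} (h : ¬ A F) (t : ℕ) : exitProb A M t F = 1 := by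
  cases t with
  | zero => simp [exitProb, ind_true h]
  | succ t => simp [exitProb, h]

lemma exitProb_nonneg (t : ℕ) (F : Finset E) : 0 ≤ exitProb A M t F := by
  induction t generalizing F with
  | zero => exact ind_nonneg _
  | succ t ih =>
    simp only [exitProb]
    split_ifs
    · exact div_nonneg (sum_nonneg fun _ _ => ih _) (Nat.cast_nonneg _)
    · exact zero_le_one

lemma exitProb_le_one (t : ℕ) (F : Finset E) : exitProb A M t F ≤ 1 := by
  induction t generalizing F with
  | zero => exact ind_le_one _
  | succ t ih =>
    simp only [exitProb]
    split_ifs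
    · refine div_le_one_of_le₀ ?_ (Nat.cast_nonneg _)
      refine (sum_le_sum fun _ _ => ih _).trans ?_
      simp
    · exact le_rfl

/-- If every step lowers `d` by one with probability at least `κ` and `d` is nonnegative on `A`,
then the family `A` is left fast. -/
lemma le_exitProb {κ : ℝ} (hκ0 : 0 ≤ κ) (hκ : κ ≤ 1) (C : Finset E) (d : Finset E → ℝ)
    (hd : ∀ F, ∀ e ∈ M \ F, d (insert e F) = d F - ind (e ∈ C)) (hA : ∀ F, A F → 0 ≤ d F)
    (t : ℕ) (F : Finset E) (hF : -1 ≤ d F) (hC : κ * #M + t ≤ #((M \ F) ∩ C)) :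
    κ * t - d F - 1 ≤ t * exitProb A M t F := by
  induction t generalizing F with
  | zero => simp; linarith
  | succ t ih =>
    by_cases hAF : A F
    swap
    · rw [exitProb_of_not hAF]
      push_cast
      have : κ * ((t : ℝ) + 1) ≤ 1 * ((t : ℝ) + 1) := by gcongr
      linarith
    have hdF := hA F hAF
    have hcard : (#((M \ F) ∩ C) : ℝ) ≤ #(M \ F) := by
      exact_mod_cast card_le_card inter_subset_left
    push_cast at hC ⊢
    have hMpos : (0 : ℝ) < #(M \ F) := by
      have : 0 ≤ κ * #M := by positivity
      have : (0 : ℝ) ≤ t := Nat.cast_nonneg t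
      linarith
    -- Average the induction hypothesis over the added element; the mean drop of `d` is at least
    -- `κ`.
    have hstep : (κ * t - d F - 1 + κ) * #(M \ F) ≤
        t * ∑ e ∈ M \ F, exitProb A M t (insert e F) := by
      rw [mul_sum]
      calc (κ * t - d F - 1 + κ) * #(M \ F)
          ≤ ∑ e ∈ M \ F, (κ * t - d F - 1 + ind (e ∈ C)) := by
            have h1 : ∑ e ∈ M \ F, ind (e ∈ C) = #((M \ F) ∩ C) := by
              have : ∀ e, ind (e ∈ C) = if e ∈ C then (1 : ℝ) else 0 := fun e => by
                by_cases h : e ∈ C <;> simp [ind, h]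
              simp only [this, sum_ite_mem, sum_const]; simp
            rw [sum_add_distrib, h1, sum_const, nsmul_eq_mul]
            have h2 : κ * #(M \ F) ≤ κ * #M := by
              gcongr; exact sdiff_subset
            have : (0 : ℝ) ≤ t := Nat.cast_nonneg t
            nlinarith
        _ ≤ _ := by
            refine sum_le_sum fun e he => ?_
            have hde := hd F e he
            have hind := ind_le_one (e ∈ C)
            have := ih (insert e F) (by linarith) ?_
            · linarith
            -- One step uses up at most one element of `C`; the summand `t` in `hC` is the reserve
            -- for this.
            · have h3 : #((M \ F) ∩ C) ≤ #((M \ insert e F) ∩ C) + 1 := by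
                refine (card_le_card (t := insert e ((M \ insert e F) ∩ C)) ?_).trans
                  (card_insert_le _ _)
                intro x hx
                simp only [mem_inter, Finset.mem_sdiff, mem_insert] at hx ⊢
                tauto
              have h4 : (#((M \ F) ∩ C) : ℝ) ≤ #((M \ insert e F) ∩ C) + 1 := by exact_mod_cast h3
              linarith
    have hval : exitProb A M (t + 1) F =
        (∑ e ∈ M \ F, exitProb A M t (insert e F)) / #(M \ F) := by
      simp [exitProb, hAF]
    have hnn := exitProb_nonneg (A := A) (M := M) (t + 1) F
    have h5 : κ * t - d F - 1 + κ ≤ t * exitProb A M (t + 1) F := by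
      rw [hval, ← mul_div_assoc, le_div_iff₀ hMpos]
      exact hstep
    linarith

/-- The elements of `M` whose addition to `F` leaves the family `A`. -/
noncomputable def pivotalCount (A : Finset E → Prop) (M F : Finset E) : ℝ :=
  ∑ e ∈ M, ind (e ∉ F ∧ A F ∧ ¬ A (insert e F))

lemma pivotalCount_nonneg (F : Finset E) : 0 ≤ pivotalCount A M F :=
  sum_nonneg fun _ _ => ind_nonneg _

lemma card_sdiff_insert_add_one {e : E} {F : Finset E} (he : e ∈ M) (hF : e ∉ F) :
    #(M \ insert e F) + 1 = #(M \ F) := by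
  have : M \ insert e F = (M \ F).erase e := by
    ext x; simp only [Finset.mem_sdiff, mem_insert, mem_erase]; tauto
  rw [this, card_erase_add_one (by simp [he, hF])]

/-- The probability that a random member of a decreasing family `A` with few elements in `M` leaves
`A` within `t` steps, in terms of the expected number of pivotal elements. -/
theorem mean_exitProb_le (h0 : 0 < p) (h1 : p ≤ 1) {ρ Kmax : ℝ} (hρ : 1 ≤ ρ)
    (hK : Kmax < #M) (hKρ : (1 - p) * Kmax ≤ ρ * (p * (#M - Kmax)))
    (t : ℕ) (K : ℝ) (hKt : K + t ≤ Kmax) :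
    mean p (fun F => ind (A F ∧ (#(F ∩ M) : ℝ) ≤ K) * exitProb A M t F) ≤
      t * ρ ^ t * (mean p (pivotalCount A M) / (#M - Kmax)) := by
  have hm : 0 < #M - Kmax := by linarith
  set P := mean p (pivotalCount A M) / (#M - Kmax) with hP
  have hP0 : 0 ≤ P :=
    div_nonneg (mean_nonneg h0.le h1 pivotalCount_nonneg) hm.le
  induction t generalizing K with
  | zero =>
    simp only [Nat.cast_zero, zero_mul]
    apply le_of_eq
    rw [← mean_const (E := E) (p := p) 0]
    congr 1; ext F
    by_cases h : A F
    · simp [exitProb, ind_false (not_not.2 h)]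
    · rw [ind_false (fun h' => h h'.1), zero_mul]
  | succ t ih =>
    push_cast at hKt ⊢
    have ht0 : (0 : ℝ) ≤ t := Nat.cast_nonneg t
    have ih' := ih (K + 1) (by linarith)
    set S := mean p (fun F => ind (A F ∧ (#(F ∩ M) : ℝ) ≤ K + 1) * exitProb A M t F) with hS
    -- The continuation value after one step, normalised by the number of choices that were
    -- available before it: `#(M \ F) + 1` when `F` already contains the new element.
    let h : Finset E → ℝ := fun F =>
      ind (A F ∧ (#(F ∩ M) : ℝ) ≤ K + 1) * exitProb A M t F / (#(M \ F) + 1)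
    have hh0 : ∀ F, 0 ≤ h F := fun F =>
      div_nonneg (mul_nonneg (ind_nonneg _) (exitProb_nonneg _ _)) (by positivity)
    -- The first step either adds a pivotal element, which costs at most `pivotalCount / (#M -
    -- Kmax)`, or stays in `A` with at most one more element of `M`.
    have hpt : ∀ F, ind (A F ∧ (#(F ∩ M) : ℝ) ≤ K) * exitProb A M (t + 1) F ≤
        pivotalCount A M F * (#M - Kmax)⁻¹ + ∑ e ∈ M, ind (e ∉ F) * h (insert e F) := by
      intro F
      have hr0 : 0 ≤ pivotalCount A M F * (#M - Kmax)⁻¹ + ∑ e ∈ M, ind (e ∉ F) * h (insert e F) :=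
        add_nonneg (mul_nonneg (pivotalCount_nonneg F) (by positivity))
          (sum_nonneg fun e _ => mul_nonneg (ind_nonneg _) (hh0 _))
      by_cases hAF : A F ∧ (#(F ∩ M) : ℝ) ≤ K
      swap
      · rw [ind_false hAF, zero_mul]; exact hr0
      have hcard : (#(M \ F) : ℝ) = #M - #(F ∩ M) := by
        have := card_sdiff_add_card_inter M F
        rw [inter_comm] at this
        have h' : (#(M \ F) : ℝ) + #(F ∩ M) = #M := by exact_mod_cast this
        linarith
      have hge : #M - Kmax ≤ #(M \ F) := by rw [hcard]; linarith [hAF.2]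
      have hpos : (0 : ℝ) < #(M \ F) := by linarith
      rw [ind_true hAF, one_mul]
      simp only [exitProb, if_pos hAF.1]
      have hsub : ∑ e ∈ M, ind (e ∉ F) * h (insert e F) =
          ∑ e ∈ M \ F, h (insert e F) := by
        rw [← sum_subset (sdiff_subset (s := M) (t := F))]
        · refine sum_congr rfl fun e he => ?_
          rw [ind_true (Finset.mem_sdiff.1 he).2, one_mul]
        · intro e he hn
          rw [ind_false, zero_mul]
          intro h'; exact hn (Finset.mem_sdiff.2 ⟨he, h'⟩)
      have hpivsub : ∑ e ∈ M \ F, ind (e ∉ F ∧ A F ∧ ¬ A (insert e F)) ≤ pivotalCount A M F :=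
        sum_le_sum_of_subset_of_nonneg sdiff_subset fun _ _ _ => ind_nonneg _
      rw [hsub]
      calc (∑ e ∈ M \ F, exitProb A M t (insert e F)) / (#(M \ F) : ℝ)
          ≤ (∑ e ∈ M \ F, (ind (e ∉ F ∧ A F ∧ ¬ A (insert e F)) +
              #(M \ F) * h (insert e F))) / (#(M \ F) : ℝ) := by
            refine div_le_div_of_nonneg_right (sum_le_sum fun e he => ?_) hpos.le
            obtain ⟨heM, heF⟩ := Finset.mem_sdiff.1 he
            by_cases hAe : A (insert e F)
            · have hle : (#(insert e F ∩ M) : ℝ) ≤ K + 1 := by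
                have : #(insert e F ∩ M) ≤ #(F ∩ M) + 1 := by
                  refine (card_le_card (t := insert e (F ∩ M)) ?_).trans (card_insert_le _ _)
                  intro x hx
                  simp only [mem_inter, mem_insert] at hx ⊢
                  tauto
                have : (#(insert e F ∩ M) : ℝ) ≤ #(F ∩ M) + 1 := by exact_mod_cast this
                linarith [hAF.2]
              have hc : (#(M \ insert e F) : ℝ) + 1 = #(M \ F) := by
                exact_mod_cast card_sdiff_insert_add_one heM heF
              simp only [h]
              rw [ind_false (fun h' => h'.2.2 hAe), ind_true ⟨hAe, hle⟩, hc, one_mul,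
                mul_div_cancel₀ _ hpos.ne', zero_add]
            · rw [ind_true ⟨heF, hAF.1, hAe⟩]
              have := exitProb_le_one (A := A) (M := M) t (insert e F)
              have := mul_nonneg hpos.le (hh0 (insert e F))
              linarith
        _ = (∑ e ∈ M \ F, ind (e ∉ F ∧ A F ∧ ¬ A (insert e F))) / (#(M \ F) : ℝ) +
              ∑ e ∈ M \ F, h (insert e F) := by
            rw [sum_add_distrib, add_div, ← mul_sum, mul_div_cancel_left₀ _ hpos.ne']
        _ ≤ pivotalCount A M F * (#M - Kmax)⁻¹ + ∑ e ∈ M \ F, h (insert e F) := by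
            rw [div_eq_mul_inv]
            gcongr
            exact pivotalCount_nonneg F
    -- After the change of measure, each set is weighted by (1 - p) #(F ∩ M) / (p (#(M \ F) + 1)),
    -- at most `ρ` while `F` has at most `Kmax` elements in `M`. So every step costs one factor `ρ`.
    have hswap : p * ∑ e ∈ M, mean p (fun F => ind (e ∉ F) * h (insert e F)) ≤
        p * (ρ * S) := by
      rw [mul_sum]
      simp only [mean_insert_swap]
      rw [← mul_sum, ← mean_sum, hS, ← mean_const_mul, ← mean_const_mul, ← mean_const_mul]
      refine mean_mono h0.le h1 fun F => ?_
      have hsum : ∑ e ∈ M, ind (e ∈ F) * h F = #(F ∩ M) *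
          (ind (A F ∧ (#(F ∩ M) : ℝ) ≤ K + 1) * exitProb A M t F / (#(M \ F) + 1)) := by
        simp only [h]
        rw [← sum_mul]
        congr 1
        have : ∀ e, ind (e ∈ F) = if e ∈ F then (1 : ℝ) else 0 := fun e => by
          by_cases h : e ∈ F <;> simp [ind, h]
        simp only [this, sum_ite_mem, sum_const]
        rw [inter_comm]; simp
      rw [hsum]
      by_cases hAF : A F ∧ (#(F ∩ M) : ℝ) ≤ K + 1
      swap
      · rw [ind_false hAF]; simp
      rw [ind_true hAF, one_mul]
      have hcard : (#(M \ F) : ℝ) = #M - #(F ∩ M) := by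
        have := card_sdiff_add_card_inter M F
        rw [inter_comm] at this
        have h' : (#(M \ F) : ℝ) + #(F ∩ M) = #M := by exact_mod_cast this
        linarith
      have hfr : (1 - p) * #(F ∩ M) ≤ (p * ρ) * (#(M \ F) + 1) := by
        rw [hcard]
        have h3 : (1 - p) * #(F ∩ M) ≤ (1 - p) * Kmax := by
          have : 0 ≤ 1 - p := by linarith
          gcongr
          linarith [hAF.2]
        have h4 : ρ * (p * (#M - Kmax)) ≤ ρ * (p * (#M - #(F ∩ M) + 1)) := by
          gcongr
          linarith [hAF.2]
        linarith
      have hpos : (0 : ℝ) < #(M \ F) + 1 := by positivity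
      rw [show (1 - p) * ((#(F ∩ M) : ℝ) * (exitProb A M t F / (#(M \ F) + 1))) =
        ((1 - p) * #(F ∩ M) / (#(M \ F) + 1)) * exitProb A M t F by ring, ← mul_assoc]
      refine mul_le_mul_of_nonneg_right ?_ (exitProb_nonneg _ _)
      rw [div_le_iff₀ hpos]; exact hfr
    calc _ ≤ mean p (fun F => pivotalCount A M F * (#M - Kmax)⁻¹ +
            ∑ e ∈ M, ind (e ∉ F) * h (insert e F)) := mean_mono h0.le h1 hpt
      _ = P + ∑ e ∈ M, mean p (fun F => ind (e ∉ F) * h (insert e F)) := by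
          rw [mean_add, mean_mul_const, mean_sum, hP, div_eq_mul_inv]
      _ ≤ P + ρ * (t * ρ ^ t * P) := by
          have h5 := le_of_mul_le_mul_left hswap h0
          have h6 : ρ * S ≤ ρ * (t * ρ ^ t * P) := by gcongr
          linarith
      _ ≤ (t + 1) * ρ ^ (t + 1) * P := by
          have h7 : 1 ≤ ρ ^ (t + 1) := one_le_pow₀ hρ
          have h8 : 1 * P ≤ ρ ^ (t + 1) * P := by gcongr
          rw [pow_succ] at h8 ⊢
          linarith

/-- The pivotal probability of an element for a decreasing family. -/
lemma mean_pivotal (e : E) (hA : ∀ F, A (insert e F) → A (F.erase e)) :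
    p * mean p (fun F => ind (e ∉ F ∧ A F ∧ ¬ A (insert e F))) =
      mean p (fun F => ind (A F) * (p - ind (e ∈ F))) := by
  rw [mean_resample e, mean_resample e (fun F => ind (A F) * (p - ind (e ∈ F))),
    ← mean_const_mul]
  congr 1; ext F
  have h1 := hA F
  rw [ind_true (mem_insert_self e F), ind_false (notMem_erase e F),
    ind_false (P := e ∉ insert e F ∧ _) (by simp)]
  have h2 : insert e (F.erase e) = insert e F := by
    ext x; simp only [mem_insert, mem_erase]; tauto
  rw [h2]
  by_cases h3 : A (insert e F)
  · have h4 := h1 h3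
    rw [ind_true h3, ind_true h4, ind_false (by tauto)]
    ring
  · by_cases h4 : A (F.erase e)
    · rw [ind_false h3, ind_true h4, ind_true ⟨notMem_erase e F, h4, h3⟩]
      ring
    · rw [ind_false h3, ind_false h4, ind_false (by tauto)]
      ring

end RandomSubset

namespace RandomCut

open Finset RandomSubset

/-! ### Cuts of a set of pairs -/

variable {V : Type*} [Fintype V] [DecidableEq V] {r : ℕ}

/-- The pairs with endpoints in different parts of `Q`. -/
def crossing (Q : V → Fin r) : Finset (Sym2 V) :=
  univ.filter fun e => ¬ (e.map Q).IsDiag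

lemma mem_crossing {Q : V → Fin r} {u v : V} : s(u, v) ∈ crossing Q ↔ Q u ≠ Q v := by
  simp [crossing]

/-- The number of pairs of `F` with endpoints in different parts of `Q`. -/
def cut (F : Finset (Sym2 V)) (Q : V → Fin r) : ℕ := #(F ∩ crossing Q)

lemma cut_insert {F : Finset (Sym2 V)} {e : Sym2 V} (he : e ∉ F) (Q : V → Fin r) :
    cut (insert e F) Q = cut F Q + if e ∈ crossing Q then 1 else 0 := by
  unfold cut
  split_ifs with h
  · rw [insert_inter_of_mem h, card_insert_of_notMem (by simp [he])]
  · rw [insert_inter_of_notMem h, add_zero]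

/-- The cut `Q` is within `a` of a maximum cut. -/
def Near (F : Finset (Sym2 V)) (a : ℕ) (Q : V → Fin r) : Prop :=
  ∀ Q' : V → Fin r, cut F Q' ≤ cut F Q + a

lemma Near.mono {F : Finset (Sym2 V)} {a b : ℕ} {Q : V → Fin r} (h : Near F a Q) (hab : a ≤ b) :
    Near F b Q := fun Q' => (h Q').trans (by omega)

/-- The size of a cut, with ties broken by an enumeration of all cuts. -/
noncomputable def score (F : Finset (Sym2 V)) (Q : V → Fin r) : ℕ :=
  cut F Q * Fintype.card (V → Fin r) + Fintype.equivFin (V → Fin r) Q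

/-- `Q` is the canonical maximum cut of `F`. -/
def IsCanonical (F : Finset (Sym2 V)) (Q : V → Fin r) : Prop :=
  ∀ Q' : V → Fin r, score F Q' ≤ score F Q

/-- The tie-breaking index is smaller than the factor that multiplies the cut size, so it cannot
outweigh a difference of one edge. -/
lemma cut_le_of_score_le {F : Finset (Sym2 V)} {Q Q' : V → Fin r} (h : score F Q' ≤ score F Q) :
    cut F Q' ≤ cut F Q := by
  by_contra hlt
  push Not at hlt
  have h1 := (Fintype.equivFin (V → Fin r) Q).isLt
  have h2 : (cut F Q + 1) * Fintype.card (V → Fin r) ≤ cut F Q' * Fintype.card (V → Fin r) :=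
    Nat.mul_le_mul_right _ hlt
  unfold score at h
  rw [add_mul] at h2
  omega

lemma IsCanonical.near {F : Finset (Sym2 V)} {Q : V → Fin r} (h : IsCanonical F Q) :
    Near F 0 Q := fun Q' => cut_le_of_score_le (h Q')

lemma score_injective (F : Finset (Sym2 V)) :
    Function.Injective (score F : (V → Fin r) → ℕ) := by
  intro Q Q' h
  have h1 : cut F Q = cut F Q' :=
    le_antisymm (cut_le_of_score_le h.le) (cut_le_of_score_le h.ge)
  unfold score at h
  rw [h1] at h
  exact (Fintype.equivFin (V → Fin r)).injective (Fin.ext (by omega))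

lemma IsCanonical.unique {F : Finset (Sym2 V)} {Q Q' : V → Fin r} (h : IsCanonical F Q)
    (h' : IsCanonical F Q') : Q = Q' :=
  score_injective F (le_antisymm (h' Q) (h Q'))

lemma exists_isCanonical [NeZero r] (F : Finset (Sym2 V)) :
    ∃ Q : V → Fin r, IsCanonical F Q := by
  obtain ⟨Q, -, hQ⟩ := exists_max_image (univ : Finset (V → Fin r)) (score F) univ_nonempty
  exact ⟨Q, fun Q' => hQ Q' (mem_univ _)⟩

/-- The canonical maximum cut. -/
noncomputable def canon [NeZero r] (F : Finset (Sym2 V)) : V → Fin r :=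
  (exists_isCanonical F).choose

lemma canon_spec [NeZero r] (F : Finset (Sym2 V)) : IsCanonical F (canon F : V → Fin r) :=
  (exists_isCanonical F).choose_spec

/-- A canonical cut stays canonical when a pair inside a part is removed. -/
lemma IsCanonical.erase {F : Finset (Sym2 V)} {Q : V → Fin r} {e : Sym2 V}
    (he : e ∉ crossing Q) (h : IsCanonical (insert e F) Q) : IsCanonical (F.erase e) Q := by
  intro Q'
  have h1 := cut_insert (notMem_erase e F) Q
  have h2 := cut_insert (notMem_erase e F) Q'
  have h3 : insert e (F.erase e) = insert e F := by
    ext x; simp only [mem_insert, mem_erase]; tauto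
  rw [h3] at h1 h2
  rw [if_neg he, add_zero] at h1
  have h4 := h Q'
  unfold score at h4 ⊢
  rw [h1, h2, add_mul] at h4
  omega

/-- The part of `Q` with label `i`. -/
def cell (Q : V → Fin r) (i : Fin r) : Finset V := univ.filter fun v => Q v = i

@[simp] lemma mem_cell {Q : V → Fin r} {i : Fin r} {v : V} : v ∈ cell Q i ↔ Q v = i := by
  simp [cell]

lemma sum_card_cell (Q : V → Fin r) : ∑ i, #(cell Q i) = Fintype.card V := by
  rw [← card_univ]
  exact (card_eq_sum_card_fiberwise fun v _ => mem_univ (Q v)).symm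

lemma compl_crossing (Q : V → Fin r) :
    (crossing Q)ᶜ = univ.biUnion fun i => (cell Q i).sym2 := by
  ext e
  induction e with
  | _ u v =>
    simp only [mem_compl, mem_crossing, mem_biUnion, mem_univ, true_and, mk_mem_sym2_iff, mem_cell,
      ne_eq, not_not]
    constructor
    · intro h; exact ⟨Q v, h, rfl⟩
    · rintro ⟨i, h1, h2⟩; rw [h1, h2]

lemma card_inter_compl_crossing (F : Finset (Sym2 V)) (Q : V → Fin r) :
    #(F ∩ (crossing Q)ᶜ) = ∑ i, #(F ∩ (cell Q i).sym2) := by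
  rw [compl_crossing, inter_biUnion]
  refine card_biUnion fun i _ j _ hij => ?_
  refine Finset.disjoint_left.2 ?_
  intro e he he'
  induction e with
  | _ u v =>
    simp only [mem_inter, mk_mem_sym2_iff, mem_cell] at he he'
    exact hij (he.2.1.symm.trans he'.2.1)

/-- Hence maximising the cut is the same as minimising the number of pairs inside the parts. -/
lemma cut_add_inner (F : Finset (Sym2 V)) (Q : V → Fin r) :
    cut F Q + ∑ i, #(F ∩ (cell Q i).sym2) = #F := by
  rw [← card_inter_compl_crossing, cut, ← sdiff_eq_inter_compl]
  exact card_inter_add_card_sdiff F _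

lemma card_sym2_real (X : Finset V) : (#X.sym2 : ℝ) = #X * (#X + 1) / 2 := by
  rw [card_sym2, Nat.cast_choose_two]; push_cast; ring

/-! ### Discrepancy -/

/-- Every set of vertices spans about as many pairs of `F` as expected. -/
def Discrepancy (p t : ℝ) (F : Finset (Sym2 V)) : Prop :=
  ∀ X : Finset V, |(#(F ∩ X.sym2) : ℝ) - p * #X.sym2| ≤ t

/-- The typical size of the discrepancy of a random set of pairs. -/
noncomputable def discBound (n : ℕ) (p : ℝ) : ℝ := 4 * n * √(n * p)

/-- With μ = p n² and t = 4n√(np) the Chernoff exponent is exactly 4n, which beats the 2^n sets in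
the union bound. The condition np ≥ 4 is what makes t ≤ 2μ. -/
lemma prob_not_discrepancy_le {p : ℝ} (h0 : 0 < p) (h1 : p ≤ 1)
    (hn : 4 ≤ (Fintype.card V : ℝ) * p) :
    prob p (fun F : Finset (Sym2 V) => ¬ Discrepancy p (discBound (Fintype.card V) p) F) ≤
      2 ^ (Fintype.card V) * (2 * Real.exp (-(4 * Fintype.card V))) := by
  set n := Fintype.card V with hndef
  have hn0 : (0 : ℝ) < n := by
    rcases (Nat.cast_nonneg n : (0 : ℝ) ≤ n).eq_or_lt with h | h
    · rw [← h] at hn; norm_num at hn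
    · exact h
  have hn1 : (1 : ℝ) ≤ n := by exact_mod_cast Nat.one_le_iff_ne_zero.2 (by rintro h; simp [h] at hn0)
  set s := √((n : ℝ) * p) with hs
  have hs2 : 2 ≤ s := by
    rw [hs]; exact Real.le_sqrt_of_sq_le (by linarith)
  have hss : s ^ 2 = n * p := Real.sq_sqrt (by positivity)
  have ht : 0 < discBound n p := by unfold discBound; positivity
  have htμ : discBound n p ≤ 2 * (p * (n : ℝ) ^ 2) := by
    unfold discBound
    rw [← hs]
    nlinarith [mul_nonneg hn0.le (mul_nonneg (by linarith : 0 ≤ s) (by linarith : 0 ≤ s - 2))]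
  have hexp : discBound n p ^ 2 / (4 * (p * (n : ℝ) ^ 2)) = 4 * n := by
    unfold discBound
    rw [← hs, mul_pow, hss]
    field_simp
  have key : ∀ X : Finset V,
      prob p (fun F : Finset (Sym2 V) =>
        ¬ |(#(F ∩ X.sym2) : ℝ) - p * #X.sym2| ≤ discBound n p) ≤
      2 * Real.exp (-(4 * n)) := by
    intro X
    have := prob_deviation_le h0.le h1 (fun _ => X.sym2) (fun _ _ _ => rfl) ht htμ
    rw [hexp] at this
    refine (prob_mono h0.le h1 fun F hF => ⟨?_, lt_of_not_ge hF⟩).trans this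
    gcongr
    rw [card_sym2_real]
    have hX : (#X : ℝ) ≤ n := by exact_mod_cast card_le_univ X
    nlinarith [(Nat.cast_nonneg #X : (0 : ℝ) ≤ #X)]
  refine (prob_mono h0.le h1 (B := fun F => ∃ X ∈ (univ : Finset (Finset V)),
    ¬ |(#(F ∩ X.sym2) : ℝ) - p * #X.sym2| ≤ discBound n p) ?_).trans
    ((prob_exists_le _ h0.le h1 _).trans ?_)
  · intro F hF
    unfold Discrepancy at hF
    push Not at hF
    obtain ⟨X, hX⟩ := hF
    exact ⟨X, mem_univ _, not_le.2 hX⟩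
  · refine (sum_le_sum fun X _ => key X).trans ?_
    rw [sum_const, card_univ, Fintype.card_finset, nsmul_eq_mul]
    push_cast
    exact le_rfl

/-! ### Near-maximum cuts are balanced -/

variable (V) in
/-- A finite type can be split into `m` pieces of almost equal size. -/
lemma exists_equitable_map (m : ℕ) (hm : 0 < m) :
    ∃ χ : V → Fin m, ∀ i, (#(univ.filter fun v => χ v = i) : ℝ) ≤ Fintype.card V / m + 1 := by
  let e := Fintype.equivFin V
  refine ⟨fun v => ⟨(e v : ℕ) % m, Nat.mod_lt _ hm⟩, fun i => ?_⟩
  have h : #(univ.filter fun v : V => (⟨(e v : ℕ) % m, Nat.mod_lt _ hm⟩ : Fin m) = i) ≤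
      #(range (Fintype.card V / m + 1)) := by
    refine card_le_card_of_injOn (fun v => (e v : ℕ) / m) ?_ ?_
    · intro v _
      simp only [coe_range, Set.mem_Iio, Nat.lt_succ_iff]
      exact Nat.div_le_div_right (e v).isLt.le
    · intro v hv w hw hvw
      simp only [coe_filter, mem_univ, true_and, Set.mem_ofPred_eq] at hv hw
      have h1 := congrArg Fin.val hv
      have h2 := congrArg Fin.val hw
      simp only at h1 h2 hvw
      apply e.injective
      apply Fin.ext
      rw [← Nat.div_add_mod (e v : ℕ) m, ← Nat.div_add_mod (e w : ℕ) m, hvw, h1, h2]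
  rw [card_range] at h
  have h2 : ((Fintype.card V / m : ℕ) : ℝ) ≤ Fintype.card V / m := Nat.cast_div_le
  have h3 : (#(univ.filter fun v : V => (⟨(e v : ℕ) % m, Nat.mod_lt _ hm⟩ : Fin m) = i) : ℝ) ≤
    ((Fintype.card V / m : ℕ) : ℝ) + 1 := by exact_mod_cast h
  linarith

/-- All cuts within `a` of a maximum cut have parts of size about `n / r`. -/
def Balanced (r : ℕ) (F : Finset (Sym2 V)) (a : ℕ) (δ : ℝ) : Prop :=
  ∀ Q : V → Fin r, Near F a Q → ∀ i, |(#(cell Q i) : ℝ) - Fintype.card V / r| ≤ δ * Fintype.card V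

lemma Balanced.mono {F : Finset (Sym2 V)} {a b : ℕ} {δ : ℝ} (h : Balanced r F b δ) (hab : a ≤ b) :
    Balanced r F a δ := fun Q hQ => h Q (hQ.mono hab)

/-- Compare with an equitable partition: a near-maximum cut has hardly more inner pairs, and by
discrepancy the number of inner pairs is about p/2 times the sum of the squared part sizes, up to a
common term. So this sum is nearly minimal, which bounds the variance of the part sizes. -/
lemma Discrepancy.balanced {p t : ℝ} {F : Finset (Sym2 V)} (hF : Discrepancy p t F) (h0 : 0 < p)
    (hr : 0 < r) {a : ℕ} {δ : ℝ} (hδ : 0 ≤ δ)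
    (h : Fintype.card V + (4 * r * t + 2 * a) / p ≤ (δ * Fintype.card V) ^ 2) :
    Balanced r F a δ := by
  intro Q hQ i
  set n := Fintype.card V with hn
  obtain ⟨χ, hχ⟩ := exists_equitable_map V r hr
  have hcell : ∀ j, (#(cell χ j) : ℝ) ≤ n / r + 1 := hχ
  have hr' : (0 : ℝ) < r := by exact_mod_cast hr
  have e1 := cut_add_inner F Q
  have e2 := cut_add_inner F χ
  have e3 := hQ χ
  have e4 : ∑ j, (#(F ∩ (cell Q j).sym2) : ℝ) ≤ ∑ j, (#(F ∩ (cell χ j).sym2) : ℝ) + a := by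
    have : ∑ j, #(F ∩ (cell Q j).sym2) ≤ ∑ j, #(F ∩ (cell χ j).sym2) + a := by omega
    exact_mod_cast this
  have e5 : ∑ j, (p * #(cell Q j).sym2 - t) ≤ ∑ j, (#(F ∩ (cell Q j).sym2) : ℝ) :=
    sum_le_sum fun j _ => by linarith [(abs_le.1 (hF (cell Q j))).1]
  have e6 : ∑ j, (#(F ∩ (cell χ j).sym2) : ℝ) ≤ ∑ j, (p * #(cell χ j).sym2 + t) :=
    sum_le_sum fun j _ => by linarith [(abs_le.1 (hF (cell χ j))).2]
  simp only [card_sym2_real, sum_sub_distrib, sum_add_distrib, sum_const, card_univ,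
    Fintype.card_fin, nsmul_eq_mul, ← mul_sum] at e5 e6
  have s1 : ∀ R : V → Fin r, ∑ j, ((#(cell R j) : ℝ) * (#(cell R j) + 1) / 2) =
      (∑ j, (#(cell R j) : ℝ) ^ 2 + n) / 2 := by
    intro R
    have : ∑ j, (#(cell R j) : ℝ) = n := by exact_mod_cast sum_card_cell R
    rw [← this, ← sum_add_distrib, sum_div]
    exact sum_congr rfl fun j _ => by ring
  rw [s1] at e5 e6
  have s2 : ∑ j, (#(cell χ j) : ℝ) ^ 2 ≤ (n / r + 1) * n := by
    have : ∑ j, (#(cell χ j) : ℝ) = n := by exact_mod_cast sum_card_cell χ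
    rw [← this, mul_sum]
    rw [this]
    refine sum_le_sum fun j _ => ?_
    rw [sq]
    exact mul_le_mul_of_nonneg_right (hcell j) (Nat.cast_nonneg _)
  have s3 : ∑ j, ((#(cell Q j) : ℝ) - n / r) ^ 2 = ∑ j, (#(cell Q j) : ℝ) ^ 2 - n * (n / r) := by
    have : ∑ j, (#(cell Q j) : ℝ) = n := by exact_mod_cast sum_card_cell Q
    have h2 : ∀ j, ((#(cell Q j) : ℝ) - n / r) ^ 2 =
        (#(cell Q j) : ℝ) ^ 2 - 2 * (n / r) * #(cell Q j) + (n / r) ^ 2 := fun j => by ring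
    simp only [h2, sum_add_distrib, sum_sub_distrib, ← mul_sum, this, sum_const, card_univ,
      Fintype.card_fin, nsmul_eq_mul]
    field_simp
    ring
  have s4 : ((#(cell Q i) : ℝ) - n / r) ^ 2 ≤ ∑ j, ((#(cell Q j) : ℝ) - n / r) ^ 2 :=
    single_le_sum (f := fun j => ((#(cell Q j) : ℝ) - n / r) ^ 2) (fun _ _ => sq_nonneg _)
      (mem_univ i)
  have s5 : ∑ j, (#(cell Q j) : ℝ) ^ 2 ≤ (n / r + 1) * n + (4 * r * t + 2 * a) / p := by
    have : p * (∑ j, (#(cell Q j) : ℝ) ^ 2) ≤ p * ((n / r + 1) * n) + (4 * r * t + 2 * a) := by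
      have := mul_le_mul_of_nonneg_left s2 h0.le
      linarith
    rw [← sub_le_iff_le_add', le_div_iff₀ h0]
    linarith
  refine abs_le_of_sq_le_sq ?_ (by positivity)
  calc _ ≤ _ := s4
    _ ≤ n + (4 * r * t + 2 * a) / p := by rw [s3]; linarith
    _ ≤ _ := h

end RandomCut

namespace RandomCut

open Finset RandomSubset

/-! ### Vertices that can change sides at a small cost are rare -/

variable {V : Type*} [Fintype V] [DecidableEq V] {r : ℕ}

/-- The pairs joining `u` to `X`. -/
def star (u : V) (X : Finset V) : Finset (Sym2 V) := X.image fun z => s(u, z)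

lemma mem_star {u v w : V} {X : Finset V} :
    s(v, w) ∈ star u X ↔ (v = u ∧ w ∈ X) ∨ (w = u ∧ v ∈ X) := by
  simp only [star, mem_image, Sym2.eq_iff]
  constructor
  · rintro ⟨z, hz, ⟨rfl, rfl⟩ | ⟨rfl, rfl⟩⟩
    · exact Or.inl ⟨rfl, hz⟩
    · exact Or.inr ⟨rfl, hz⟩
  · rintro (⟨rfl, h⟩ | ⟨rfl, h⟩)
    · exact ⟨w, h, Or.inl ⟨rfl, rfl⟩⟩
    · exact ⟨v, h, Or.inr ⟨rfl, rfl⟩⟩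

lemma mk_mem_star {u w : V} {X : Finset V} : s(u, w) ∈ star u X ↔ w ∈ X := by
  rw [mem_star]
  constructor
  · rintro (⟨-, h⟩ | ⟨rfl, h⟩) <;> exact h
  · intro h; exact Or.inl ⟨rfl, h⟩

lemma mk_left_injective (u : V) : Function.Injective fun z => s(u, z) := by
  intro x y h
  rcases Sym2.eq_iff.1 h with ⟨-, h⟩ | ⟨h1, h2⟩
  · exact h
  · exact h2.trans h1

lemma card_star (u : V) (X : Finset V) : #(star u X) = #X :=
  card_image_of_injective _ (mk_left_injective u)

lemma mem_of_mem_star {u : V} {X : Finset V} {e : Sym2 V} (h : e ∈ star u X) : u ∈ e := by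
  obtain ⟨z, -, rfl⟩ := mem_image.1 h
  exact Sym2.mem_mk_left u z

/-- The pairs joining `u` to its own part. -/
def ownStar (Q : V → Fin r) (u : V) : Finset (Sym2 V) := star u (cell Q (Q u))

lemma notMem_crossing_of_mem_ownStar {Q : V → Fin r} {u : V} {e : Sym2 V}
    (h : e ∈ ownStar Q u) : e ∉ crossing Q := by
  obtain ⟨z, hz, rfl⟩ := mem_image.1 h
  rw [mem_cell] at hz
  rw [mem_crossing, not_not, hz]

/-- Some cut within `a` of a maximum cut separates `u` from many of its non-neighbours in its
part of `Q`. -/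
def Flips (F : Finset (Sym2 V)) (Q : V → Fin r) (a : ℕ) (x : ℝ) (u : V) : Prop :=
  ∃ Q' : V → Fin r, Near F a Q' ∧ x ≤ #((ownStar Q u \ F) ∩ crossing Q')

/-- The potential is `cut F Q - cut F Q'`. It is nonnegative while `Q` is canonical, starts at most
at `a`, and drops whenever the added pair crosses `Q'`, since pairs of `ownStar Q u` never cross
`Q`. The choice of `T` makes κT - a - 1 at least κT/2. -/
lemma le_exitProb_of_flips {F : Finset (Sym2 V)} {Q : V → Fin r} {a T : ℕ} {κ : ℝ} {u : V}
    (hκ0 : 0 < κ) (hκ : κ ≤ 1) (hT : 2 * (a + 1) ≤ κ * T) (hQ : IsCanonical F Q)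
    (h : Flips F Q a (κ * #(ownStar Q u) + T) u) :
    κ / 2 ≤ exitProb (fun F => IsCanonical F Q) (ownStar Q u) T F := by
  obtain ⟨Q', hQ', hx⟩ := h
  have hle : ∀ F : Finset (Sym2 V), IsCanonical F Q → (0 : ℝ) ≤ cut F Q - cut F Q' := by
    intro F hF
    have : (cut F Q' : ℝ) ≤ cut F Q := by exact_mod_cast cut_le_of_score_le (hF Q')
    linarith
  have key := le_exitProb hκ0.le hκ (crossing Q') (fun F => (cut F Q : ℝ) - cut F Q')
    (A := fun F => IsCanonical F Q) (M := ownStar Q u) ?_ hle T F (by linarith [hle F hQ]) hx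
  · have h1 : (cut F Q : ℝ) ≤ cut F Q' + a := by exact_mod_cast hQ' Q
    have hT0 : (0 : ℝ) < T := by
      by_contra hneg
      have : (T : ℝ) = 0 := le_antisymm (not_lt.1 hneg) (Nat.cast_nonneg _)
      rw [this] at hT
      have : (0 : ℝ) ≤ a := Nat.cast_nonneg a
      linarith
    have h2 : κ / 2 * T ≤ T * exitProb (fun F => IsCanonical F Q) (ownStar Q u) T F := by
      linarith
    rw [mul_comm] at h2
    exact le_of_mul_le_mul_left h2 hT0
  · intro F e he
    obtain ⟨heM, heF⟩ := Finset.mem_sdiff.1 he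
    simp only [cut_insert heF, if_neg (notMem_crossing_of_mem_ownStar heM)]
    by_cases h : e ∈ crossing Q' <;> simp [ind, h]
    ring

/-- Each inner pair lies in the own stars of at most its two endpoints. -/
lemma sum_pivotalCount_ownStar_le (A : Finset (Sym2 V) → Prop) (F : Finset (Sym2 V))
    (Q : V → Fin r) :
    ∑ u, pivotalCount A (ownStar Q u) F ≤ 2 * pivotalCount A (crossing Q)ᶜ F := by
  unfold pivotalCount
  set g : Sym2 V → ℝ := fun e => ind (e ∉ F ∧ A F ∧ ¬ A (insert e F))
  have hg : ∀ e, 0 ≤ g e := fun e => ind_nonneg _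
  calc ∑ u, ∑ e ∈ ownStar Q u, g e
      ≤ ∑ u, ∑ e ∈ (crossing Q)ᶜ, if u ∈ e then g e else 0 := by
        refine sum_le_sum fun u _ => ?_
        rw [← sum_filter]
        refine sum_le_sum_of_subset_of_nonneg ?_ fun _ _ _ => hg _
        intro e he
        rw [mem_filter, mem_compl]
        exact ⟨notMem_crossing_of_mem_ownStar he, mem_of_mem_star he⟩
    _ = ∑ e ∈ (crossing Q)ᶜ, ∑ u, if u ∈ e then g e else 0 := sum_comm
    _ ≤ ∑ e ∈ (crossing Q)ᶜ, 2 * g e := by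
        refine sum_le_sum fun e _ => ?_
        rw [← sum_filter, sum_const, nsmul_eq_mul]
        refine mul_le_mul_of_nonneg_right ?_ (hg e)
        have : #(univ.filter fun u => u ∈ e) ≤ 2 := by
          induction e with
          | _ x y =>
            refine (card_le_card (t := {x, y}) ?_).trans card_le_two
            intro u hu
            simpa using hu
        exact_mod_cast this
    _ = _ := by rw [mul_sum]

lemma sum_ind_isCanonical [NeZero r] (F : Finset (Sym2 V)) (f : (V → Fin r) → ℝ) :
    ∑ Q : V → Fin r, ind (IsCanonical F Q) * f Q = f (canon F) := by
  rw [sum_eq_single (canon F)]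
  · rw [ind_true (canon_spec F), one_mul]
  · intro Q _ hQ
    rw [ind_false, zero_mul]
    intro h
    exact hQ (h.unique (canon_spec F))
  · simp

/-- The expected number of pivotal pairs inside the parts of the canonical maximum cut. -/
lemma sum_mean_pivotalCount [NeZero r] {p : ℝ} :
    p * ∑ Q : V → Fin r, mean p (pivotalCount (fun F => IsCanonical F Q) (crossing Q)ᶜ) =
      mean p fun F => p * #(crossing (canon F : V → Fin r))ᶜ -
        #(F ∩ (crossing (canon F : V → Fin r))ᶜ) := by
  -- For a fixed `Q` the inner pairs do not depend on `F`, and the family is decreasing in each of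
  -- them, so `mean_pivotal` applies pair by pair.
  have h1 : ∀ Q : V → Fin r, p * mean p (pivotalCount (fun F => IsCanonical F Q) (crossing Q)ᶜ) =
      mean p fun F => ind (IsCanonical F Q) * (p * #(crossing Q)ᶜ - #(F ∩ (crossing Q)ᶜ)) := by
    intro Q
    unfold pivotalCount
    rw [mean_sum, mul_sum]
    have h2 : ∀ e ∈ (crossing Q)ᶜ,
        p * mean p (fun F => ind (e ∉ F ∧ IsCanonical F Q ∧ ¬ IsCanonical (insert e F) Q)) =
        mean p (fun F => ind (IsCanonical F Q) * (p - ind (e ∈ F))) := fun e he =>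
      mean_pivotal e fun F hF => hF.erase (mem_compl.1 he)
    rw [sum_congr rfl h2, ← mean_sum]
    congr 1; ext F
    rw [← mul_sum, sum_sub_distrib, sum_const, nsmul_eq_mul, mul_comm p]
    congr 2
    have : ∀ e, ind (e ∈ F) = if e ∈ F then (1 : ℝ) else 0 := fun e => by
      by_cases h : e ∈ F <;> simp [ind, h]
    simp only [this, sum_ite_mem, sum_const]
    rw [inter_comm]; simp
  rw [mul_sum, sum_congr rfl fun Q _ => h1 Q, ← mean_sum]
  congr 1; ext F
  exact sum_ind_isCanonical F fun Q => p * #(crossing Q)ᶜ - #(F ∩ (crossing Q)ᶜ)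

/-- Under discrepancy each of the `r` parts has a deficit of at most `t`; on the exceptional event
the trivial bound n² is used. -/
lemma mean_inner_deficit_le [NeZero r] {p t : ℝ} (h0 : 0 ≤ p) (h1 : p ≤ 1) (ht : 0 ≤ t) :
    mean p (fun F => p * #(crossing (canon F : V → Fin r))ᶜ -
        #(F ∩ (crossing (canon F : V → Fin r))ᶜ)) ≤
      r * t + (Fintype.card V : ℝ) ^ 2 *
        prob p (fun F : Finset (Sym2 V) => ¬ Discrepancy p t F) := by
  unfold prob
  rw [← mean_const_mul, ← mean_const (E := Sym2 V) (p := p) (r * t), ← mean_add]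
  refine mean_mono h0 h1 fun F => ?_
  set Q : V → Fin r := canon F
  by_cases hF : Discrepancy p t F
  · rw [ind_false (not_not.2 hF), mul_zero, add_zero]
    have e1 : #(crossing Q)ᶜ = ∑ i, #(cell Q i).sym2 := by
      have := card_inter_compl_crossing univ Q
      simpa only [univ_inter] using this
    rw [card_inter_compl_crossing, e1]
    push_cast
    rw [mul_sum, ← sum_sub_distrib]
    calc _ ≤ ∑ i : Fin r, t :=
          sum_le_sum fun i _ => by linarith [(abs_le.1 (hF (cell Q i))).1]
      _ = r * t := by simp
  · rw [ind_true hF, mul_one]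
    have e2 : (#(crossing Q)ᶜ : ℝ) ≤ (Fintype.card V : ℝ) ^ 2 := by
      have h2 : (#(crossing Q)ᶜ : ℝ) ≤ #((univ : Finset V).sym2) := by
        exact_mod_cast card_le_card (by simp)
      rw [card_sym2_real, card_univ] at h2
      have h3 : (Fintype.card V : ℝ) ≤ (Fintype.card V : ℝ) ^ 2 := by
        have : Fintype.card V ≤ (Fintype.card V) ^ 2 := Nat.le_self_pow two_ne_zero _
        exact_mod_cast this
      nlinarith
    have e3 : p * (#(crossing Q)ᶜ : ℝ) ≤ 1 * #(crossing Q)ᶜ := by gcongr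
    have e4 : (0 : ℝ) ≤ #(F ∩ (crossing Q)ᶜ) := Nat.cast_nonneg _
    have e5 : 0 ≤ r * t := by positivity
    linarith

/-- The expected number of vertices with few neighbours in their part that can change sides at a
small cost. -/
theorem mean_card_flips_le [NeZero r] {p ν lam κ ρ t : ℝ} {a T : ℕ} (h0 : 0 < p) (h1 : p ≤ 1)
    (hν : 0 < ν) (hlam : 0 ≤ lam) (hκ0 : 0 < κ) (hκ : κ ≤ 1) (ht : 0 ≤ t)
    (hT : 2 * (a + 1) ≤ κ * T) (hTν : T ≤ lam * p * ν) (hρ : 1 ≤ ρ)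
    (hlam1 : p * (1 + 2 * lam) < 1)
    (hρp : (1 - p) * (1 + 2 * lam) ≤ ρ * (1 - p * (1 + 2 * lam))) :
    mean p (fun F => ∑ u : V, ind (ν ≤ #(ownStar (canon F : V → Fin r) u) ∧
        (#(F ∩ ownStar (canon F : V → Fin r) u) : ℝ) ≤
          (1 + lam) * p * #(ownStar (canon F : V → Fin r) u) ∧
        Flips F (canon F : V → Fin r) a (κ * #(ownStar (canon F : V → Fin r) u) + T) u)) ≤
      2 / κ * (T * ρ ^ T / (ν * (1 - p * (1 + 2 * lam)))) * (2 / p *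
        (r * t + (Fintype.card V : ℝ) ^ 2 *
          prob p (fun F : Finset (Sym2 V) => ¬ Discrepancy p t F))) := by
  set c := ν * (1 - p * (1 + 2 * lam)) with hc
  have hc0 : 0 < c := mul_pos hν (by linarith)
  let X : (V → Fin r) → V → Finset (Sym2 V) → Prop := fun Q u F =>
    ν ≤ #(ownStar Q u) ∧ (#(F ∩ ownStar Q u) : ℝ) ≤ (1 + lam) * p * #(ownStar Q u) ∧
      Flips F Q a (κ * #(ownStar Q u) + T) u
  -- `Q` is fixed here and recovered by summing over all cuts, of which exactly one is canonical. As
  -- the bound is proportional to the pivotal count of `Q`, the sum loses nothing, and no union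
  -- bound over cuts is needed.
  have key : ∀ Q u, mean p (fun F => ind (IsCanonical F Q) * ind (X Q u F)) ≤
      2 / κ * (T * ρ ^ T / c) * mean p (pivotalCount (fun F => IsCanonical F Q) (ownStar Q u)) := by
    intro Q u
    have hP : 0 ≤ mean p (pivotalCount (fun F => IsCanonical F Q) (ownStar Q u)) :=
      mean_nonneg h0.le h1 pivotalCount_nonneg
    by_cases hm : ν ≤ #(ownStar Q u)
    swap
    · have : (fun F => ind (IsCanonical F Q) * ind (X Q u F)) = fun _ => 0 := by
        ext F
        rw [ind_false (P := X Q u F) (fun h => hm h.1), mul_zero]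
      rw [this, mean_const]
      positivity
    set m : ℝ := (#(ownStar Q u) : ℝ) with hmdef
    have hm0 : 0 < m := by linarith
    -- The inner degree starts below (1 + lam) p m and may grow to (1 + 2 lam) p m; by `hTν` this
    -- window has room for `T` additions.
    have hflow := mean_exitProb_le (A := fun F => IsCanonical F Q) (M := ownStar Q u)
      (ρ := ρ) (Kmax := p * (1 + 2 * lam) * m) h0 h1 hρ (by nlinarith)
      (by
        have := mul_le_mul_of_nonneg_left hρp (mul_nonneg h0.le hm0.le)
        rw [← hmdef]
        linarith) T ((1 + lam) * p * m)
      (by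
        have : lam * p * ν ≤ lam * p * m := by gcongr
        linarith)
    rw [← hmdef] at hflow
    have hmc : c ≤ m - p * (1 + 2 * lam) * m := by
      have : ν * (1 - p * (1 + 2 * lam)) ≤ m * (1 - p * (1 + 2 * lam)) := by
        have : 0 ≤ 1 - p * (1 + 2 * lam) := by linarith
        gcongr
      rw [hc]; linarith
    calc mean p (fun F => ind (IsCanonical F Q) * ind (X Q u F))
        ≤ mean p (fun F => 2 / κ * (ind (IsCanonical F Q ∧ (#(F ∩ ownStar Q u) : ℝ) ≤
            (1 + lam) * p * m) * exitProb (fun F => IsCanonical F Q) (ownStar Q u) T F)) := by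
          refine mean_mono h0.le h1 fun F => ?_
          rw [← ind_and]
          by_cases h : IsCanonical F Q ∧ X Q u F
          · obtain ⟨hcan, hX⟩ := h
            rw [ind_true ⟨hcan, hX⟩, ind_true ⟨hcan, hX.2.1⟩, one_mul]
            have := le_exitProb_of_flips hκ0 hκ hT hcan hX.2.2
            calc (1 : ℝ) = 2 / κ * (κ / 2) := by field_simp
              _ ≤ _ := by gcongr
          · rw [ind_false h]
            have := exitProb_nonneg (A := fun F => IsCanonical F Q) (M := ownStar Q u) T F
            have := ind_nonneg (IsCanonical F Q ∧ (#(F ∩ ownStar Q u) : ℝ) ≤ (1 + lam) * p * m)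
            positivity
      _ = 2 / κ * mean p (fun F => ind (IsCanonical F Q ∧ (#(F ∩ ownStar Q u) : ℝ) ≤
            (1 + lam) * p * m) * exitProb (fun F => IsCanonical F Q) (ownStar Q u) T F) :=
          mean_const_mul _ _
      _ ≤ 2 / κ * (T * ρ ^ T * (mean p (pivotalCount (fun F => IsCanonical F Q) (ownStar Q u)) /
            (m - p * (1 + 2 * lam) * m))) := by gcongr
      _ ≤ 2 / κ * (T * ρ ^ T *
            (mean p (pivotalCount (fun F => IsCanonical F Q) (ownStar Q u)) / c)) := by gcongr
      _ = _ := by ring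
  have hsum : (fun F => ∑ u : V, ind (X (canon F) u F)) =
      fun F => ∑ u : V, ∑ Q : V → Fin r, ind (IsCanonical F Q) * ind (X Q u F) := by
    ext F
    exact sum_congr rfl fun u _ => (sum_ind_isCanonical F fun Q => ind (X Q u F)).symm
  change mean p (fun F => ∑ u : V, ind (X (canon F) u F)) ≤ _
  rw [hsum, mean_sum]
  simp only [mean_sum]
  have hB : 0 ≤ 2 / κ * (T * ρ ^ T / c) := by positivity
  calc ∑ u, ∑ Q : V → Fin r, mean p (fun F => ind (IsCanonical F Q) * ind (X Q u F))
      ≤ ∑ u, ∑ Q : V → Fin r, 2 / κ * (T * ρ ^ T / c) *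
          mean p (pivotalCount (fun F => IsCanonical F Q) (ownStar Q u)) :=
        sum_le_sum fun u _ => sum_le_sum fun Q _ => key Q u
    _ = 2 / κ * (T * ρ ^ T / c) * ∑ Q : V → Fin r, mean p (fun F =>
          ∑ u, pivotalCount (fun F => IsCanonical F Q) (ownStar Q u) F) := by
        rw [sum_comm, mul_sum]
        refine sum_congr rfl fun Q _ => ?_
        rw [mean_sum, mul_sum]
    _ ≤ 2 / κ * (T * ρ ^ T / c) * ∑ Q : V → Fin r, mean p (fun F =>
          2 * pivotalCount (fun F => IsCanonical F Q) (crossing Q)ᶜ F) := by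
        gcongr with Q
        refine mean_mono h0.le h1 fun F => ?_
        exact sum_pivotalCount_ownStar_le _ F Q
    _ = 2 / κ * (T * ρ ^ T / c) * (2 / p * mean p (fun F =>
          p * #(crossing (canon F : V → Fin r))ᶜ - #(F ∩ (crossing (canon F : V → Fin r))ᶜ))) := by
        rw [← sum_mean_pivotalCount]
        simp only [mean_const_mul]
        rw [← mul_sum]
        field_simp
    _ ≤ _ := by
        gcongr
        exact mean_inner_deficit_le h0.le h1 ht

end RandomCut

namespace RandomCut

open Finset RandomSubset

/-! ### Vertices on which all near-maximum cuts agree -/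

variable {V : Type*} [Fintype V] [DecidableEq V] {r : ℕ}

/-- No cut into `r` parts within `a` of a maximum cut separates `x` and `z`. -/
def Inseparable (r : ℕ) (F : Finset (Sym2 V)) (a : ℕ) (x z : V) : Prop :=
  ∀ Q : V → Fin r, Near F a Q → Q x = Q z

open Classical in
/-- The vertices that are inseparable from few others. -/
noncomputable def unstable (r : ℕ) (F : Finset (Sym2 V)) (a : ℕ) : Finset V :=
  univ.filter fun x => 3 * r * #(univ.filter fun z => Inseparable r F a x z) ≤ 2 * Fintype.card V

/-- Allowing more cuts leaves fewer inseparable pairs, hence more unstable vertices. -/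
lemma unstable_subset_of_near {F F' : Finset (Sym2 V)} {a b : ℕ}
    (h : ∀ Q : V → Fin r, Near F a Q → Near F' b Q) : unstable r F a ⊆ unstable r F' b := by
  classical
  intro x hx
  simp only [unstable, mem_filter, mem_univ, true_and] at hx ⊢
  refine le_trans (Nat.mul_le_mul_left _ (card_le_card fun z hz => ?_)) hx
  simp only [mem_filter, mem_univ, true_and] at hz ⊢
  exact fun Q hQ => hz Q (h Q hQ)

/-- Two near-maximum cuts agree outside of the unstable vertices, up to the names of the parts. -/
lemma Balanced.exists_cell_eq {F : Finset (Sym2 V)} {a : ℕ} {δ : ℝ} (hB : Balanced r F a δ)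
    (hr : 0 < r) (hV : 0 < Fintype.card V) (hδ : δ * r < 1 / 3)
    (hU : 2 * r * #(unstable r F a) ≤ Fintype.card V)
    {Q Q' : V → Fin r} (hQ : Near F a Q) (hQ' : Near F a Q') (i : Fin r) :
    ∃ i', ∀ z ∉ unstable r F a, (Q z = i ↔ Q' z = i') := by
  classical
  have hr0 : (0 : ℝ) < r := by exact_mod_cast hr
  have hV0 : (0 : ℝ) < Fintype.card V := by exact_mod_cast hV
  have hcell : ∀ R : V → Fin r, Near F a R → ∀ j, 3 * r * #(cell R j) < 4 * Fintype.card V := by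
    intro R hR j
    have h1 := (abs_le.1 (hB R hR j)).2
    have h2 : (3 * r * #(cell R j) : ℝ) < 4 * Fintype.card V := by
      have h3 : (#(cell R j) : ℝ) ≤ Fintype.card V / r + δ * Fintype.card V := by linarith
      calc (3 * r * #(cell R j) : ℝ) ≤ 3 * r * (Fintype.card V / r + δ * Fintype.card V) := by gcongr
        _ = 3 * Fintype.card V + 3 * (δ * r) * Fintype.card V := by field_simp
        _ < _ := by nlinarith
    exact_mod_cast h2
  -- Each part outnumbers the unstable vertices, so it contains a stable vertex to serve as its
  -- representative.
  have hlow : #(unstable r F a) < #(cell Q i) := by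
    have h1 := (abs_le.1 (hB Q hQ i)).1
    have h2 : (2 * r * #(unstable r F a) : ℝ) ≤ Fintype.card V := by exact_mod_cast hU
    have h3 : (2 * r * #(unstable r F a) : ℝ) < 2 * r * #(cell Q i) := by
      have h3 : (Fintype.card V / r : ℝ) - δ * Fintype.card V ≤ (#(cell Q i) : ℝ) := by linarith
      have h4 : (2 * r * (Fintype.card V / r - δ * Fintype.card V) : ℝ) =
        2 * Fintype.card V - 2 * (δ * r) * Fintype.card V := by field_simp
      have h5 : 2 * r * (Fintype.card V / r - δ * Fintype.card V) ≤ (2 * r * #(cell Q i) : ℝ) := by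
        gcongr
      nlinarith
    have := lt_of_mul_lt_mul_left h3 (by positivity)
    exact_mod_cast this
  obtain ⟨x, hx, hxU⟩ := exists_mem_notMem_of_card_lt_card hlow
  rw [mem_cell] at hx
  have key : ∀ R : V → Fin r, Near F a R → ∀ z ∉ unstable r F a, R z = R x →
      Inseparable r F a x z := by
    intro R hR z hz hzx
    simp only [unstable, mem_filter, mem_univ, true_and, not_le] at hz hxU
    set cx := univ.filter fun w => Inseparable r F a x w
    set cz := univ.filter fun w => Inseparable r F a z w
    have h1 : cx ⊆ cell R (R x) := fun w hw => by
      simp only [cx, mem_filter, mem_univ, true_and] at hw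
      rw [mem_cell]; exact (hw R hR).symm
    have h2 : cz ⊆ cell R (R x) := fun w hw => by
      simp only [cz, mem_filter, mem_univ, true_and] at hw
      rw [mem_cell, ← hzx]; exact (hw R hR).symm
    -- Both classes lie in one part of size below 4n/(3r), while stability makes each larger than
    -- 2n/(3r); so they meet. This is the reason for the threshold in `unstable`.
    have h3 : ¬ Disjoint cx cz := by
      intro hd
      have h4 : #cx + #cz ≤ #(cell R (R x)) := by
        rw [← card_union_of_disjoint hd]; exact card_le_card (union_subset h1 h2)
      have h5 := hcell R hR (R x)
      have h6 : 3 * r * (#cx + #cz) ≤ 3 * r * #(cell R (R x)) := Nat.mul_le_mul_left _ h4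
      rw [mul_add] at h6
      omega
    obtain ⟨w, hwx, hwz⟩ := not_disjoint_iff.1 h3
    simp only [cx, cz, mem_filter, mem_univ, true_and] at hwx hwz
    intro R' hR'
    rw [hwx R' hR', hwz R' hR']
  refine ⟨Q' x, fun z hz => ⟨fun h => ?_, fun h => ?_⟩⟩
  · exact (key Q hQ z hz (h.trans hx.symm) Q' hQ').symm
  · exact (key Q' hQ' z hz h Q hQ).symm.trans hx

/-! ### Counting pairs between sets -/

/-- Expresses pairs between disjoint sets through pairs inside sets, so that discrepancy also
controls bipartite densities. -/
lemma card_between_add_le (F : Finset (Sym2 V)) {A B : Finset V} (hAB : Disjoint A B) :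
    #((A ×ˢ B).filter fun x => s(x.1, x.2) ∈ F) + #(F ∩ A.sym2) + #(F ∩ B.sym2) ≤
      #(F ∩ (A ∪ B).sym2) := by
  have hinj : Set.InjOn (fun x : V × V => s(x.1, x.2))
      ((A ×ˢ B).filter fun x => s(x.1, x.2) ∈ F : Finset (V × V)) := by
    rintro ⟨x, y⟩ hx ⟨x', y'⟩ hx' h
    simp only [coe_filter, mem_product, Set.mem_ofPred_eq] at hx hx'
    rcases Sym2.eq_iff.1 h with ⟨rfl, rfl⟩ | ⟨rfl, rfl⟩
    · rfl
    · exact absurd hx'.1.2 (Finset.disjoint_left.1 hAB hx.1.1)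
  rw [← card_image_of_injOn hinj, ← card_union_of_disjoint, ← card_union_of_disjoint]
  · apply card_le_card
    intro e he
    induction e with
    | _ u v =>
      simp only [mem_union, mem_image, mem_filter, mem_product, mem_inter, mk_mem_sym2_iff] at he ⊢
      rcases he with (⟨⟨x, y⟩, ⟨⟨hx, hy⟩, hF⟩, h⟩ | h) | h
      · rw [← h]
        refine ⟨hF, ?_⟩
        rcases Sym2.eq_iff.1 h with ⟨h1, h2⟩ | ⟨h1, h2⟩ <;> subst h1 <;> subst h2 <;> tauto
      · tauto
      · tauto
  · rw [Finset.disjoint_left]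
    intro e he he'
    induction e with
    | _ u v =>
      simp only [mem_union, mem_image, mem_filter, mem_product, mem_inter, mk_mem_sym2_iff] at he he'
      have hd := Finset.disjoint_left.1 hAB
      rcases he with ⟨⟨x, y⟩, ⟨⟨hx, hy⟩, hF⟩, h⟩ | h
      · rcases Sym2.eq_iff.1 h with ⟨h1, h2⟩ | ⟨h1, h2⟩
        · exact hd hx (h1 ▸ he'.2.1)
        · exact hd hx (h1 ▸ he'.2.2)
      · exact hd h.2.1 he'.2.1
  · rw [Finset.disjoint_left]
    intro e he he'
    induction e with
    | _ u v =>
      simp only [mem_image, mem_filter, mem_product, mem_inter, mk_mem_sym2_iff] at he he'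
      have hd := Finset.disjoint_left.1 hAB
      obtain ⟨⟨x, y⟩, ⟨⟨hx, hy⟩, hF⟩, h⟩ := he
      rcases Sym2.eq_iff.1 h with ⟨h1, h2⟩ | ⟨h1, h2⟩
      · exact hd he'.2.2 (h2 ▸ hy)
      · exact hd he'.2.1 (h2 ▸ hy)

/-- A pair inside `C` is counted once per endpoint in `X`, so pairs inside `X` may count twice.
Loops in `X` count once on the left and twice on the right, whence only an inequality. -/
lemma sum_card_star_add_le (F : Finset (Sym2 V)) {X C : Finset V} (hXC : X ⊆ C) :
    ∑ u ∈ X, #(F ∩ star u C) + #(F ∩ (C \ X).sym2) ≤ #(F ∩ C.sym2) + #(F ∩ X.sym2) := by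
  have hc : ∀ B : Finset (Sym2 V), #(F ∩ B) = ∑ e ∈ F, if e ∈ B then 1 else 0 := by
    intro B; rw [← filter_mem_eq_inter, card_filter]
  simp only [hc]
  rw [sum_comm, ← sum_add_distrib, ← sum_add_distrib]
  refine sum_le_sum fun e _ => ?_
  rw [← card_filter]
  induction e with
  | _ x y =>
    simp only [mk_mem_sym2_iff, mem_star, Finset.mem_sdiff]
    by_cases hx : x ∈ C
    swap
    · rw [filter_false_of_mem, card_empty]
      · simp [hx]
      · rintro u hu (⟨rfl, h⟩ | ⟨rfl, h⟩)
        · exact hx (hXC hu)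
        · exact hx h
    by_cases hy : y ∈ C
    swap
    · rw [filter_false_of_mem, card_empty]
      · simp [hy]
      · rintro u hu (⟨rfl, h⟩ | ⟨rfl, h⟩)
        · exact hy h
        · exact hy (hXC hu)
    have hsub : (X.filter fun u => x = u ∧ y ∈ C ∨ y = u ∧ x ∈ C) ⊆
        ({x} : Finset V).filter (· ∈ X) ∪ ({y} : Finset V).filter (· ∈ X) := by
      intro u hu
      simp only [mem_filter, mem_union, mem_singleton] at hu ⊢
      tauto
    have hle := (card_le_card hsub).trans (card_union_le _ _)
    simp only [card_filter, sum_singleton] at hle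
    by_cases hx' : x ∈ X <;> by_cases hy' : y ∈ X <;> simp [hx, hy, hx', hy'] at hle ⊢ <;> omega

/-- Few vertices have many more neighbours in their part than expected. -/
lemma Discrepancy.card_high_le {p t lam : ℝ} {F : Finset (Sym2 V)} (hF : Discrepancy p t F)
    (h0 : 0 < p) (hlam : 0 < lam) (hr : 0 < r) (Q : V → Fin r)
    (hQ : ∀ i, (Fintype.card V : ℝ) ≤ 2 * r * #(cell Q i)) (hn : 4 * r ≤ lam * Fintype.card V)
    (X : Finset V) (hX : ∀ u ∈ X, (1 + lam) * p * #(ownStar Q u) < #(F ∩ ownStar Q u)) :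
    (#X : ℝ) * (lam * p * Fintype.card V) ≤ 12 * r ^ 2 * t := by
  have hr0 : (0 : ℝ) < r := by exact_mod_cast hr
  have key : ∀ i, (#(X ∩ cell Q i) : ℝ) * (lam * p * Fintype.card V) ≤ 12 * r * t := by
    intro i
    set C := cell Q i
    set Y := X ∩ C
    have hYC : Y ⊆ C := inter_subset_right
    have h1 : (∑ u ∈ Y, #(F ∩ star u C) : ℝ) + #(F ∩ (C \ Y).sym2) ≤
        #(F ∩ C.sym2) + #(F ∩ Y.sym2) := by exact_mod_cast sum_card_star_add_le F hYC
    have h2 : (#Y : ℝ) * ((1 + lam) * p * #C) ≤ ∑ u ∈ Y, (#(F ∩ star u C) : ℝ) := by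
      rw [← nsmul_eq_mul, ← sum_const]
      refine sum_le_sum fun u hu => ?_
      obtain ⟨huX, huC⟩ := mem_inter.1 hu
      have := hX u huX
      rw [mem_cell] at huC
      unfold ownStar at this
      rw [huC, card_star] at this
      exact this.le
    have h3 := (abs_le.1 (hF C)).2
    have h4 := (abs_le.1 (hF Y)).2
    have h5 := (abs_le.1 (hF (C \ Y))).1
    have h6 : (#(C \ Y) : ℝ) = #C - #Y := by
      have := card_sdiff_add_card_eq_card hYC
      have : (#(C \ Y) : ℝ) + #Y = #C := by exact_mod_cast this
      linarith
    rw [card_sym2_real] at h3 h4 h5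
    rw [h6] at h5
    -- The expected counts leave p (#C #Y + #Y); the term `-p` comes from loops, and each of the
    -- three discrepancies costs `t`.
    have h7 : (#Y : ℝ) * (lam * p * #C - p) ≤ 3 * t := by linarith
    have h8 : (Fintype.card V : ℝ) * (lam * p) ≤ 4 * r * (lam * p * #C - p) := by
      have e1 := mul_le_mul_of_nonneg_right (hQ i) (mul_nonneg hlam.le h0.le)
      have e2 := mul_le_mul_of_nonneg_right hn h0.le
      change _ ≤ 2 * r * (#C : ℝ) * (lam * p) at e1
      linarith
    have h9 : (0 : ℝ) ≤ #Y := Nat.cast_nonneg _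
    calc (#Y : ℝ) * (lam * p * Fintype.card V) = #Y * (Fintype.card V * (lam * p)) := by ring
      _ ≤ #Y * (4 * r * (lam * p * #C - p)) := by gcongr
      _ = 4 * r * (#Y * (lam * p * #C - p)) := by ring
      _ ≤ 4 * r * (3 * t) := by gcongr
      _ = _ := by ring
  have hsum : (#X : ℝ) = ∑ i, (#(X ∩ cell Q i) : ℝ) := by
    have : #X = ∑ i, #(X ∩ cell Q i) := by
      rw [card_eq_sum_card_fiberwise (f := Q) (t := univ) fun _ _ => mem_univ _]
      refine sum_congr rfl fun i _ => ?_
      congr 1; ext u; simp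
    exact_mod_cast this
  rw [hsum, sum_mul]
  refine (sum_le_sum fun i _ => key i).trans ?_
  rw [sum_const, card_univ, Fintype.card_fin, nsmul_eq_mul]
  apply le_of_eq; ring

/-- If no vertex outside of a small set `S` can change sides at a small cost, then only vertices
of `S` are unstable. -/
theorem Discrepancy.unstable_subset {p t lam δ y : ℝ} {F : Finset (Sym2 V)} {a : ℕ}
    (hF : Discrepancy p t F) (hr : 0 < r) (hp1 : p < 1) (hV : 0 < Fintype.card V) (ht : 0 ≤ t)
    (hB : Balanced r F a δ) {Q : V → Fin r} (hQ : Near F a Q) (S : Finset V)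
    (hS1 : ∀ u ∉ S, (#(F ∩ ownStar Q u) : ℝ) ≤ (1 + lam) * p * #(ownStar Q u))
    (hS2 : ∀ u ∉ S, ¬ Flips F Q a y u)
    (hδ : 4 * r * δ ≤ 1) (hSδ : 24 * r * (#S : ℝ) ≤ Fintype.card V) (hlam : (1 + lam) * p ≤ 1)
    (hnum : 4 * r * ((y + #S) * (1 - p) + y + 12 * r ^ 2 * t / Fintype.card V) <
      Fintype.card V * (1 - (1 + lam) * p) * (1 - p)) :
    unstable r F a ⊆ S := by
  classical
  have hr0 : (0 : ℝ) < r := by exact_mod_cast hr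
  set n : ℝ := (Fintype.card V : ℝ) with hn
  have hn0 : 0 < n := by rw [hn]; exact_mod_cast hV
  have hcell : ∀ j, 3 * n ≤ 4 * r * #(cell Q j) := by
    intro j
    have h1 := (abs_le.1 (hB Q hQ j)).1
    have h2 : n / r - δ * n ≤ #(cell Q j) := by linarith
    have h3 : 4 * r * (n / r - δ * n) ≤ 4 * r * (#(cell Q j) : ℝ) := by gcongr
    have h4 : 4 * r * (n / r - δ * n) = 4 * n - (4 * r * δ) * n := by field_simp
    have h5 : (4 * r * δ) * n ≤ 1 * n := by gcongr
    linarith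
  have main : ∀ j, ∀ Q' : V → Fin r, Near F a Q' → ∀ u ∈ cell Q j \ S, ∀ u' ∈ cell Q j \ S,
      Q' u = Q' u' := by
    intro j Q' hQ' u₁ hu₁ u₂ hu₂
    set C := cell Q j \ S with hC
    have hCcard : 2 * n ≤ 4 * r * (#C : ℝ) := by
      have h1 : (#(cell Q j) : ℝ) ≤ #C + #S := by
        have := card_le_card_sdiff_add_card (s := cell Q j) (t := S)
        exact_mod_cast this
      have h2 : 4 * r * (#(cell Q j) : ℝ) ≤ 4 * r * (#C + #S) := by gcongr
      have := hcell j
      linarith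
    -- the largest class of `Q'` inside `C`
    obtain ⟨l, -, hl⟩ := exists_max_image (univ : Finset (Fin r)) (fun l => #(C ∩ cell Q' l))
      ⟨⟨0, hr⟩, mem_univ _⟩
    set A := C ∩ cell Q' l with hA
    set B := C \ cell Q' l with hBdef
    have hAcard : (#C : ℝ) ≤ r * #A := by
      have h1 : #C = ∑ l, #(C ∩ cell Q' l) := by
        rw [card_eq_sum_card_fiberwise (f := Q') (t := univ) fun _ _ => mem_univ _]
        refine sum_congr rfl fun i _ => ?_
        congr 1; ext u; simp
      have h2 : #C ≤ ∑ _l : Fin r, #A := by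
        rw [h1]; exact sum_le_sum fun i _ => hl i (mem_univ i)
      simp only [sum_const, card_univ, Fintype.card_fin, smul_eq_mul] at h2
      exact_mod_cast h2
    have hA0 : n ≤ 2 * r ^ 2 * (#A : ℝ) := by
      have := mul_le_mul_of_nonneg_left hAcard hr0.le
      nlinarith
    have hApos : (0 : ℝ) < #A := by
      by_contra hneg
      have : (#A : ℝ) = 0 := le_antisymm (not_lt.1 hneg) (Nat.cast_nonneg _)
      rw [this] at hA0; linarith
    suffices hBe : B = ∅ by
      have h3 : ∀ u ∈ C, Q' u = l := by
        intro u hu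
        by_contra hne
        have : u ∈ B := by rw [hBdef, Finset.mem_sdiff, mem_cell]; exact ⟨hu, hne⟩
        rw [hBe] at this
        exact absurd this (notMem_empty u)
      rw [h3 u₁ hu₁, h3 u₂ hu₂]
    by_contra hBne
    obtain ⟨u, huB⟩ := nonempty_iff_ne_empty.2 hBne
    have hgood : ∀ v ∈ C, (#((ownStar Q v \ F) ∩ crossing Q') : ℝ) < y := by
      intro v hv
      have := hS2 v (Finset.mem_sdiff.1 hv).2
      unfold Flips at this
      push Not at this
      exact this Q' hQ'
    have hQC : ∀ v ∈ C, Q v = j := fun v hv => by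
      have := (Finset.mem_sdiff.1 hv).1
      rwa [mem_cell] at this
    have hAC : A ⊆ C := inter_subset_left
    have hBC : B ⊆ C := sdiff_subset
    have hAB : Disjoint A B := by
      rw [Finset.disjoint_left]
      intro x hxA hxB
      exact (Finset.mem_sdiff.1 hxB).2 (mem_inter.1 hxA).2
    have hlabel : ∀ v ∈ A, ∀ w ∈ B, Q' v ≠ Q' w := by
      intro v hv w hw h
      have h1 := (mem_inter.1 hv).2
      have h2 := (Finset.mem_sdiff.1 hw).2
      rw [mem_cell] at h1 h2
      exact h2 (h ▸ h1)
    -- there are few pairs of non-neighbours between `A` and `B`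
    have hfew : (#A : ℝ) * #B - #((A ×ˢ B).filter fun x => s(x.1, x.2) ∈ F) ≤ #A * y := by
      have h1 : #((A ×ˢ B).filter fun x => s(x.1, x.2) ∈ F) +
          #((A ×ˢ B).filter fun x => ¬ s(x.1, x.2) ∈ F) = #A * #B := by
        rw [card_filter_add_card_filter_not, card_product]
      have h2 : #((A ×ˢ B).filter fun x => ¬ s(x.1, x.2) ∈ F) =
          ∑ v ∈ A, #(B.filter fun w => s(v, w) ∉ F) := by
        rw [card_filter, sum_product]
        refine sum_congr rfl fun v _ => ?_
        rw [card_filter]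
      have h3 : (#((A ×ˢ B).filter fun x => ¬ s(x.1, x.2) ∈ F) : ℝ) ≤ #A * y := by
        rw [h2]
        push_cast
        rw [← nsmul_eq_mul, ← sum_const]
        refine sum_le_sum fun v hv => ?_
        refine le_trans ?_ (hgood v (hAC hv)).le
        have : #(B.filter fun w => s(v, w) ∉ F) ≤ #((ownStar Q v \ F) ∩ crossing Q') := by
          rw [← card_image_of_injective _ (mk_left_injective v)]
          refine card_le_card fun e he => ?_
          obtain ⟨w, hw, rfl⟩ := mem_image.1 he
          obtain ⟨hwB, hwF⟩ := mem_filter.1 hw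
          rw [mem_inter, Finset.mem_sdiff, mem_crossing]
          refine ⟨⟨?_, hwF⟩, hlabel v hv w hwB⟩
          rw [ownStar, mk_mem_star, mem_cell, hQC v (hAC hv), hQC w (hBC hwB)]
        exact_mod_cast this
      have h4 : (#((A ×ˢ B).filter fun x => s(x.1, x.2) ∈ F) : ℝ) +
          #((A ×ˢ B).filter fun x => ¬ s(x.1, x.2) ∈ F) = #A * #B := by exact_mod_cast h1
      linarith
    -- Discrepancy puts about `p #A #B` pairs of `F` between `A` and `B`, whereas almost all pairs
    -- there are in `F`. As `A` has at least n/(2r²) vertices, `B` must be small.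
    have hBsmall : (1 - p) * #B ≤ y + 6 * r ^ 2 * t / n := by
      have h1 : (#((A ×ˢ B).filter fun x => s(x.1, x.2) ∈ F) : ℝ) + #(F ∩ A.sym2) +
          #(F ∩ B.sym2) ≤ #(F ∩ (A ∪ B).sym2) := by exact_mod_cast card_between_add_le F hAB
      have h2 := (abs_le.1 (hF (A ∪ B))).2
      have h3 := (abs_le.1 (hF A)).1
      have h4 := (abs_le.1 (hF B)).1
      rw [card_sym2_real] at h2 h3 h4
      have h5 : (#(A ∪ B) : ℝ) = #A + #B := by exact_mod_cast card_union_of_disjoint hAB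
      rw [h5] at h2
      have h6 : (#A : ℝ) * ((1 - p) * #B - y) ≤ 3 * t := by linarith
      have h7 : (1 - p) * #B - y ≤ 6 * r ^ 2 * t / n := by
        rw [le_div_iff₀ hn0]
        by_cases hneg : (1 - p) * #B - y ≤ 0
        · exact (mul_nonpos_of_nonpos_of_nonneg hneg hn0.le).trans (by positivity)
        · push Not at hneg
          calc ((1 - p) * #B - y) * n ≤ ((1 - p) * #B - y) * (2 * r ^ 2 * #A) := by gcongr
            _ = 2 * r ^ 2 * (#A * ((1 - p) * #B - y)) := by ring
            _ ≤ 2 * r ^ 2 * (3 * t) := by gcongr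
            _ = _ := by ring
      linarith
    -- but `u` has many non-neighbours in its part
    have hu := hS1 u (Finset.mem_sdiff.1 (hBC huB)).2
    have huy := hgood u (hBC huB)
    -- A pair from `u` to its part that is neither in `F` nor separated by `Q'` ends in the same
    -- class of `Q'` as `u`, hence in `B`, or in `S`.
    have hcover : #(ownStar Q u) ≤ #(F ∩ ownStar Q u) + #((ownStar Q u \ F) ∩ crossing Q') +
        (#B + #S) := by
      have hsub : ownStar Q u ⊆ ((F ∩ ownStar Q u) ∪ ((ownStar Q u \ F) ∩ crossing Q')) ∪
          star u (B ∪ S) := by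
        intro e he
        by_cases heF : e ∈ F
        · exact mem_union_left _ (mem_union_left _ (mem_inter.2 ⟨heF, he⟩))
        by_cases hec : e ∈ crossing Q'
        · exact mem_union_left _ (mem_union_right _
            (mem_inter.2 ⟨Finset.mem_sdiff.2 ⟨he, heF⟩, hec⟩))
        refine mem_union_right _ ?_
        obtain ⟨w, hw, rfl⟩ := mem_image.1 he
        rw [mem_crossing, not_not] at hec
        rw [mk_mem_star, mem_union]
        by_cases hwS : w ∈ S
        · exact Or.inr hwS
        left
        rw [hQC u (hBC huB)] at hw
        rw [hBdef, Finset.mem_sdiff]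
        refine ⟨Finset.mem_sdiff.2 ⟨hw, hwS⟩, ?_⟩
        have := (Finset.mem_sdiff.1 huB).2
        rw [mem_cell] at this ⊢
        rwa [← hec]
      refine (card_le_card hsub).trans ((card_union_le _ _).trans ?_)
      refine add_le_add (card_union_le _ _) ?_
      rw [card_star]
      exact card_union_le _ _
    have hcover' : (#(ownStar Q u) : ℝ) ≤ #(F ∩ ownStar Q u) +
        #((ownStar Q u \ F) ∩ crossing Q') + (#B + #S) := by exact_mod_cast hcover
    have hown : 3 * n ≤ 4 * r * (#(ownStar Q u) : ℝ) := by
      rw [ownStar, card_star]; exact hcell _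
    have hq : 0 < 1 - p := by linarith
    have f1 : (#(ownStar Q u) : ℝ) * (1 - (1 + lam) * p) ≤ y + #B + #S := by linarith
    have f2 : (#(ownStar Q u) : ℝ) * (1 - (1 + lam) * p) * (1 - p) ≤
        (y + #S) * (1 - p) + y + 6 * r ^ 2 * t / n := by
      have := mul_le_mul_of_nonneg_right f1 hq.le
      linarith
    have f3 : 0 ≤ (1 - (1 + lam) * p) * (1 - p) := mul_nonneg (by linarith) hq.le
    have f4 : 3 * n * ((1 - (1 + lam) * p) * (1 - p)) ≤
        4 * r * #(ownStar Q u) * ((1 - (1 + lam) * p) * (1 - p)) := by gcongr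
    have f5 : 4 * r * ((#(ownStar Q u) : ℝ) * (1 - (1 + lam) * p) * (1 - p)) ≤
        4 * r * ((y + #S) * (1 - p) + y + 6 * r ^ 2 * t / n) := by gcongr
    have f6 : 6 * r ^ 2 * t / n ≤ 12 * r ^ 2 * t / n := by
      gcongr; norm_num
    have f7 : 4 * r * ((y + #S) * (1 - p) + y + 6 * r ^ 2 * t / n) ≤
        4 * r * ((y + #S) * (1 - p) + y + 12 * r ^ 2 * t / n) := by gcongr
    have f8 : 0 ≤ n * ((1 - (1 + lam) * p) * (1 - p)) := mul_nonneg hn0.le f3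
    linarith
  intro x hx
  by_contra hxS
  simp only [unstable, mem_filter, mem_univ, true_and] at hx
  -- The whole part without `S` is inseparable from `x`. It has more than 2n/(3r) vertices, so `x`
  -- is stable.
  have hsub : cell Q (Q x) \ S ⊆ univ.filter fun z => Inseparable r F a x z := by
    intro z hz
    simp only [mem_filter, mem_univ, true_and]
    intro Q' hQ'
    exact main (Q x) Q' hQ' x (Finset.mem_sdiff.2 ⟨by simp, hxS⟩) z hz
  have h1 : (3 * r * (#(cell Q (Q x) \ S) : ℝ)) ≤ 2 * n := by
    have : 3 * r * #(cell Q (Q x) \ S) ≤ 2 * Fintype.card V :=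
      (Nat.mul_le_mul_left _ (card_le_card hsub)).trans hx
    rw [hn]
    exact_mod_cast this
  have h2 : (#(cell Q (Q x)) : ℝ) ≤ #(cell Q (Q x) \ S) + #S := by
    exact_mod_cast card_le_card_sdiff_add_card (s := cell Q (Q x)) (t := S)
  have h3 : 4 * r * (#(cell Q (Q x)) : ℝ) ≤ 4 * r * (#(cell Q (Q x) \ S) + #S) := by gcongr
  have h4 := hcell (Q x)
  have h5 : (0 : ℝ) ≤ #S := Nat.cast_nonneg _
  linarith

end RandomCut

namespace RandomCut

open Finset RandomSubset

/-! ### Most vertices are stable -/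

variable {V : Type*} [Fintype V] [DecidableEq V] {r : ℕ}

/-- The number of vertices of typical degree in their part that can be flipped. -/
noncomputable def flipCount [NeZero r] (F : Finset (Sym2 V)) (p ν lam κ : ℝ) (a T : ℕ) : ℝ :=
  ∑ u : V, ind (ν ≤ #(ownStar (canon F : V → Fin r) u) ∧
    (#(F ∩ ownStar (canon F : V → Fin r) u) : ℝ) ≤
      (1 + lam) * p * #(ownStar (canon F : V → Fin r) u) ∧
    Flips F (canon F : V → Fin r) a (κ * #(ownStar (canon F : V → Fin r) u) + T) u)

lemma sum_ind_eq_card {ι : Type*} [Fintype ι] (A : ι → Prop) [DecidablePred A] :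
    ∑ u, ind (A u) = (#(univ.filter A) : ℝ) := by
  rw [card_filter]
  push_cast
  refine sum_congr rfl fun u _ => ?_
  by_cases h : A u
  · rw [ind_true h, if_pos h]
  · rw [ind_false h, if_neg h]

/-- The exceptional set consists of the vertices of high inner degree, few by discrepancy, and the
flippable ones of typical degree, counted by `flipCount`. -/
lemma card_unstable_le [NeZero r] {p t lam κ δ σ : ℝ} {F : Finset (Sym2 V)} {a T : ℕ}
    (hF : Discrepancy p t F) (h0 : 0 < p) (hp1 : p < 1) (hV : 0 < Fintype.card V) (ht : 0 ≤ t)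
    (hκ : 0 ≤ κ) (hlam0 : 0 < lam) (hB : Balanced r F a δ) (hδ : 4 * r * δ ≤ 1)
    (hflip : flipCount (r := r) F p (Fintype.card V / (2 * r)) lam κ a T ≤ σ * Fintype.card V)
    (hhigh : 12 * r ^ 2 * t ≤ σ * Fintype.card V * (lam * p * Fintype.card V))
    (hσ : 48 * r * σ ≤ 1) (hn : 4 * r ≤ lam * Fintype.card V) (hlam : (1 + lam) * p ≤ 1)
    (hnum : 4 * r * ((κ * Fintype.card V + T + 2 * σ * Fintype.card V) * (1 - p) +
      (κ * Fintype.card V + T) + 12 * r ^ 2 * t / Fintype.card V) <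
      Fintype.card V * (1 - (1 + lam) * p) * (1 - p)) :
    (#(unstable r F a) : ℝ) ≤ 2 * σ * Fintype.card V := by
  classical
  have hr : 0 < r := Nat.pos_of_ne_zero (NeZero.ne r)
  have hr0 : (0 : ℝ) < r := by exact_mod_cast hr
  have hV0 : (0 : ℝ) < Fintype.card V := by exact_mod_cast hV
  set Q : V → Fin r := canon F with hQdef
  have hnear : Near F a Q := (canon_spec F).near.mono (Nat.zero_le a)
  have hcell : ∀ i, (Fintype.card V : ℝ) ≤ 2 * r * #(cell Q i) := by
    intro j
    have h1 := (abs_le.1 (hB Q hnear j)).1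
    have h2 : (Fintype.card V : ℝ) / r - δ * Fintype.card V ≤ #(cell Q j) := by linarith
    have h3 : 4 * r * (Fintype.card V / r - δ * Fintype.card V) ≤ 4 * r * (#(cell Q j) : ℝ) := by
      gcongr
    have h4 : 4 * r * (Fintype.card V / r - δ * Fintype.card V) =
      4 * Fintype.card V - (4 * r * δ) * (Fintype.card V : ℝ) := by field_simp
    have h5 : (4 * r * δ) * (Fintype.card V : ℝ) ≤ 1 * Fintype.card V := by gcongr
    linarith
  set H := univ.filter fun u => (1 + lam) * p * #(ownStar Q u) < #(F ∩ ownStar Q u) with hH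
  set S' := univ.filter fun u => ((Fintype.card V : ℝ) / (2 * r) ≤ #(ownStar Q u) ∧
    (#(F ∩ ownStar Q u) : ℝ) ≤ (1 + lam) * p * #(ownStar Q u) ∧
    Flips F Q a (κ * #(ownStar Q u) + T) u) with hS'
  have hHcard : (#H : ℝ) ≤ σ * Fintype.card V := by
    have h1 := hF.card_high_le h0 hlam0 hr Q hcell hn H fun u hu => (mem_filter.1 hu).2
    exact le_of_mul_le_mul_right (h1.trans hhigh) (by positivity)
  have hScard : (#S' : ℝ) ≤ σ * Fintype.card V := by
    rw [hS', ← sum_ind_eq_card]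
    exact hflip
  have hunion : (#(H ∪ S') : ℝ) ≤ 2 * σ * Fintype.card V := by
    have : (#(H ∪ S') : ℝ) ≤ #H + #S' := by exact_mod_cast card_union_le _ _
    linarith
  have hsub : unstable r F a ⊆ H ∪ S' := by
    refine hF.unstable_subset (lam := lam) (y := κ * Fintype.card V + T) hr hp1 hV ht hB hnear
      (H ∪ S') (fun u hu => ?_) (fun u hu hf => ?_) hδ ?_ hlam (lt_of_le_of_lt ?_ hnum)
    · by_contra h
      exact hu (mem_union_left _ (mem_filter.2 ⟨mem_univ _, not_le.1 h⟩))
    · rw [mem_union, not_or] at hu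
      refine hu.2 (mem_filter.2 ⟨mem_univ _, ?_, ?_, ?_⟩)
      · rw [ownStar, card_star, div_le_iff₀ (by positivity), mul_comm]
        exact hcell _
      · by_contra h
        exact hu.1 (mem_filter.2 ⟨mem_univ _, not_le.1 h⟩)
      · obtain ⟨Q', h1, h2⟩ := hf
        refine ⟨Q', h1, le_trans ?_ h2⟩
        have : (#(ownStar Q u) : ℝ) ≤ Fintype.card V := by
          rw [ownStar, card_star]
          exact_mod_cast card_le_univ _
        gcongr
    · calc 24 * r * (#(H ∪ S') : ℝ) ≤ 24 * r * (2 * σ * Fintype.card V) := by gcongr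
        _ = (48 * r * σ) * Fintype.card V := by ring
        _ ≤ 1 * Fintype.card V := by gcongr
        _ = _ := one_mul _
    · have hq : 0 ≤ 1 - p := by linarith
      gcongr
  exact le_trans (by exact_mod_cast card_le_card hsub) hunion

/-- With few unstable vertices, near-maximum cuts are almost determined by the graph. -/
def Rigid (r : ℕ) (F : Finset (Sym2 V)) (a : ℕ) (δ : ℝ) : Prop :=
  Balanced r F a δ ∧ (#(unstable r F a) : ℝ) ≤ δ * Fintype.card V

/-- Markov's inequality for `flipCount`, with all parameters still free. -/
lemma prob_not_rigid_le_of_numeric [NeZero r] {p t lam κ δ σ δ' ρ : ℝ} {a T : ℕ}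
    (h0 : 0 < p) (hp1 : p < 1) (hV : 0 < Fintype.card V) (ht : 0 ≤ t)
    (hκ0 : 0 < κ) (hκ : κ ≤ 1) (hlam0 : 0 < lam) (hδ0 : 0 ≤ δ)
    (hbal : Fintype.card V + (4 * r * t + 2 * a) / p ≤ (δ * Fintype.card V) ^ 2)
    (hδ : 4 * r * δ ≤ 1) (hδ' : δ ≤ δ') (hσδ : 2 * σ ≤ δ') (hσ0 : 0 < σ)
    (hhigh : 12 * r ^ 2 * t ≤ σ * Fintype.card V * (lam * p * Fintype.card V))
    (hσ : 48 * r * σ ≤ 1) (hn : 4 * r ≤ lam * Fintype.card V) (hlam : (1 + lam) * p ≤ 1)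
    (hnum : 4 * r * ((κ * Fintype.card V + T + 2 * σ * Fintype.card V) * (1 - p) +
      (κ * Fintype.card V + T) + 12 * r ^ 2 * t / Fintype.card V) <
      Fintype.card V * (1 - (1 + lam) * p) * (1 - p))
    (hT : 2 * (a + 1) ≤ κ * T) (hTν : T ≤ lam * p * (Fintype.card V / (2 * r))) (hρ : 1 ≤ ρ)
    (hlam1 : p * (1 + 2 * lam) < 1)
    (hρp : (1 - p) * (1 + 2 * lam) ≤ ρ * (1 - p * (1 + 2 * lam))) :
    prob p (fun F : Finset (Sym2 V) => ¬ Rigid r F a δ') ≤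
      prob p (fun F : Finset (Sym2 V) => ¬ Discrepancy p t F) +
      2 / κ * (T * ρ ^ T / (Fintype.card V / (2 * r) * (1 - p * (1 + 2 * lam)))) * (2 / p *
        (r * t + (Fintype.card V : ℝ) ^ 2 *
          prob p (fun F : Finset (Sym2 V) => ¬ Discrepancy p t F))) / (σ * Fintype.card V) := by
  have hr : 0 < r := Nat.pos_of_ne_zero (NeZero.ne r)
  have hr0 : (0 : ℝ) < r := by exact_mod_cast hr
  have hV0 : (0 : ℝ) < Fintype.card V := by exact_mod_cast hV
  have h1 : ∀ F : Finset (Sym2 V), ¬ Rigid r F a δ' → ¬ Discrepancy p t F ∨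
      σ * Fintype.card V ≤ flipCount (r := r) F p (Fintype.card V / (2 * r)) lam κ a T := by
    intro F hF
    by_contra h
    push Not at h
    have hB := h.1.balanced h0 hr hδ0 hbal
    refine hF ⟨fun Q hQ i => (hB Q hQ i).trans (by gcongr), ?_⟩
    refine (card_unstable_le h.1 h0 hp1 hV ht hκ0.le hlam0 hB hδ h.2.le hhigh hσ hn hlam
      hnum).trans ?_
    gcongr
  refine (prob_mono h0.le hp1.le h1).trans ((prob_or_le h0.le hp1.le _ _).trans ?_)
  refine add_le_add le_rfl ((prob_le_of_mean h0.le hp1.le (fun F => ?_) (by positivity)).trans ?_)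
  · exact sum_nonneg fun u _ => ind_nonneg _
  · gcongr
    exact mean_card_flips_le h0 hp1.le (by positivity) hlam0.le hκ0 hκ ht hT hTν hρ hlam1 hρp

end RandomCut

/-! ### Choice of the parameters for rigidity. -/

namespace RandomCut

open Finset RandomSubset

lemma sq_mul_two_pow_mul_exp_le (n : ℕ) (hn : 0 < n) :
    (n : ℝ) ^ 2 * (2 ^ n * (2 * Real.exp (-(4 * n)))) ≤ 1 := by
  have hn1 : (1 : ℝ) ≤ n := by exact_mod_cast hn
  have h1 : (n : ℝ) ≤ Real.exp n := by linarith [Real.add_one_le_exp (n : ℝ)]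
  have h2 : (2 : ℝ) ≤ Real.exp n := by linarith [Real.add_one_le_exp (n : ℝ)]
  have h3 : (2 : ℝ) ^ n ≤ Real.exp n := by
    have : (2 : ℝ) ≤ Real.exp 1 := by linarith [Real.add_one_le_exp (1 : ℝ)]
    calc (2 : ℝ) ^ n ≤ Real.exp 1 ^ n := by gcongr
      _ = _ := by rw [← Real.exp_nat_mul, mul_one]
  calc (n : ℝ) ^ 2 * (2 ^ n * (2 * Real.exp (-(4 * n))))
      ≤ Real.exp n ^ 2 * (Real.exp n * (Real.exp n * Real.exp (-(4 * n)))) := by gcongr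
    _ = Real.exp (n + n + (n + (n + -(4 * n)))) := by
        simp only [Real.exp_add]; ring
    _ = 1 := by
        rw [Real.exp_eq_one_iff]; ring

variable {r : ℕ}

-- With lam = 1/L and T = O(L), the distortion ρ^T with ρ = 1 + O(1/L) is bounded. The expected
-- proportion of flippable vertices is then O(L/√(np)), which the hypothesis np ≥ (ΩL)² makes
-- O(1/Ω).
set_option maxHeartbeats 2000000 in
theorem exists_prob_not_rigid_le [NeZero r] {η α δ ζ : ℝ} (hη0 : 0 < η) (hη1 : η ≤ 1)
    (hα : 0 ≤ α) (hδ : 0 < δ) (hζ : 0 < ζ) :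
    ∃ Ω : ℝ, 1 ≤ Ω ∧ ∀ (V : Type) [Fintype V] [DecidableEq V] (p L : ℝ) (a : ℕ),
      0 < p → p ≤ 1 - η → Ω ≤ L → (Ω * L) ^ 2 ≤ Fintype.card V * p → a ≤ α * L →
      prob p (fun F : Finset (Sym2 V) => ¬ Rigid r F a δ) ≤ ζ := by
  have hr : 0 < r := Nat.pos_of_ne_zero (NeZero.ne r)
  have hr1 : (1 : ℝ) ≤ r := by exact_mod_cast hr
  have hr0 : (0 : ℝ) < r := by linarith
  obtain ⟨σ, hσ0, hσδ, hση⟩ : ∃ σ : ℝ, 0 < σ ∧ 2 * σ ≤ δ ∧ σ * (64 * r) ≤ η ^ 2 := by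
    refine ⟨min (δ / 2) (η ^ 2 / (64 * r)), lt_min (by positivity) (by positivity), ?_, ?_⟩
    · linarith [min_le_left (δ / 2) (η ^ 2 / (64 * r))]
    · rw [← le_div_iff₀ (by positivity)]
      exact min_le_right _ _
  obtain ⟨δ₀, hδ₀0, hδ₀δ, hδ₀r⟩ : ∃ δ₀ : ℝ, 0 < δ₀ ∧ δ₀ ≤ δ ∧ 4 * r * δ₀ ≤ 1 := by
    refine ⟨min δ (1 / (4 * r)), lt_min hδ (by positivity), min_le_left _ _, ?_⟩
    calc 4 * r * min δ (1 / (4 * r)) ≤ 4 * r * (1 / (4 * r)) := by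
          gcongr; exact min_le_right _ _
      _ = 1 := by field_simp
  have hη2 : η ^ 2 ≤ 1 := pow_le_one₀ hη0.le hη1
  have hσ1 : σ ≤ 1 := by nlinarith
  set τ : ℝ := (2 * α + 2) / σ + 1 with hτ
  have hτ0 : 0 < τ := by positivity
  set R : ℝ := Real.exp (4 * τ / η) with hR
  have hR0 : 0 < R := Real.exp_pos _
  obtain ⟨Ω, hΩ1, hΩη, hΩτ, hΩδ, hΩσ, hΩr, hΩκ, hΩK, hΩζ⟩ : ∃ Ω : ℝ, 1 ≤ Ω ∧ 4 / η ≤ Ω ∧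
      2 * r * τ ≤ Ω ∧ (1 + 2 * α + 16 * r) / δ₀ ^ 2 ≤ Ω ∧ 48 * r ^ 2 / σ ≤ Ω ∧ 4 * r ≤ Ω ∧
      τ / σ ≤ Ω ∧ 80 * r ^ 2 * τ * R / (σ * η * σ) * (2 / ζ) ≤ Ω ∧ 2 / ζ ≤ Ω := by
    have e1 : 0 < 4 / η := by positivity
    have e2 : 0 < 2 * r * τ := by positivity
    have e3 : 0 < (1 + 2 * α + 16 * r) / δ₀ ^ 2 := by positivity
    have e4 : 0 < 48 * r ^ 2 / σ := by positivity
    have e5 : 0 < τ / σ := by positivity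
    have e6 : 0 < 80 * r ^ 2 * τ * R / (σ * η * σ) * (2 / ζ) := by positivity
    have e7 : 0 < 2 / ζ := by positivity
    refine ⟨1 + 4 / η + 2 * r * τ + (1 + 2 * α + 16 * r) / δ₀ ^ 2 + 48 * r ^ 2 / σ + 4 * r +
      τ / σ + 80 * r ^ 2 * τ * R / (σ * η * σ) * (2 / ζ) + 2 / ζ, ?_, ?_, ?_, ?_, ?_, ?_, ?_, ?_,
      ?_⟩ <;> linarith
  rw [div_le_iff₀ hη0] at hΩη
  rw [div_le_iff₀ (by positivity)] at hΩδ
  rw [div_le_iff₀ hσ0] at hΩσ hΩκ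
  refine ⟨Ω, hΩ1, fun V _ _ p L a hp0 hp hL hnp ha => ?_⟩
  have hΩ0 : 0 < Ω := by linarith
  have hL1 : 1 ≤ L := hΩ1.trans hL
  have hL0 : 0 < L := by linarith
  have hp1 : p < 1 := by linarith
  set n : ℝ := (Fintype.card V : ℝ) with hn
  have hnn : 0 ≤ n := Nat.cast_nonneg _
  set s : ℝ := √(n * p) with hs
  have hsΩ : Ω * L ≤ s := Real.le_sqrt_of_sq_le hnp
  have hs2 : s ^ 2 = n * p := Real.sq_sqrt (by positivity)
  have hΩL : Ω ≤ Ω * L := le_mul_of_one_le_right hΩ0.le hL1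
  have hΩs : Ω ≤ s := hΩL.trans hsΩ
  have hs1 : 1 ≤ s := hΩ1.trans hΩs
  have hs0 : 0 < s := by linarith
  have hs2n : s ^ 2 ≤ n := by rw [hs2]; exact mul_le_of_le_one_right hnn hp1.le
  have hss : s ≤ s ^ 2 := le_self_pow₀ hs1 two_ne_zero
  have hsn : s ≤ n := hss.trans hs2n
  have hΩsn : Ω * s ≤ n := by
    refine le_trans ?_ hs2n
    rw [sq]
    gcongr
  have hΩLn : Ω * L ≤ n := hsΩ.trans hsn
  have hΩn : Ω ≤ n := hΩs.trans hsn
  have hn0 : 0 < n := by linarith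
  have hV : 0 < Fintype.card V := by rw [hn] at hn0; exact_mod_cast hn0
  -- Small enough that `T` additions distort the law boundedly, yet large enough that `T` of them
  -- fit into the degree window and that few vertices have high inner degree.
  set lam : ℝ := 1 / L with hlam
  have hlam0 : 0 < lam := by positivity
  have hlamL : lam * L = 1 := by rw [hlam]; field_simp
  have hlamη : lam ≤ η / 4 := by
    rw [hlam, div_le_iff₀ hL0]
    calc (1 : ℝ) ≤ Ω * η / 4 := by linarith
      _ ≤ L * η / 4 := by gcongr
      _ = _ := by ring
  set T : ℕ := ⌈2 * ((a : ℝ) + 1) / σ⌉₊ with hT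
  have hTlow : 2 * ((a : ℝ) + 1) ≤ σ * T := by
    rw [mul_comm σ, ← div_le_iff₀ hσ0]
    exact Nat.le_ceil _
  have hTup : (T : ℝ) ≤ τ * L := by
    have h1 : (T : ℝ) < 2 * ((a : ℝ) + 1) / σ + 1 := Nat.ceil_lt_add_one (by positivity)
    have h2 : 2 * ((a : ℝ) + 1) / σ ≤ (2 * α + 2) / σ * L := by
      rw [div_mul_eq_mul_div]
      refine div_le_div_of_nonneg_right ?_ hσ0.le
      linarith
    calc (T : ℝ) ≤ (2 * α + 2) / σ * L + 1 * L := by linarith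
      _ = τ * L := by rw [hτ]; ring
  have ht : discBound (Fintype.card V) p = 4 * n * s := rfl
  have h2lam : 2 * lam ≤ η / 2 := by linarith
  have hplam1 : p * lam ≤ lam := mul_le_of_le_one_left hlam0.le hp1.le
  have hplam : p * (1 + 2 * lam) ≤ p + 2 * lam := by linarith
  have hq : η / 2 ≤ 1 - p * (1 + 2 * lam) := by linarith
  have hdisc : n ^ 2 * prob p (fun F : Finset (Sym2 V) =>
      ¬ Discrepancy p (discBound (Fintype.card V) p) F) ≤ 1 := by
    refine le_trans ?_ (sq_mul_two_pow_mul_exp_le (Fintype.card V) hV)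
    rw [← hn]
    refine mul_le_mul_of_nonneg_left (prob_not_discrepancy_le hp0 hp1.le ?_) (by positivity)
    rw [← hn, ← hs2]
    have : 4 ≤ s := by linarith
    linarith
  -- The excess over 1 absorbs the additional degree; the factor 1/η comes from 1 - p (1 + 2 lam) ≥
  -- η/2.
  set ρ : ℝ := 1 + 4 * lam / η with hρ
  have hρ1 : 1 ≤ ρ := by rw [hρ]; linarith [show 0 < 4 * lam / η by positivity]
  have hρT : ρ ^ T ≤ R := by
    have h1 : ρ ≤ Real.exp (4 * lam / η) := by
      rw [hρ]; linarith [Real.add_one_le_exp (4 * lam / η)]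
    calc ρ ^ T ≤ Real.exp (4 * lam / η) ^ T := by gcongr
      _ = Real.exp (T * (4 * lam / η)) := by rw [← Real.exp_nat_mul]
      _ ≤ R := by
        rw [hR, Real.exp_le_exp, mul_div_assoc', div_le_div_iff_of_pos_right hη0]
        calc (T : ℝ) * (4 * lam) ≤ (τ * L) * (4 * lam) := by gcongr
          _ = 4 * τ * (lam * L) := by ring
          _ = 4 * τ := by rw [hlamL, mul_one]
  have key := prob_not_rigid_le_of_numeric (V := V) (r := r)
    (p := p) (t := discBound (Fintype.card V) p) (lam := lam) (κ := σ) (δ := δ₀)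
    (σ := σ) (δ' := δ) (ρ := ρ) (a := a) (T := T) hp0 hp1 hV (by rw [ht]; positivity) hσ0 hσ1
    hlam0 hδ₀0.le ?bal hδ₀r hδ₀δ hσδ hσ0 ?high ?sig ?four ?lam1 ?num hTlow ?Tnu hρ1 ?lam2 ?rho
  case bal =>
    rw [ht, ← hn]
    have h1 : (4 * r * (4 * n * s) + 2 * a) / p = (4 * r * (4 * n * s) + 2 * a) * n / s ^ 2 := by
      rw [hs2]; field_simp
    rw [h1, mul_pow]
    have h2 : (4 * r * (4 * n * s) + 2 * a) * n / s ^ 2 ≤ 16 * r * n ^ 2 / Ω + 2 * α * n := by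
      rw [div_le_iff₀ (by positivity)]
      have e1 : 2 * (a : ℝ) ≤ 2 * α * s ^ 2 := by
        have : L ≤ s ^ 2 := (le_mul_of_one_le_left hL0.le hΩ1).trans (hsΩ.trans hss)
        calc 2 * (a : ℝ) ≤ 2 * (α * L) := by gcongr
          _ ≤ 2 * (α * s ^ 2) := by gcongr
          _ = _ := by ring
      have e2 : 16 * r * n ^ 2 * s ≤ 16 * r * n ^ 2 / Ω * s ^ 2 := by
        rw [div_mul_eq_mul_div, le_div_iff₀ hΩ0]
        calc 16 * r * n ^ 2 * s * Ω ≤ 16 * r * n ^ 2 * s * s := by gcongr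
          _ = _ := by ring
      have e3 : 2 * (a : ℝ) * n ≤ 2 * α * s ^ 2 * n := by gcongr
      linarith
    have h3 : (1 + 2 * α) * n ≤ (1 + 2 * α) * (n ^ 2 / Ω) := by
      gcongr
      rw [le_div_iff₀ hΩ0, sq]
      gcongr
    have h4 : (1 + 2 * α) * (n ^ 2 / Ω) + 16 * r * n ^ 2 / Ω ≤ δ₀ ^ 2 * n ^ 2 := by
      have : (1 + 2 * α) * (n ^ 2 / Ω) + 16 * r * n ^ 2 / Ω =
        (1 + 2 * α + 16 * r) * n ^ 2 / Ω := by ring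
      rw [this, div_le_iff₀ hΩ0]
      calc (1 + 2 * α + 16 * r) * n ^ 2 ≤ (Ω * δ₀ ^ 2) * n ^ 2 := by gcongr
        _ = _ := by ring
    linarith
  case high =>
    rw [ht, ← hn]
    have h1 : σ * n * (lam * p * n) = lam * (σ * n * s ^ 2) := by rw [hs2]; ring
    have h2 : 48 * r ^ 2 * L ≤ σ * s := by
      calc 48 * r ^ 2 * L ≤ Ω * σ * L := by gcongr
        _ = σ * (Ω * L) := by ring
        _ ≤ _ := by gcongr
    have h3 : 48 * r ^ 2 ≤ lam * (σ * s) := by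
      rw [hlam, div_mul_eq_mul_div, le_div_iff₀ hL0, one_mul]
      exact h2
    rw [h1]
    calc 12 * r ^ 2 * (4 * n * s) = 48 * r ^ 2 * (n * s) := by ring
      _ ≤ lam * (σ * s) * (n * s) := by gcongr
      _ = _ := by ring
  case sig => linarith [mul_pos hσ0 hr0]
  case four =>
    rw [hlam, div_mul_eq_mul_div, le_div_iff₀ hL0, one_mul, ← hn]
    exact le_trans (by gcongr) hΩLn
  case lam1 => linarith [mul_pos hp0 hlam0]
  case lam2 => linarith
  case num =>
    rw [ht, ← hn]
    have h1 : 12 * r ^ 2 * (4 * n * s) / n = 48 * r ^ 2 * s := by field_simp; ring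
    have h2 : 48 * r ^ 2 * s ≤ σ * n := by
      calc 48 * r ^ 2 * s ≤ Ω * σ * s := by gcongr
        _ = σ * (Ω * s) := by ring
        _ ≤ _ := by gcongr
    have h3 : (T : ℝ) ≤ σ * n := by
      calc (T : ℝ) ≤ τ * L := hTup
        _ ≤ Ω * σ * L := by gcongr
        _ = σ * (Ω * L) := by ring
        _ ≤ _ := by gcongr
    have h4 : (σ * n + T + 2 * σ * n) * (1 - p) ≤ (σ * n + T + 2 * σ * n) * 1 := by
      gcongr; linarith
    have h5 : 4 * r * ((σ * n + T + 2 * σ * n) * (1 - p) + (σ * n + T) +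
        12 * r ^ 2 * (4 * n * s) / n) ≤ 4 * r * (7 * (σ * n)) := by
      rw [h1]; gcongr; linarith
    have h6 : 4 * r * (7 * (σ * n)) = (28 / 64) * (σ * (64 * r) * n) := by ring
    have h7 : σ * (64 * r) * n ≤ η ^ 2 * n := by gcongr
    have h8 : n * (η / 2) * η ≤ n * (1 - (1 + lam) * p) * (1 - p) := by
      have e1 : η / 2 ≤ 1 - (1 + lam) * p := by linarith [mul_pos hp0 hlam0]
      have e2 : η ≤ 1 - p := by linarith
      have e3 : 0 ≤ 1 - (1 + lam) * p := by linarith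
      gcongr
    have h9 : 0 < η ^ 2 * n := by positivity
    linarith
  case Tnu =>
    rw [← hn]
    refine hTup.trans ?_
    have h1 : lam * p * (n / (2 * r)) = s ^ 2 / (2 * r * L) := by
      rw [hs2, hlam]; field_simp
    rw [h1, le_div_iff₀ (by positivity)]
    have h2 : Ω * L ^ 2 ≤ s ^ 2 := by
      calc Ω * L ^ 2 ≤ Ω ^ 2 * L ^ 2 := by gcongr; exact le_self_pow₀ hΩ1 two_ne_zero
        _ = (Ω * L) ^ 2 := by ring
        _ ≤ _ := by gcongr
    calc τ * L * (2 * r * L) = 2 * r * τ * L ^ 2 := by ring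
      _ ≤ Ω * L ^ 2 := by gcongr
      _ ≤ _ := h2
  case rho =>
    have h1 : 4 * lam / η * (η / 2) ≤ 4 * lam / η * (1 - p * (1 + 2 * lam)) := by gcongr
    have h2 : 4 * lam / η * (η / 2) = 2 * lam := by field_simp; ring
    rw [hρ, add_mul]
    linarith
  refine key.trans ?_
  rw [ht, ← hn] at *
  set P := prob p (fun F : Finset (Sym2 V) => ¬ Discrepancy p (4 * n * s) F) with hP
  have hP1 : P ≤ ζ / 2 := by
    have h1 : Ω * P ≤ 1 := by
      refine le_trans ?_ hdisc
      refine mul_le_mul_of_nonneg_right ?_ (prob_nonneg hp0.le hp1.le _)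
      exact hΩn.trans (le_self_pow₀ (hΩ1.trans hΩn) two_ne_zero)
    rw [div_le_iff₀ hζ] at hΩζ
    rw [← mul_le_mul_iff_right₀ hΩ0]
    linarith
  have hP0 : 0 ≤ P := prob_nonneg hp0.le hp1.le _
  have hmain : 2 / σ * (T * ρ ^ T / (n / (2 * r) * (1 - p * (1 + 2 * lam)))) *
      (2 / p * (r * (4 * n * s) + n ^ 2 * P)) / (σ * n) ≤ ζ / 2 := by
    have h1 : n ^ 2 * P ≤ r * n * s := hdisc.trans (by
      have : 1 ≤ n := hΩ1.trans hΩn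
      calc (1 : ℝ) = 1 * 1 * 1 := by norm_num
        _ ≤ r * n * s := by gcongr)
    calc 2 / σ * (T * ρ ^ T / (n / (2 * r) * (1 - p * (1 + 2 * lam)))) *
          (2 / p * (r * (4 * n * s) + n ^ 2 * P)) / (σ * n)
        ≤ 2 / σ * (τ * L * R / (n / (2 * r) * (η / 2))) *
          (2 / p * (r * (4 * n * s) + r * n * s)) / (σ * n) := by gcongr
      _ = 80 * r ^ 2 * τ * R / (σ * η * σ) * (L * s / (n * p)) := by field_simp; ring
      _ = 80 * r ^ 2 * τ * R / (σ * η * σ) * (L / s) := by rw [← hs2]; field_simp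
      _ ≤ 80 * r ^ 2 * τ * R / (σ * η * σ) * (1 / Ω) := by
          gcongr ?_ * ?_
          rw [div_le_div_iff₀ hs0 hΩ0]
          linarith
      _ ≤ ζ / 2 := by
          rw [mul_one_div, div_le_iff₀ hΩ0]
          calc 80 * r ^ 2 * τ * R / (σ * η * σ) =
              ζ / 2 * (80 * r ^ 2 * τ * R / (σ * η * σ) * (2 / ζ)) := by field_simp
            _ ≤ ζ / 2 * Ω := by gcongr
  linarith

end RandomCut

namespace RandomCut

open Finset RandomSubset

/-! ### Exposing the edges at one vertex -/

variable {V : Type*} [Fintype V] [DecidableEq V] {r : ℕ}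

/-- The common neighbours of the vertices of `W`. -/
def common (F : Finset (Sym2 V)) (W : Finset V) : Finset V :=
  univ.filter fun z => z ∉ W ∧ ∀ w ∈ W, s(w, z) ∈ F

lemma mem_common {F : Finset (Sym2 V)} {W : Finset V} {z : V} :
    z ∈ common F W ↔ z ∉ W ∧ ∀ w ∈ W, s(w, z) ∈ F := by simp [common]

@[simp] lemma common_empty (F : Finset (Sym2 V)) : common F ∅ = univ := by
  ext z; simp [mem_common]

/-- The vertices of `U` that become common neighbours of `insert x W` if they are adjacent to
`x`. -/
def link (F : Finset (Sym2 V)) (W : Finset V) (x : V) (U : Finset V) : Finset V :=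
  (common F W).erase x ∩ U

/-- The edges other than those between `x` and `link F W x U`. -/
def hide (F : Finset (Sym2 V)) (W : Finset V) (x : V) (U : Finset V) : Finset (Sym2 V) :=
  F \ star x (link F W x U)

/-- No pair of `star x B` has an endpoint in `W`, so resampling these pairs cannot change the common
neighbourhood of `W`. -/
lemma common_congr {F F' : Finset (Sym2 V)} {W B : Finset V} {x : V} (hx : x ∉ W)
    (hB : Disjoint B W) (h : F \ star x B = F' \ star x B) : common F' W = common F W := by
  ext z
  rw [mem_common, mem_common]
  refine and_congr_right fun _ => forall₂_congr fun w hw => ?_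
  have hn : s(w, z) ∉ star x B := by
    rw [mem_star]
    rintro (⟨rfl, -⟩ | ⟨-, h2⟩)
    · exact hx hw
    · exact Finset.disjoint_left.1 hB h2 hw
  have h1 := congrArg (fun S => s(w, z) ∈ S) h
  simpa [hn] using h1.symm

lemma mem_common_insert {F : Finset (Sym2 V)} {W : Finset V} {x z : V} :
    z ∈ common F (insert x W) ↔ z ∈ (common F W).erase x ∧ s(x, z) ∈ F := by
  simp only [mem_common, mem_insert, mem_erase, forall_eq_or_imp, not_or]
  tauto

lemma card_inter_star {F : Finset (Sym2 V)} {W B : Finset V} {x : V}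
    (hB : B ⊆ (common F W).erase x) : #(F ∩ star x B) = #(common F (insert x W) ∩ B) := by
  rw [← card_image_of_injective (common F (insert x W) ∩ B) (mk_left_injective x)]
  congr 1
  ext e
  simp only [star, mem_inter, mem_image]
  constructor
  · rintro ⟨he, z, hz, rfl⟩
    exact ⟨z, ⟨mem_common_insert.2 ⟨hB hz, he⟩, hz⟩, rfl⟩
  · rintro ⟨z, ⟨h1, hz⟩, rfl⟩
    exact ⟨(mem_common_insert.1 h1).2, z, hz, rfl⟩

lemma common_insert_inter_link (F : Finset (Sym2 V)) (W : Finset V) (x : V) (U Y : Finset V) :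
    common F (insert x W) ∩ (link F W x U ∩ Y) = common F (insert x W) ∩ (U ∩ Y) := by
  ext z
  simp only [link, mem_inter]
  constructor
  · tauto
  · rintro ⟨h1, h2⟩
    exact ⟨h1, ⟨(mem_common_insert.1 h1).1, h2.1⟩, h2.2⟩

/-- The number of neighbours of `x` in a set that is determined by the other edges is concentrated
around its mean. -/
lemma prob_link_deviation_le {p : ℝ} (h0 : 0 ≤ p) (h1 : p ≤ 1) {W : Finset V} {x : V} (hx : x ∉ W)
    (U : Finset V) (g : Finset (Sym2 V) → Finset V) {μ t : ℝ} (ht : 0 < t) (htμ : t ≤ 2 * μ) :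
    prob p (fun F => p * #(link F W x U ∩ g (hide F W x U)) ≤ μ ∧
      t < |(#(common F (insert x W) ∩ (U ∩ g (hide F W x U))) : ℝ) -
        p * #(link F W x U ∩ g (hide F W x U))|) ≤ 2 * Real.exp (-(t ^ 2 / (4 * μ))) := by
  refine le_trans (prob_mono h0 h1 fun F hF => ?_) (prob_deviation_le h0 h1
    (fun F => star x (link F W x U ∩ g (hide F W x U))) (fun F F' h => ?_) ht htμ)
  · simp only [card_star]
    rw [card_inter_star (W := W) (show link F W x U ∩ g (hide F W x U) ⊆ (common F W).erase x from
      inter_subset_left.trans inter_subset_left), common_insert_inter_link]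
    exact hF
  · have hsub : link F W x U ∩ g (hide F W x U) ⊆ common F W :=
      (inter_subset_left.trans inter_subset_left).trans (erase_subset _ _)
    have h2 : common F' W = common F W := by
      refine common_congr hx (Finset.disjoint_left.2 fun z hz => ?_) h
      exact (mem_common.1 (hsub hz)).1
    have h3 : link F' W x U = link F W x U := by rw [link, link, h2]
    -- `F` and `F'` differ only on the star of the probed part of the link, and `hide` deletes the
    -- star of the whole link.
    have h4 : hide F' W x U = hide F W x U := by
      have h5 : star x (link F W x U ∩ g (hide F W x U)) ⊆ star x (link F W x U) :=
        image_subset_image inter_subset_left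
      have h6 : ∀ G : Finset (Sym2 V), G \ star x (link F W x U) =
          (G \ star x (link F W x U ∩ g (hide F W x U))) \ star x (link F W x U) := by
        intro G
        rw [Finset.sdiff_sdiff_left', ← Finset.sdiff_union_distrib, union_eq_right.2 h5]
      rw [hide, hide, h3, h6 F', h6 F, h]
    simp only [h3, h4]

end RandomCut

namespace RandomCut

open Finset RandomSubset

/-! ### Common neighbourhoods in a graph with typical exposures -/

variable {V : Type*} [Fintype V] [DecidableEq V] {r k : ℕ}

lemma cut_le_add_of_card_sdiff_le {F F₀ : Finset (Sym2 V)} {ℓ : ℕ} (h : #(F \ F₀) ≤ ℓ)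
    (Q : V → Fin r) : cut F Q ≤ cut F₀ Q + ℓ := by
  have h1 : F ∩ crossing Q ⊆ (F₀ ∩ crossing Q) ∪ (F \ F₀) := by
    intro e he
    rw [mem_inter] at he
    by_cases h0 : e ∈ F₀
    · exact mem_union_left _ (mem_inter.2 ⟨h0, he.2⟩)
    · exact mem_union_right _ (Finset.mem_sdiff.2 ⟨he.1, h0⟩)
  exact (card_le_card h1).trans ((card_union_le _ _).trans (Nat.add_le_add_left h _))

lemma cut_mono {F F₀ : Finset (Sym2 V)} (h : F₀ ⊆ F) (Q : V → Fin r) : cut F₀ Q ≤ cut F Q :=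
  card_le_card (inter_subset_inter_right h)

/-- Deleting at most `ℓ` pairs lowers every cut by at most `ℓ`. With its converse below, it
transfers near-maximality between `F` and `hide F`. -/
lemma Near.of_superset {F F₀ : Finset (Sym2 V)} {a ℓ : ℕ} {Q : V → Fin r} (hQ : Near F a Q)
    (hs : F₀ ⊆ F) (h : #(F \ F₀) ≤ ℓ) : Near F₀ (a + ℓ) Q := fun Q' => by
  have h1 := cut_mono hs Q'
  have h2 := hQ Q'
  have h3 := cut_le_add_of_card_sdiff_le h Q
  omega

lemma Near.of_subset {F F₀ : Finset (Sym2 V)} {a ℓ : ℕ} {Q : V → Fin r} (hQ : Near F₀ a Q)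
    (hs : F₀ ⊆ F) (h : #(F \ F₀) ≤ ℓ) : Near F (a + ℓ) Q := fun Q' => by
  have h1 := cut_mono hs Q
  have h2 := hQ Q'
  have h3 := cut_le_add_of_card_sdiff_le h Q'
  omega

/-- The sets whose intersections with neighbourhoods are tested. -/
noncomputable def probe (k r ℓ : ℕ) [NeZero r] :
    Option (Fin k ⊕ Fin r) → Finset (Sym2 V) → Finset V
  | none, _ => univ
  | some (Sum.inl i), F => unstable r F (2 * (i + 1) * ℓ)
  | some (Sum.inr i), F => cell (canon F) i

/-- The fibre of a map. -/
def chunk {m : ℕ} (χ : V → Fin m) (c : Fin m) : Finset V := univ.filter fun v => χ v = c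

lemma sum_card_inter_chunk {m : ℕ} (χ : V → Fin m) (X : Finset V) :
    ∑ c, (#(X ∩ chunk χ c) : ℝ) = #X := by
  rw [card_eq_sum_card_fiberwise (f := χ) (t := univ) (fun x _ => mem_coe.2 (mem_univ _))]
  push_cast
  refine sum_congr rfl fun c _ => ?_
  congr 2
  ext v
  simp [chunk]

/-- Inside the fibres of `χ`, all exposures of a neighbourhood behave as expected. -/
def Exposed [NeZero r] {m : ℕ} (χ : V → Fin m) (j k ℓ : ℕ) (p s θ : ℝ) (F : Finset (Sym2 V)) :
    Prop :=
  ∀ W : Finset V, #W < j → ∀ x ∉ W, ∀ c, ∀ i : Option (Fin k ⊕ Fin r),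
    p * #(link F W x (chunk χ c) ∩ probe k r ℓ i (hide F W x (chunk χ c))) ≤
      (#W + 3) * s * p ^ (#W + 1) →
    |(#(common F (insert x W) ∩ (chunk χ c ∩ probe k r ℓ i (hide F W x (chunk χ c)))) : ℝ) -
      p * #(link F W x (chunk χ c) ∩ probe k r ℓ i (hide F W x (chunk χ c)))| ≤
      θ * s * p ^ (#W + 1)

/-! ### Consequences of typical exposures. -/

section

variable [NeZero r] {m j ℓ : ℕ} {χ : V → Fin m} {p s θ : ℝ} {F : Finset (Sym2 V)}

/-- A chunk starts with at most `3 s` vertices, and each exposure adds at most one unit `s p^(#W +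
1)` of error, which explains `#W + 3`. The bound is also what justifies the next exposure. -/
lemma Exposed.card_common_le (hE : Exposed (r := r) χ j k ℓ p s θ F) (h0 : 0 ≤ p) (hs : 0 ≤ s)
    (hθ : θ ≤ 1) (hχ : ∀ c, (#(chunk χ c) : ℝ) ≤ 3 * s) (W : Finset V) (hW : #W ≤ j) (c : Fin m) :
    (#(common F W ∩ chunk χ c) : ℝ) ≤ (#W + 3) * s * p ^ #W := by
  induction W using Finset.induction_on with
  | empty => simpa using hχ c
  | insert x W hx ih =>
    rw [card_insert_of_notMem hx] at hW ⊢
    have ih := ih (by omega)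
    have h1 : (#(link F W x (chunk χ c)) : ℝ) ≤ (#W + 3) * s * p ^ #W := by
      refine le_trans ?_ ih
      exact_mod_cast card_le_card (inter_subset_inter_right (erase_subset _ _))
    have h2 : p * #(link F W x (chunk χ c)) ≤ (#W + 3) * s * p ^ (#W + 1) := by
      calc p * #(link F W x (chunk χ c)) ≤ p * ((#W + 3) * s * p ^ #W) := by gcongr
        _ = _ := by ring
    have h3 := hE W (by omega) x hx c none
    simp only [probe, inter_univ] at h3
    have h4 := (abs_le.1 (h3 h2)).2
    have h5 : θ * s * p ^ (#W + 1) ≤ 1 * s * p ^ (#W + 1) := by gcongr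
    push_cast
    linarith

/-- The size condition in `Exposed`, needed for Chernoff's bound, always holds by the previous
lemma. -/
lemma Exposed.deviation_le (hE : Exposed (r := r) χ j k ℓ p s θ F) (h0 : 0 ≤ p) (hs : 0 ≤ s)
    (hθ : θ ≤ 1) (hχ : ∀ c, (#(chunk χ c) : ℝ) ≤ 3 * s) {W : Finset V} (hW : #W < j) {x : V}
    (hx : x ∉ W) (c : Fin m) (i : Option (Fin k ⊕ Fin r)) :
    |(#(common F (insert x W) ∩ (chunk χ c ∩ probe k r ℓ i (hide F W x (chunk χ c)))) : ℝ) -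
      p * #(link F W x (chunk χ c) ∩ probe k r ℓ i (hide F W x (chunk χ c)))| ≤
      θ * s * p ^ (#W + 1) := by
  refine hE W hW x hx c i ?_
  have h1 : (#(link F W x (chunk χ c) ∩ probe k r ℓ i (hide F W x (chunk χ c))) : ℝ) ≤
      (#W + 3) * s * p ^ #W := by
    refine le_trans ?_ (hE.card_common_le h0 hs hθ hχ W hW.le c)
    exact_mod_cast card_le_card
      (inter_subset_left.trans (inter_subset_inter_right (erase_subset _ _)))
  calc _ ≤ p * ((#W + 3) * s * p ^ #W) := by gcongr
    _ = _ := by ring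

/-- The hidden edges correspond to common neighbours of `insert x W` inside one chunk. Restricting
to chunks is what keeps their number logarithmic. -/
lemma Exposed.card_sdiff_hide_le (hE : Exposed (r := r) χ j k ℓ p s θ F) (h0 : 0 ≤ p) (hs : 0 ≤ s)
    (hθ : θ ≤ 1) (hχ : ∀ c, (#(chunk χ c) : ℝ) ≤ 3 * s) {W : Finset V} (hW : #W + 1 = j)
    {x : V} (hx : x ∉ W) (c : Fin m) (hℓ : (j + 3) * s * p ^ j ≤ ℓ) :
    #(F \ hide F W x (chunk χ c)) ≤ ℓ := by
  have h1 : F \ hide F W x (chunk χ c) = F ∩ star x (link F W x (chunk χ c)) := by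
    rw [hide]; ext e; simp only [Finset.mem_sdiff, mem_inter]; tauto
  rw [h1, card_inter_star (W := W) (show link F W x (chunk χ c) ⊆ (common F W).erase x from
    inter_subset_left)]
  have h2 : common F (insert x W) ∩ link F W x (chunk χ c) ⊆
      common F (insert x W) ∩ chunk χ c := inter_subset_inter_left inter_subset_right
  have h3 := hE.card_common_le h0 hs hθ hχ (insert x W)
    (by rw [card_insert_of_notMem hx]; omega) c
  rw [card_insert_of_notMem hx, hW] at h3
  have h4 : (#(common F (insert x W) ∩ link F W x (chunk χ c)) : ℝ) ≤ ℓ :=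
    le_trans (by exact_mod_cast card_le_card h2) (h3.trans hℓ)
  exact_mod_cast h4

lemma hide_subset (F : Finset (Sym2 V)) (W : Finset V) (x : V) (U : Finset V) :
    hide F W x U ⊆ F := sdiff_subset

/-- The unstable set of the hidden graph, at tolerance (2i + 2)ℓ, does not depend on the exposed
pairs and is sandwiched between those of `F` at tolerances (2i + 1)ℓ and (2i + 3)ℓ. -/
lemma Exposed.card_unstable_step (hE : Exposed (r := r) χ j k ℓ p s θ F) (h0 : 0 ≤ p) (hs : 0 ≤ s)
    (hθ : θ ≤ 1) (hχ : ∀ c, (#(chunk χ c) : ℝ) ≤ 3 * s) {W : Finset V} (hW : #W + 1 = j)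
    {x : V} (hx : x ∉ W) (hℓ : (j + 3) * s * p ^ j ≤ ℓ) {i : ℕ} (hi : i < k) :
    (#(common F (insert x W) ∩ unstable r F ((2 * i + 1) * ℓ)) : ℝ) ≤
      p * #(common F W ∩ unstable r F ((2 * i + 3) * ℓ)) + m * (θ * s * p ^ j) := by
  have key : ∀ c, (#(common F (insert x W) ∩ unstable r F ((2 * i + 1) * ℓ) ∩ chunk χ c) : ℝ) ≤
      p * #(common F W ∩ unstable r F ((2 * i + 3) * ℓ) ∩ chunk χ c) + θ * s * p ^ j := by
    intro c
    have hcard := hE.card_sdiff_hide_le h0 hs hθ hχ hW hx c hℓ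
    have h1 := (abs_le.1 (hE.deviation_le h0 hs hθ hχ (by omega : #W < j) hx c
      (some (Sum.inl ⟨i, hi⟩)))).2
    simp only [probe, hW] at h1
    have h2 : unstable r F ((2 * i + 1) * ℓ) ⊆
        unstable r (hide F W x (chunk χ c)) (2 * (i + 1) * ℓ) :=
      unstable_subset_of_near fun Q hQ =>
        (hQ.of_superset (hide_subset _ _ _ _) hcard).mono (by ring_nf; rfl)
    have h3 : unstable r (hide F W x (chunk χ c)) (2 * (i + 1) * ℓ) ⊆
        unstable r F ((2 * i + 3) * ℓ) :=
      unstable_subset_of_near fun Q hQ =>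
        (hQ.of_subset (hide_subset _ _ _ _) hcard).mono (by ring_nf; rfl)
    have h4 : (#(common F (insert x W) ∩ unstable r F ((2 * i + 1) * ℓ) ∩ chunk χ c) : ℝ) ≤
        #(common F (insert x W) ∩ (chunk χ c ∩
          unstable r (hide F W x (chunk χ c)) (2 * (i + 1) * ℓ))) := by
      refine Nat.cast_le.2 (card_le_card fun z hz => ?_)
      simp only [mem_inter] at hz ⊢
      exact ⟨hz.1.1, hz.2, h2 hz.1.2⟩
    have h5 : (#(link F W x (chunk χ c) ∩
          unstable r (hide F W x (chunk χ c)) (2 * (i + 1) * ℓ)) : ℝ) ≤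
        #(common F W ∩ unstable r F ((2 * i + 3) * ℓ) ∩ chunk χ c) := by
      refine Nat.cast_le.2 (card_le_card fun z hz => ?_)
      simp only [link, mem_inter] at hz ⊢
      exact ⟨⟨erase_subset _ _ hz.1.1, h3 hz.2⟩, hz.1.2⟩
    have h6 := mul_le_mul_of_nonneg_left h5 h0
    linarith
  rw [← sum_card_inter_chunk χ (common F (insert x W) ∩ _),
    ← sum_card_inter_chunk χ (common F W ∩ _), mul_sum]
  refine (sum_le_sum fun c _ => key c).trans (le_of_eq ?_)
  rw [sum_add_distrib, sum_const, card_univ, Fintype.card_fin, nsmul_eq_mul]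

/-- In each chunk `Q` is replaced by the canonical cut of the hidden graph, which is within `ℓ` of
the maximum in `F` and so agrees with `Q` off the unstable vertices. The final `+ 1` is for `x`,
which the link omits. -/
lemma Exposed.abs_card_cell_step (hE : Exposed (r := r) χ j k ℓ p s θ F) (h0 : 0 ≤ p)
    (h1 : p ≤ 1) (hs : 0 ≤ s)
    (hθ : θ ≤ 1) (hχ : ∀ c, (#(chunk χ c) : ℝ) ≤ 3 * s) {W : Finset V} (hW : #W + 1 = j)
    {x : V} (hx : x ∉ W) (hℓ : (j + 3) * s * p ^ j ≤ ℓ) {Q : V → Fin r} (hQ : Near F ℓ Q)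
    {δ : ℝ} (hB : Balanced r F ℓ δ) (hV : 0 < Fintype.card V) (hδ : δ * r < 1 / 3)
    (hU : 2 * r * #(unstable r F ℓ) ≤ Fintype.card V) (i : Fin r) :
    |(#(common F (insert x W) ∩ cell Q i) : ℝ) - p * #(common F W ∩ cell Q i)| ≤
      #(common F (insert x W) ∩ unstable r F ℓ) + p * #(common F W ∩ unstable r F ℓ) +
        m * (θ * s * p ^ j) + 1 := by
  have hr : 0 < r := Nat.pos_of_ne_zero (NeZero.ne r)
  have key : ∀ c,
      |(#(common F (insert x W) ∩ cell Q i ∩ chunk χ c) : ℝ) -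
        p * #(common F W ∩ cell Q i ∩ chunk χ c)| ≤
      #(common F (insert x W) ∩ unstable r F ℓ ∩ chunk χ c) +
        p * #(common F W ∩ unstable r F ℓ ∩ chunk χ c) + θ * s * p ^ j +
        #({x} ∩ chunk χ c) := by
    intro c
    have hcard := hE.card_sdiff_hide_le h0 hs hθ hχ hW hx c hℓ
    set F₀ := hide F W x (chunk χ c) with hF₀
    have hnear : Near F ℓ (canon F₀ : V → Fin r) :=
      ((canon_spec F₀).near.of_subset (hide_subset _ _ _ _) hcard).mono (by omega)
    obtain ⟨i', hi'⟩ := hB.exists_cell_eq hr hV hδ hU hQ hnear i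
    have h2 := abs_le.1 (hE.deviation_le h0 hs hθ hχ (by omega : #W < j) hx c (some (Sum.inr i')))
    simp only [probe, hW, ← hF₀] at h2
    set U := chunk χ c
    set D := unstable r F ℓ
    set C := cell (canon F₀ : V → Fin r) i'
    have e : ∀ z, z ∉ D → (z ∈ cell Q i ↔ z ∈ C) := by simpa [C] using hi'
    have a1 : (#(common F (insert x W) ∩ cell Q i ∩ U) : ℝ) ≤
        #(common F (insert x W) ∩ (U ∩ C)) + #(common F (insert x W) ∩ D ∩ U) := by
      have : common F (insert x W) ∩ cell Q i ∩ U ⊆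
          common F (insert x W) ∩ (U ∩ C) ∪ common F (insert x W) ∩ D ∩ U := by
        intro z hz
        have := e z
        simp only [mem_inter, mem_union] at hz ⊢
        tauto
      exact_mod_cast (card_le_card this).trans (card_union_le _ _)
    have a2 : (#(common F (insert x W) ∩ (U ∩ C)) : ℝ) ≤
        #(common F (insert x W) ∩ cell Q i ∩ U) + #(common F (insert x W) ∩ D ∩ U) := by
      have : common F (insert x W) ∩ (U ∩ C) ⊆
          common F (insert x W) ∩ cell Q i ∩ U ∪ common F (insert x W) ∩ D ∩ U := by
        intro z hz
        have := e z
        simp only [mem_inter, mem_union] at hz ⊢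
        tauto
      exact_mod_cast (card_le_card this).trans (card_union_le _ _)
    have a3 : (#(common F W ∩ cell Q i ∩ U) : ℝ) ≤
        #(link F W x U ∩ C) + #(common F W ∩ D ∩ U) + #({x} ∩ U) := by
      have : common F W ∩ cell Q i ∩ U ⊆
          (link F W x U ∩ C ∪ common F W ∩ D ∩ U) ∪ ({x} ∩ U) := by
        intro z hz
        have := e z
        simp only [link, mem_inter, mem_union, mem_erase, mem_singleton] at hz ⊢
        tauto
      exact_mod_cast (card_le_card this).trans ((card_union_le _ _).trans
        (Nat.add_le_add_right (card_union_le _ _) _))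
    have a4 : (#(link F W x U ∩ C) : ℝ) ≤
        #(common F W ∩ cell Q i ∩ U) + #(common F W ∩ D ∩ U) := by
      have : link F W x U ∩ C ⊆ common F W ∩ cell Q i ∩ U ∪ common F W ∩ D ∩ U := by
        intro z hz
        have := e z
        simp only [link, mem_inter, mem_union, mem_erase] at hz ⊢
        tauto
      exact_mod_cast (card_le_card this).trans (card_union_le _ _)
    have b3 := mul_le_mul_of_nonneg_left a3 h0
    have b4 := mul_le_mul_of_nonneg_left a4 h0
    have b5 : p * (#({x} ∩ U) : ℝ) ≤ #({x} ∩ U) := mul_le_of_le_one_left (Nat.cast_nonneg _) h1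
    have b6 : (0 : ℝ) ≤ #({x} ∩ U) := Nat.cast_nonneg _
    rw [abs_le]
    constructor <;> linarith
  have hsing : (1 : ℝ) = #({x} : Finset V) := by simp
  rw [hsing, ← sum_card_inter_chunk χ (common F (insert x W) ∩ cell Q i),
    ← sum_card_inter_chunk χ (common F W ∩ cell Q i), ← sum_card_inter_chunk χ {x},
    ← sum_card_inter_chunk χ (common F (insert x W) ∩ unstable r F ℓ),
    ← sum_card_inter_chunk χ (common F W ∩ unstable r F ℓ), mul_sum, mul_sum, ← sum_sub_distrib]
  refine (abs_sum_le_sum_abs _ _).trans ((sum_le_sum fun c _ => key c).trans (le_of_eq ?_))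
  simp only [sum_add_distrib]
  rw [sum_const, card_univ, Fintype.card_fin, nsmul_eq_mul]

end

end RandomCut

/-! ### Induction over the vertices of `W`, and the probability of atypical exposures. -/

namespace RandomCut

open Finset RandomSubset

variable {V : Type*} [Fintype V] [DecidableEq V] {r k : ℕ}

lemma unstable_mono {F : Finset (Sym2 V)} {a b : ℕ} (h : a ≤ b) :
    unstable r F a ⊆ unstable r F b := unstable_subset_of_near fun _ hQ => hQ.mono h

/-- In a graph with rigid near-maximum cuts and typical exposures, all maximum cuts split the
common neighbourhoods evenly. -/
theorem abs_card_common_inter_cell_le [NeZero r] {ℓ : ℕ} {p θ : ℝ} {F : Finset (Sym2 V)}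
    (h0 : 0 ≤ p) (h1 : p ≤ 1) (hθ0 : 0 ≤ θ) (hθ1 : θ ≤ 1) (hθr : θ * r < 1 / 3)
    (hV : 0 < Fintype.card V)
    (hrigid : Rigid r F ((2 * k + 1) * ℓ) θ)
    (hE : ∀ j, 1 ≤ j → j ≤ k → ∃ (m : ℕ) (χ : V → Fin m) (s : ℝ), 0 ≤ s ∧
      Exposed (r := r) χ j k ℓ p s θ F ∧ (∀ c, (#(chunk χ c) : ℝ) ≤ 3 * s) ∧
      m * s ≤ Fintype.card V ∧ (j + 3) * s * p ^ j ≤ ℓ)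
    (hone : 1 ≤ θ * Fintype.card V * p ^ k) {Q : V → Fin r} (hQ : Near F 0 Q) (i : Fin r)
    (W : Finset V) (hW : #W = k) :
    |(#(common F W ∩ cell Q i) : ℝ) - Fintype.card V * p ^ k / r| ≤
      (k * (2 * k + 3) + 1) * θ * (Fintype.card V * p ^ k) := by
  have hr : 0 < r := Nat.pos_of_ne_zero (NeZero.ne r)
  have hr0 : (0 : ℝ) < r := by exact_mod_cast hr
  set n : ℝ := (Fintype.card V : ℝ) with hn
  have hn0 : 0 ≤ n := Nat.cast_nonneg _
  -- Each vertex of `W` costs `2ℓ` of tolerance: rigidity supplies (2k + 1)ℓ for the empty set, and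
  -- `ℓ` is left for `k` vertices.
  have hunst : ∀ W : Finset V, #W ≤ k →
      (#(common F W ∩ unstable r F ((2 * (k - #W) + 1) * ℓ)) : ℝ) ≤
        (#W + 1) * θ * n * p ^ #W := by
    intro W
    induction W using Finset.induction_on with
    | empty => intro _; simpa using hrigid.2
    | insert x W hx ih =>
      intro hW
      rw [card_insert_of_notMem hx] at hW ⊢
      have ih := ih (by omega)
      obtain ⟨m, χ, s, hs, hexp, hχ, hms, hℓ⟩ := hE (#W + 1) (by omega) hW
      have h2 := hexp.card_unstable_step h0 hs hθ1 hχ rfl hx hℓ (i := k - (#W + 1)) (by omega)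
      have h3 : 2 * (k - (#W + 1)) + 3 = 2 * (k - #W) + 1 := by omega
      rw [h3] at h2
      have h4 : (m : ℝ) * (θ * s * p ^ (#W + 1)) ≤ θ * n * p ^ (#W + 1) := by
        calc (m : ℝ) * (θ * s * p ^ (#W + 1)) = θ * (m * s) * p ^ (#W + 1) := by ring
          _ ≤ _ := by gcongr
      have h5 := mul_le_mul_of_nonneg_left ih h0
      have h6 : p * ((#W + 1) * θ * n * p ^ #W) = (#W + 1) * θ * n * p ^ (#W + 1) := by ring
      push_cast
      linarith
  have hunst' : ∀ W : Finset V, #W ≤ k →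
      (#(common F W ∩ unstable r F ℓ) : ℝ) ≤ (#W + 1) * θ * n * p ^ #W := by
    intro W hW
    refine le_trans ?_ (hunst W hW)
    refine Nat.cast_le.2 (card_le_card (inter_subset_inter_left (unstable_mono ?_)))
    exact Nat.le_mul_of_pos_left _ (by omega)
  have hℓk : ℓ ≤ (2 * k + 1) * ℓ := Nat.le_mul_of_pos_left _ (by omega)
  have hB : Balanced r F ℓ θ := hrigid.1.mono hℓk
  have hU : 2 * r * #(unstable r F ℓ) ≤ Fintype.card V := by
    have h2 : (#(unstable r F ℓ) : ℝ) ≤ θ * n :=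
      le_trans (Nat.cast_le.2 (card_le_card (unstable_mono hℓk))) hrigid.2
    have h3 : 2 * r * (#(unstable r F ℓ) : ℝ) ≤ n := by
      calc 2 * r * (#(unstable r F ℓ) : ℝ) ≤ 2 * r * (θ * n) := by gcongr
        _ = 2 * (θ * r) * n := by ring
        _ ≤ 1 * n := by gcongr; linarith
        _ = n := one_mul n
    rw [hn] at h3
    exact_mod_cast h3
  have hcell : ∀ W : Finset V, #W ≤ k →
      |(#(common F W ∩ cell Q i) : ℝ) - p ^ #W * #(cell Q i)| ≤
        #W * (2 * k + 3) * θ * n * p ^ #W := by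
    intro W
    induction W using Finset.induction_on with
    | empty => intro _; simp
    | insert x W hx ih =>
      intro hW
      have h2 := hunst' (insert x W) hW
      rw [card_insert_of_notMem hx] at hW h2 ⊢
      have ih := ih (by omega)
      have h3 := hunst' W (by omega)
      obtain ⟨m, χ, s, hs, hexp, hχ, hms, hℓ⟩ := hE (#W + 1) (by omega) hW
      have h4 := hexp.abs_card_cell_step h0 h1 hs hθ1 hχ rfl hx hℓ (hQ.mono (Nat.zero_le _)) hB hV
        hθr hU i
      have h5 : (m : ℝ) * (θ * s * p ^ (#W + 1)) ≤ θ * n * p ^ (#W + 1) := by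
        calc (m : ℝ) * (θ * s * p ^ (#W + 1)) = θ * (m * s) * p ^ (#W + 1) := by ring
          _ ≤ _ := by gcongr
      have h6 : 1 ≤ θ * n * p ^ (#W + 1) := by
        refine hone.trans ?_
        gcongr ?_ * ?_
        exact pow_le_pow_of_le_one h0 h1 hW
      have h7 := mul_le_mul_of_nonneg_left h3 h0
      have h8 : p * ((#W + 1) * θ * n * p ^ #W) = (#W + 1) * θ * n * p ^ (#W + 1) := by ring
      have h9 : |p * (#(common F W ∩ cell Q i) : ℝ) - p ^ (#W + 1) * #(cell Q i)| ≤
          #W * (2 * k + 3) * θ * n * p ^ (#W + 1) := by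
        have e1 : p * (#(common F W ∩ cell Q i) : ℝ) - p ^ (#W + 1) * #(cell Q i) =
          p * (#(common F W ∩ cell Q i) - p ^ #W * #(cell Q i)) := by ring
        rw [e1, abs_mul, abs_of_nonneg h0]
        calc _ ≤ p * (#W * (2 * k + 3) * θ * n * p ^ #W) := by gcongr
          _ = _ := by ring
      have h10 := abs_sub_le (#(common F (insert x W) ∩ cell Q i) : ℝ)
        (p * #(common F W ∩ cell Q i)) (p ^ (#W + 1) * #(cell Q i))
      -- In units of `θ n p^(#W + 1)`, the new error is #W + 2 and #W + 1 for the unstable vertices,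
      -- 1 for the deviations and 1 for `x`.
      have h11 : (2 * ((#W : ℝ) + 1) + 3) * (θ * n * p ^ (#W + 1)) ≤
          (2 * k + 3) * (θ * n * p ^ (#W + 1)) := by
        have : (#W : ℝ) + 1 ≤ k := by exact_mod_cast hW
        gcongr
      push_cast at h2 ⊢
      linarith
  have h2 := hcell W hW.le
  rw [hW] at h2
  have h3 : |p ^ k * (#(cell Q i) : ℝ) - n * p ^ k / r| ≤ θ * (n * p ^ k) := by
    have e1 : p ^ k * (#(cell Q i) : ℝ) - n * p ^ k / r = p ^ k * (#(cell Q i) - n / r) := by ring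
    rw [e1, abs_mul, abs_of_nonneg (pow_nonneg h0 k)]
    calc _ ≤ p ^ k * (θ * n) := by
          have := hB Q (hQ.mono (Nat.zero_le _)) i
          gcongr
      _ = _ := by ring
  have h4 := abs_sub_le (#(common F W ∩ cell Q i) : ℝ) (p ^ k * #(cell Q i)) (n * p ^ k / r)
  linarith

lemma card_filter_card_lt_le (j : ℕ) (hV : 0 < Fintype.card V) :
    #(univ.filter fun W : Finset V => #W < j) ≤ j * Fintype.card V ^ j := by
  have h1 : (univ.filter fun W : Finset V => #W < j) ⊆
      (range j).biUnion fun i => powersetCard i univ := by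
    intro W hW
    rw [mem_filter] at hW
    exact mem_biUnion.2 ⟨#W, mem_range.2 hW.2, mem_powersetCard.2 ⟨subset_univ _, rfl⟩⟩
  refine (card_le_card h1).trans (card_biUnion_le.trans ?_)
  calc ∑ i ∈ range j, #(powersetCard i (univ : Finset V)) ≤
      ∑ i ∈ range j, Fintype.card V ^ j := by
        refine sum_le_sum fun i hi => ?_
        rw [card_powersetCard, card_univ]
        exact (Nat.choose_le_pow _ _).trans (Nat.pow_le_pow_right hV (mem_range.1 hi).le)
    _ = _ := by rw [sum_const, card_range, smul_eq_mul]

/-- Exposures are typical with high probability. -/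
lemma prob_not_exposed_le [NeZero r] {m j ℓ : ℕ} {p s θ L : ℝ} (χ : V → Fin m)
    (h0 : 0 < p) (h1 : p ≤ 1) (hs : 0 < s) (hθ0 : 0 < θ) (hθ1 : θ ≤ 1) (hj : j ≤ k)
    (hV : 0 < Fintype.card V) (hm : m ≤ Fintype.card V) (hL : Real.exp L = Fintype.card V)
    (hs2 : 4 * (k + 3) * ((k + 3) * L) ≤ θ ^ 2 * (s * p ^ j)) :
    prob p (fun F : Finset (Sym2 V) => ¬ Exposed (r := r) χ j k ℓ p s θ F) ≤
      2 * k * (k + r + 1) / Fintype.card V := by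
  classical
  set n : ℝ := (Fintype.card V : ℝ) with hn
  have hn0 : 0 < n := by rw [hn]; exact_mod_cast hV
  have hn1 : 1 ≤ n := by rw [hn]; exact_mod_cast hV
  set bad : (Finset V × V × Fin m × Option (Fin k ⊕ Fin r)) → Finset (Sym2 V) → Prop :=
    fun y F => y.2.1 ∉ y.1 ∧
      p * #(link F y.1 y.2.1 (chunk χ y.2.2.1) ∩
        probe k r ℓ y.2.2.2 (hide F y.1 y.2.1 (chunk χ y.2.2.1))) ≤
        (#y.1 + 3) * s * p ^ (#y.1 + 1) ∧
      θ * s * p ^ (#y.1 + 1) <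
      |(#(common F (insert y.2.1 y.1) ∩ (chunk χ y.2.2.1 ∩
        probe k r ℓ y.2.2.2 (hide F y.1 y.2.1 (chunk χ y.2.2.1)))) : ℝ) -
      p * #(link F y.1 y.2.1 (chunk χ y.2.2.1) ∩
        probe k r ℓ y.2.2.2 (hide F y.1 y.2.1 (chunk χ y.2.2.1)))| with hbad
  set S : Finset (Finset V × V × Fin m × Option (Fin k ⊕ Fin r)) :=
    (univ.filter fun W : Finset V => #W < j) ×ˢ univ with hS
  have hSbad : ∀ F : Finset (Sym2 V), ¬ Exposed (r := r) χ j k ℓ p s θ F →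
      ∃ y ∈ S, bad y F := by
    intro F hF
    unfold Exposed at hF
    push Not at hF
    obtain ⟨W, hW, x, hx, c, i, h2, h3⟩ := hF
    exact ⟨(W, x, c, i), by simp [hS, hW], hx, h2, h3⟩
  -- Each failure has probability at most 2 n^(-k-3), against O(n^(k+2)) choices of set, vertex,
  -- chunk and probe.
  have hone : ∀ y ∈ S, prob p (bad y) ≤ 2 * Real.exp (-((k + 3) * L)) := by
    rintro ⟨W, x, c, i⟩ hy
    have hW : #W < j := by simpa [hS] using hy
    have hWk : (#W : ℝ) ≤ k := by exact_mod_cast hW.le.trans hj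
    by_cases hx : x ∈ W
    · have h3 : prob p (bad (W, x, c, i)) ≤ prob p (fun _ : Finset (Sym2 V) => False) :=
        prob_mono h0.le h1 fun F hF => hF.1 hx
      have h4 : prob p (fun _ : Finset (Sym2 V) => False) = 0 := by
        unfold prob
        simp only [ind_false not_false, mean_const]
      rw [h4] at h3
      exact h3.trans (by positivity)
    have hspos : 0 < s * p ^ (#W + 1) := by positivity
    have h2 := prob_link_deviation_le h0.le h1 hx (chunk χ c) (probe k r ℓ i)
      (μ := (#W + 3) * s * p ^ (#W + 1)) (t := θ * s * p ^ (#W + 1)) (by positivity) (by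
        have : θ * (s * p ^ (#W + 1)) ≤ 1 * (s * p ^ (#W + 1)) := by gcongr
        have : (0 : ℝ) ≤ #W * (s * p ^ (#W + 1)) := by positivity
        linarith)
    refine (prob_mono h0.le h1 fun F hF => hF.2).trans (h2.trans ?_)
    refine mul_le_mul_of_nonneg_left (Real.exp_le_exp.2 (neg_le_neg ?_)) zero_le_two
    rw [le_div_iff₀ (by positivity)]
    have h3 : p ^ j ≤ p ^ (#W + 1) := pow_le_pow_of_le_one h0.le h1 hW
    have h4 : 4 * ((k : ℝ) + 3) * ((k + 3) * L) ≤ θ ^ 2 * (s * p ^ (#W + 1)) :=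
      hs2.trans (by gcongr)
    have hL0 : 0 ≤ L := by
      rw [← Real.exp_le_exp, Real.exp_zero, hL]; exact hn1
    calc (k + 3) * L * (4 * ((#W + 3) * s * p ^ (#W + 1)))
        ≤ (k + 3) * L * (4 * ((k + 3) * s * p ^ (#W + 1))) := by gcongr
      _ = 4 * ((k : ℝ) + 3) * ((k + 3) * L) * (s * p ^ (#W + 1)) := by ring
      _ ≤ θ ^ 2 * (s * p ^ (#W + 1)) * (s * p ^ (#W + 1)) := by gcongr
      _ = _ := by ring
  have hcard : (#S : ℝ) ≤ k * n ^ k * (n * (n * (k + r + 1))) := by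
    have h2 : #S = #(univ.filter fun W : Finset V => #W < j) *
        (Fintype.card V * (m * (k + r + 1))) := by
      rw [hS, card_product]
      simp
    have h3 : #S ≤ (k * Fintype.card V ^ k) *
        (Fintype.card V * (Fintype.card V * (k + r + 1))) := by
      rw [h2]
      refine Nat.mul_le_mul ((card_filter_card_lt_le j hV).trans ?_) (by gcongr)
      exact Nat.mul_le_mul hj (Nat.pow_le_pow_right hV hj)
    rw [hn]
    exact_mod_cast h3
  have hexp : Real.exp (-((k + 3) * L)) = (n ^ (k + 3))⁻¹ := by
    rw [Real.exp_neg, ← hL, ← Real.exp_nat_mul]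
    push_cast
    rfl
  calc _ ≤ prob p (fun F => ∃ y ∈ S, bad y F) := prob_mono h0.le h1 hSbad
    _ ≤ ∑ y ∈ S, prob p (bad y) := prob_exists_le S h0.le h1 bad
    _ ≤ ∑ y ∈ S, 2 * Real.exp (-((k + 3) * L)) := sum_le_sum hone
    _ = #S * (2 * (n ^ (k + 3))⁻¹) := by rw [sum_const, nsmul_eq_mul, hexp]
    _ ≤ k * n ^ k * (n * (n * (k + r + 1))) * (2 * (n ^ (k + 3))⁻¹) := by gcongr
    _ = _ := by field_simp; ring

end RandomCut

/-! ### Even splitting for `p` bounded away from 1. -/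

namespace RandomCut

open Finset RandomSubset

/-- All maximum cuts split the common neighbourhoods of `k` vertices into parts of size about
`x / r`. -/
def SplitsEvenly {V : Type*} [Fintype V] [DecidableEq V] (k r : ℕ) (ε x : ℝ)
    (F : Finset (Sym2 V)) : Prop :=
  ∀ Q : V → Fin r, Near F 0 Q → ∀ W : Finset V, #W = k → ∀ i,
    |(#(common F W ∩ cell Q i) : ℝ) - x / r| ≤ ε * x

/-- The order of quantifiers matters: `A` is fixed before `η` and `ζ`, so the constant in the final
theorem depends on `k`, `r` and `ε` only. -/
theorem exists_prob_not_splitsEvenly_le (k r : ℕ) [NeZero r] {ε : ℝ} (hε : 0 < ε) :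
    ∃ A : ℝ, 0 < A ∧ ∀ η ζ : ℝ, 0 < η → η ≤ 1 → 0 < ζ → ∃ Ω : ℝ, 1 ≤ Ω ∧
      ∀ (V : Type) [Fintype V] [DecidableEq V] (p L : ℝ), 0 < p → p ≤ 1 - η →
        Real.exp L = Fintype.card V → Ω ≤ L → (Ω * L) ^ 2 ≤ Fintype.card V * p →
        A * L ≤ Fintype.card V * p ^ k →
        prob p (fun F : Finset (Sym2 V) => ¬ SplitsEvenly k r ε (Fintype.card V * p ^ k) F) ≤
          ζ := by
  have hr : 0 < r := Nat.pos_of_ne_zero (NeZero.ne r)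
  have hr1 : (1 : ℝ) ≤ r := by exact_mod_cast hr
  have hr0 : (0 : ℝ) < r := by linarith
  obtain ⟨θ, hθ0, hθr, hθε⟩ : ∃ θ : ℝ, 0 < θ ∧ θ * (4 * r) ≤ 1 ∧
      (k * (2 * k + 3) + 1) * θ ≤ ε := by
    have hk : (0 : ℝ) < k * (2 * k + 3) + 1 := by positivity
    refine ⟨min (1 / (4 * r)) (ε / (k * (2 * k + 3) + 1)), lt_min (by positivity) (by positivity),
      ?_, ?_⟩
    · rw [← le_div_iff₀ (by positivity)]
      exact min_le_left _ _
    · rw [mul_comm, ← le_div_iff₀ hk]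
      exact min_le_right _ _
  have hθ4 : θ * 4 ≤ 1 := by
    refine le_trans ?_ hθr
    gcongr
    linarith
  have hθ1 : θ ≤ 1 := by linarith
  -- Makes the Chernoff exponent θ²AL / (4(k + 3)) equal to (k + 3)L, as the union bound over
  -- exposures requires.
  set A : ℝ := 4 * (k + 3) * (k + 3) / θ ^ 2 with hA
  have hA0 : 0 < A := by positivity
  have hAθ : θ ^ 2 * A = 4 * (k + 3) * (k + 3) := by rw [hA]; field_simp
  have hk0 : (0 : ℝ) ≤ k := Nat.cast_nonneg k
  have hθA : 1 ≤ θ * A := by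
    have h1 : (1 : ℝ) ≤ θ ^ 2 * A := by rw [hAθ]; nlinarith
    have h2 : θ ^ 2 * A ≤ θ * A := by
      gcongr
      exact pow_le_of_le_one hθ0.le hθ1 two_ne_zero
    linarith
  have hA1 : 1 ≤ A := hθA.trans (mul_le_of_le_one_left hA0.le hθ1)
  refine ⟨A, hA0, fun η ζ hη0 hη1 hζ => ?_⟩
  -- Chosen so that the tolerance (2k + 1)ℓ is at most αL.
  set α : ℝ := (2 * k + 1) * ((k + 3) * A + 1) with hα
  obtain ⟨Ω₁, hΩ₁, hrig⟩ := exists_prob_not_rigid_le (r := r) (α := α) (δ := θ) (ζ := ζ / 2)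
    hη0 hη1 (by positivity) hθ0 (by positivity)
  set K : ℝ := k * (2 * k * (k + r + 1)) * (2 / ζ) with hK
  have hK0 : 0 ≤ K := by positivity
  refine ⟨Ω₁ + K, by linarith, fun V _ _ p L hp0 hp hexpL hΩL hnp hAL => ?_⟩
  have hΩ₁L : Ω₁ ≤ L := by linarith
  have hL1 : 1 ≤ L := by linarith
  have hL0 : 0 < L := by linarith
  have hp1 : p ≤ 1 := by linarith
  set n : ℝ := (Fintype.card V : ℝ) with hn
  have hLn : L ≤ n := by rw [← hexpL]; linarith [Real.add_one_le_exp L]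
  have hn0 : 0 < n := by linarith
  have hV : 0 < Fintype.card V := by rw [hn] at hn0; exact_mod_cast hn0
  set ℓ : ℕ := ⌈(k + 3) * A * L⌉₊ with hℓ
  have hℓlow : (k + 3) * A * L ≤ ℓ := Nat.le_ceil _
  have hℓup : (ℓ : ℝ) ≤ ((k + 3) * A + 1) * L := by
    have := Nat.ceil_lt_add_one (show 0 ≤ (k + 3) * A * L by positivity)
    calc (ℓ : ℝ) ≤ (k + 3) * A * L + 1 := this.le
      _ ≤ (k + 3) * A * L + L := by gcongr
      _ = _ := by ring
  -- With this chunk size, `j` vertices have about `A L` common neighbours in a chunk, whatever `p`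
  -- is.
  set s : ℕ → ℝ := fun j => A * L / p ^ j with hs
  have hs1 : ∀ j, 1 ≤ s j := by
    intro j
    simp only [hs]
    rw [one_le_div (by positivity)]
    calc p ^ j ≤ 1 := pow_le_one₀ hp0.le hp1
      _ = 1 * 1 := by ring
      _ ≤ A * L := by gcongr
  have hsp : ∀ j, s j * p ^ j = A * L := by
    intro j
    simp only [hs]
    field_simp
  have hsn : ∀ j ≤ k, s j ≤ n := by
    intro j hj
    simp only [hs]
    rw [div_le_iff₀ (by positivity)]
    refine hAL.trans ?_
    gcongr ?_ * ?_
    exact pow_le_pow_of_le_one hp0.le hp1 hj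
  have hscheme : ∀ j, ∃ (m : ℕ) (χ : V → Fin m), j ≤ k →
      (∀ c, (#(chunk χ c) : ℝ) ≤ 3 * s j) ∧ m * s j ≤ n ∧ m ≤ Fintype.card V := by
    intro j
    by_cases hj : j ≤ k
    swap
    · exact ⟨Fintype.card V, Fintype.equivFin V, fun h => absurd h hj⟩
    have hsj : 0 < s j := by linarith [hs1 j]
    have hy : 1 ≤ n / s j := by rw [one_le_div hsj]; exact hsn j hj
    have hm0 : 0 < ⌊n / s j⌋₊ := Nat.floor_pos.2 hy
    have hm1 : (1 : ℝ) ≤ ⌊n / s j⌋₊ := by exact_mod_cast hm0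
    have hm2 : (⌊n / s j⌋₊ : ℝ) ≤ n / s j := Nat.floor_le (by positivity)
    have hm3 : n / s j < ⌊n / s j⌋₊ + 1 := Nat.lt_floor_add_one _
    obtain ⟨χ, hχ⟩ := exists_equitable_map (V := V) _ hm0
    refine ⟨_, χ, fun _ => ⟨fun c => (hχ c).trans ?_, ?_, ?_⟩⟩
    · rw [← hn]
      have : n / ⌊n / s j⌋₊ ≤ 2 * s j := by
        rw [div_le_iff₀ (by linarith)]
        rw [div_lt_iff₀ hsj] at hm3
        have : s j * 1 ≤ s j * ⌊n / s j⌋₊ := by gcongr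
        linarith
      linarith [hs1 j]
    · rwa [← le_div_iff₀ hsj]
    · have : (⌊n / s j⌋₊ : ℝ) ≤ Fintype.card V :=
        hm2.trans (div_le_self hn0.le (hs1 j))
      exact_mod_cast this
  choose m χ hχ using hscheme
  have hbad : ∀ F : Finset (Sym2 V), ¬ SplitsEvenly k r ε (n * p ^ k) F →
      ¬ Rigid r F ((2 * k + 1) * ℓ) θ ∨
      ∃ j ∈ Icc 1 k, ¬ Exposed (r := r) (χ j) j k ℓ p (s j) θ F := by
    intro F hF
    by_contra h
    push Not at h
    refine hF fun Q hQ W hW i => ?_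
    have h1 := abs_card_common_inter_cell_le hp0.le hp1 hθ0.le hθ1 (by linarith) hV h.1
      (fun j hj1 hjk => ⟨m j, χ j, s j, by linarith [hs1 j], h.2 j (mem_Icc.2 ⟨hj1, hjk⟩),
        (hχ j hjk).1, (hχ j hjk).2.1, ?_⟩) ?_ hQ i W hW
    · refine h1.trans ?_
      gcongr
    · refine le_trans ?_ hℓlow
      rw [mul_assoc, hsp, ← mul_assoc]
      gcongr
    · rw [← hn, mul_assoc]
      calc (1 : ℝ) = 1 * 1 := by ring
        _ ≤ (θ * A) * L := by gcongr
        _ = θ * (A * L) := by ring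
        _ ≤ _ := by gcongr
  have hrig' := hrig V p L ((2 * k + 1) * ℓ) hp0 hp hΩ₁L
    (le_trans (by gcongr; linarith) hnp) (by
      push_cast
      calc (2 * (k : ℝ) + 1) * ℓ ≤ (2 * k + 1) * (((k + 3) * A + 1) * L) := by gcongr
        _ = _ := by rw [hα]; ring)
  have hexp : ∀ j ∈ Icc 1 k,
      prob p (fun F : Finset (Sym2 V) => ¬ Exposed (r := r) (χ j) j k ℓ p (s j) θ F) ≤
        2 * k * (k + r + 1) / n := by
    intro j hj
    have hjk := (mem_Icc.1 hj).2
    refine prob_not_exposed_le (χ j) hp0 hp1 (by linarith [hs1 j]) hθ0 hθ1 hjk hV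
      (hχ j hjk).2.2 hexpL ?_
    rw [hsp, ← mul_assoc, ← mul_assoc, hAθ]
  calc _ ≤ prob p (fun F : Finset (Sym2 V) => ¬ Rigid r F ((2 * k + 1) * ℓ) θ ∨
        ∃ j ∈ Icc 1 k, ¬ Exposed (r := r) (χ j) j k ℓ p (s j) θ F) :=
        prob_mono hp0.le hp1 hbad
    _ ≤ _ := prob_or_le hp0.le hp1 _ _
    _ ≤ ζ / 2 + ∑ j ∈ Icc 1 k, 2 * k * (k + r + 1) / n :=
        add_le_add hrig' ((prob_exists_le _ hp0.le hp1 _).trans (sum_le_sum hexp))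
    _ = ζ / 2 + k * (2 * k * (k + r + 1)) / n := by
        rw [sum_const, Nat.card_Icc, nsmul_eq_mul, Nat.add_sub_cancel]; ring
    _ ≤ ζ / 2 + ζ / 2 := by
        refine add_le_add le_rfl ?_
        rw [div_le_iff₀ hn0]
        have : K ≤ n := by linarith
        calc (k : ℝ) * (2 * k * (k + r + 1)) = ζ / 2 * K := by rw [hK]; field_simp
          _ ≤ _ := by gcongr
    _ = ζ := add_halves ζ

end RandomCut

namespace RandomCut

open Finset RandomSubset

/-! ### Dense graphs -/

/-- A vertex of `X` is lost only if it lies in `W` or is one of the at most `y` non-neighbours of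
some vertex of `W`. -/
lemma abs_card_common_inter_sub_le {V : Type*} [Fintype V] [DecidableEq V]
    {F : Finset (Sym2 V)} {W : Finset V} {y : ℝ} (hy : ∀ u, (#(star u univ \ F) : ℝ) ≤ y)
    (X : Finset V) : |(#(common F W ∩ X) : ℝ) - #X| ≤ #W * (y + 1) := by
  have h1 : X ⊆ common F W ∩ X ∪
      (W ∪ W.biUnion fun w => univ.filter fun z => s(w, z) ∉ F) := by
    intro z hz
    by_cases hc : z ∈ common F W
    · exact mem_union_left _ (mem_inter.2 ⟨hc, hz⟩)
    · refine mem_union_right _ ?_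
      rw [mem_common] at hc
      push Not at hc
      by_cases hW : z ∈ W
      · exact mem_union_left _ hW
      · obtain ⟨w, hw, hwz⟩ := hc hW
        exact mem_union_right _ (mem_biUnion.2 ⟨w, hw, by simpa using hwz⟩)
  have h2 : (#X : ℝ) ≤ #(common F W ∩ X) +
      (#W + #(W.biUnion fun w => univ.filter fun z => s(w, z) ∉ F)) := by
    exact_mod_cast (card_le_card h1).trans ((card_union_le _ _).trans
      (Nat.add_le_add_left (card_union_le _ _) _))
  have h3 : (#(W.biUnion fun w => univ.filter fun z => s(w, z) ∉ F) : ℝ) ≤ #W * y := by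
    have h4 : (#(W.biUnion fun w => univ.filter fun z => s(w, z) ∉ F) : ℝ) ≤
        ∑ w ∈ W, (#(univ.filter fun z => s(w, z) ∉ F) : ℝ) := by exact_mod_cast card_biUnion_le
    refine h4.trans ?_
    rw [← nsmul_eq_mul]
    refine sum_le_card_nsmul _ _ _ fun w _ => le_trans ?_ (hy w)
    rw [← card_image_of_injective _ (mk_left_injective w)]
    refine Nat.cast_le.2 (card_le_card fun e he => ?_)
    obtain ⟨z, hz, rfl⟩ := mem_image.1 he
    exact Finset.mem_sdiff.2 ⟨mk_mem_star.2 (mem_univ _), (mem_filter.1 hz).2⟩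
  have h5 : (#(common F W ∩ X) : ℝ) ≤ #X := by exact_mod_cast card_le_card inter_subset_right
  have h6 : (0 : ℝ) ≤ #W * (y + 1) := by linarith [(Nat.cast_nonneg #W : (0 : ℝ) ≤ #W),
    (Nat.cast_nonneg _ : (0 : ℝ) ≤ #(W.biUnion fun w => univ.filter fun z => s(w, z) ∉ F))]
  rw [abs_le]
  constructor <;> linarith

/-- Here common neighbourhoods are almost the whole vertex set, so balanced parts suffice and no
independence is needed. -/
theorem exists_prob_not_splitsEvenly_le_of_dense (k r : ℕ) [NeZero r] {ε : ℝ} (hε : 0 < ε) :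
    ∃ η : ℝ, 0 < η ∧ η ≤ 1 ∧ ∀ ζ : ℝ, 0 < ζ → ∃ N : ℝ,
      ∀ (V : Type) [Fintype V] [DecidableEq V] (p : ℝ), 1 - η ≤ p → p ≤ 1 →
        N ≤ Fintype.card V →
        prob p (fun F : Finset (Sym2 V) => ¬ SplitsEvenly k r ε (Fintype.card V * p ^ k) F) ≤
          ζ := by
  have hr : 0 < r := Nat.pos_of_ne_zero (NeZero.ne r)
  have hr1 : (1 : ℝ) ≤ r := by exact_mod_cast hr
  have hr0 : (0 : ℝ) < r := by linarith
  have hk0 : (0 : ℝ) ≤ k := Nat.cast_nonneg k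
  obtain ⟨η, hη0, hη2, hηk, hηε⟩ : ∃ η : ℝ, 0 < η ∧ η * 2 ≤ 1 ∧ k * η * 2 ≤ 1 ∧
      k * η * 24 ≤ ε := by
    set d : ℝ := 2 * (k + 1) + 24 * (k + 1) / ε with hd
    have hd0 : 0 < d := by positivity
    have e0 : 0 < 24 * (k + 1) / ε := by positivity
    refine ⟨1 / d, by positivity, ?_, ?_, ?_⟩
    · rw [div_mul_eq_mul_div, div_le_one hd0]; linarith
    · rw [mul_one_div, div_mul_eq_mul_div, div_le_one hd0]; linarith
    · rw [mul_one_div, div_mul_eq_mul_div, div_le_iff₀ hd0, hd, mul_add, mul_div_cancel₀ _ hε.ne']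
      have : 0 ≤ ε * (2 * (k + 1)) := by positivity
      linarith
  have hη1 : η ≤ 1 := by linarith
  refine ⟨η, hη0, hη1, fun ζ hζ => ?_⟩
  set δ : ℝ := ε / 8 with hδ
  have hδ0 : 0 < δ := by positivity
  set M : ℝ := (1 + 32 * r) / δ ^ 2 with hM
  have hM0 : 0 < M := by positivity
  refine ⟨8 + M ^ 2 + 8 * k / ε + 2 / ζ + 128 / (η ^ 4 * ζ),
    fun V _ _ p hp hp1 hN => ?_⟩
  set n : ℝ := (Fintype.card V : ℝ) with hn
  have e1 : 0 < M ^ 2 := by positivity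
  have e2 : 0 ≤ 8 * k / ε := by positivity
  have e3 : 0 < 2 / ζ := by positivity
  have e4 : 0 < 128 / (η ^ 4 * ζ) := by positivity
  have hn8 : 8 ≤ n := by linarith
  have hn0 : 0 < n := by linarith
  have hV : 0 < Fintype.card V := by rw [hn] at hn0; exact_mod_cast hn0
  have hnM : M ^ 2 ≤ n := by linarith
  have hnk : k ≤ ε / 8 * n := by
    have : 8 * k / ε ≤ n := by linarith
    rw [div_le_iff₀ hε] at this
    linarith
  have hnζ : 1 / n ≤ ζ / 2 := by
    have : 2 / ζ ≤ n := by linarith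
    rw [div_le_iff₀ hζ] at this
    rw [div_le_iff₀ hn0]
    linarith
  have hnη : 64 / (η ^ 4 * n) ≤ ζ / 2 := by
    have : 128 / (η ^ 4 * ζ) ≤ n := by linarith
    rw [div_le_iff₀ (by positivity)] at this ⊢
    linarith
  have hp2 : 1 / 2 ≤ p := by linarith
  have hp0 : 0 < p := by linarith
  have hpk1 : p ^ k ≤ 1 := pow_le_one₀ hp0.le hp1
  have hpk : 1 - k * η ≤ p ^ k := by
    have h1 := one_add_mul_le_pow (show (-2 : ℝ) ≤ -η by linarith) k
    have h2 : (1 + -η) ^ k ≤ p ^ k := by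
      refine pow_le_pow_left₀ (by linarith) (by linarith) k
    linarith
  have hdisc : prob p (fun F : Finset (Sym2 V) => ¬ Discrepancy p (discBound (Fintype.card V) p) F)
      ≤ 1 / n := by
    have h1 := sq_mul_two_pow_mul_exp_le (Fintype.card V) hV
    have h2 := prob_not_discrepancy_le (V := V) hp0 hp1 (by rw [← hn]; nlinarith)
    rw [← hn] at h1 h2
    rw [le_div_iff₀ hn0, mul_comm]
    refine le_trans ?_ h1
    refine mul_le_mul ?_ h2 (prob_nonneg hp0.le hp1 _) (by positivity)
    exact le_self_pow₀ (by linarith) two_ne_zero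
  have hstar : ∀ u ∈ (univ : Finset V), prob p (fun F : Finset (Sym2 V) =>
      p * #(star u (univ : Finset V)) ≤ n ∧
        η * n < |(#(F ∩ star u univ) : ℝ) - p * #(star u (univ : Finset V))|) ≤
      64 / (η ^ 4 * n) / n := by
    intro u _
    have h1 := prob_deviation_le hp0.le hp1 (fun _ => star u (univ : Finset V))
      (fun _ _ _ => rfl) (μ := n) (t := η * n) (by positivity)
      (by linarith [mul_le_mul_of_nonneg_right hη1 hn0.le])
    refine h1.trans ?_
    have h2 : (η * n) ^ 2 / (4 * n) = η ^ 2 * n / 4 := by field_simp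
    rw [h2, Real.exp_neg]
    -- Quadratic growth of the exponential is enough: a failure probability O(n⁻²) per vertex
    -- survives the union over `n` vertices.
    have h3 : (η ^ 2 * n / 4) ^ 2 / 2 ≤ Real.exp (η ^ 2 * n / 4) := by
      have := Real.quadratic_le_exp_of_nonneg (show 0 ≤ η ^ 2 * n / 4 by positivity)
      have h5 : 0 ≤ η ^ 2 * n / 4 := by positivity
      linarith
    calc 2 * (Real.exp (η ^ 2 * n / 4))⁻¹ ≤ 2 * ((η ^ 2 * n / 4) ^ 2 / 2)⁻¹ := by gcongr
      _ = _ := by field_simp; norm_num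
  have hbad : ∀ F : Finset (Sym2 V), ¬ SplitsEvenly k r ε (n * p ^ k) F →
      ¬ Discrepancy p (discBound (Fintype.card V) p) F ∨
      ∃ u ∈ (univ : Finset V), p * #(star u (univ : Finset V)) ≤ n ∧
        η * n < |(#(F ∩ star u univ) : ℝ) - p * #(star u (univ : Finset V))| := by
    intro F hF
    by_contra h
    push Not at h
    refine hF fun Q hQ W hW i => ?_
    have hB : Balanced r F 0 δ := by
      refine h.1.balanced hp0 hr hδ0.le ?_
      rw [← hn]
      have hs2 : √n ^ 2 = n := Real.sq_sqrt hn0.le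
      have h1 : √(n * p) ≤ √n := Real.sqrt_le_sqrt (mul_le_of_le_one_right hn0.le hp1)
      have h2 : M ≤ √n := Real.le_sqrt_of_sq_le hnM
      have h3 : 1 ≤ √n := by rw [Real.one_le_sqrt]; linarith
      have h4 : (4 * r * discBound (Fintype.card V) p + 2 * ((0 : ℕ) : ℝ)) / p ≤
          32 * r * (n * √n) := by
        rw [discBound, ← hn, div_le_iff₀ hp0]
        push_cast
        calc 4 * r * (4 * n * √(n * p)) + 2 * 0 ≤ 4 * r * (4 * n * √n) + 2 * 0 := by gcongr
          _ = 32 * r * (n * √n) * (1 / 2) := by ring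
          _ ≤ _ := by gcongr
      have h5 : (1 + 32 * r) * (n * √n) ≤ (δ * n) ^ 2 := by
        have h6 : 1 + 32 * r ≤ √n * δ ^ 2 := by
          rw [hM, div_le_iff₀ (by positivity)] at h2
          exact h2
        calc (1 + 32 * r) * (n * √n) ≤ (√n * δ ^ 2) * (n * √n) := by gcongr
          _ = δ ^ 2 * n * √n ^ 2 := by ring
          _ = _ := by rw [hs2]; ring
      have h7 : n ≤ n * √n := le_mul_of_one_le_right hn0.le h3
      linarith
    have hmiss : ∀ u, (#(star u univ \ F) : ℝ) ≤ 2 * (η * n) := by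
      intro u
      have hc : (#(star u (univ : Finset V)) : ℝ) = n := by rw [card_star, card_univ]
      have h1 := h.2 u (mem_univ u) (by rw [hc]; exact mul_le_of_le_one_left hn0.le hp1)
      have h2 : (#(star u univ \ F) : ℝ) + #(F ∩ star u univ) = #(star u (univ : Finset V)) := by
        rw [inter_comm]
        exact_mod_cast card_sdiff_add_card_inter (star u univ) F
      have h3 := (abs_le.1 h1).1
      rw [hc] at h2 h3
      have h4 : (1 - η) * n ≤ p * n := by gcongr
      linarith
    have h1 := abs_card_common_inter_sub_le (W := W) hmiss (cell Q i)
    rw [hW] at h1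
    have h2 := hB Q hQ i
    rw [← hn, hδ] at h2
    have h3 : |n / r - n * p ^ k / r| ≤ k * η * n := by
      have e : n / r - n * p ^ k / r = n * (1 - p ^ k) / r := by ring
      have h4 : 0 ≤ n * (1 - p ^ k) := mul_nonneg hn0.le (by linarith)
      rw [e, abs_of_nonneg (by positivity)]
      calc n * (1 - p ^ k) / r ≤ n * (1 - p ^ k) := div_le_self h4 hr1
        _ ≤ n * (k * η) := by gcongr; linarith
        _ = _ := by ring
    have h4 := abs_sub_le (#(common F W ∩ cell Q i) : ℝ) (#(cell Q i)) (n / r)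
    have h5 := abs_sub_le (#(common F W ∩ cell Q i) : ℝ) (n / r) (n * p ^ k / r)
    have h6 : ε / 2 * n ≤ ε * (n * p ^ k) := by
      have : (1 / 2 : ℝ) ≤ p ^ k := by linarith
      calc ε / 2 * n = ε * (n * (1 / 2)) := by ring
        _ ≤ _ := by gcongr
    have h7 : k * η * 24 * n ≤ ε * n := by gcongr
    linarith
  calc _ ≤ _ := prob_mono hp0.le hp1 hbad
    _ ≤ _ := prob_or_le hp0.le hp1 _ _
    _ ≤ 1 / n + ∑ u : V, 64 / (η ^ 4 * n) / n :=
        add_le_add hdisc ((prob_exists_le _ hp0.le hp1 _).trans (sum_le_sum hstar))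
    _ = 1 / n + 64 / (η ^ 4 * n) := by
        rw [sum_const, card_univ, nsmul_eq_mul, ← hn]; field_simp
    _ ≤ ζ / 2 + ζ / 2 := add_le_add hnζ hnη
    _ = ζ := add_halves ζ

end RandomCut

/-! ### Transfer to the binomial random graph. -/

namespace RandomSubset

open Finset

variable {E : Type*} [Fintype E] [DecidableEq E]

/-- The trace of the random subset on `N` has the binomial distribution on `N`. -/
lemma prob_inter_eq {p : ℝ} {N H : Finset E} (hH : H ⊆ N) :
    prob p (fun F => F ∩ N = H) = p ^ #H * (1 - p) ^ #(N \ H) := by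
  classical
  have h1 : ∀ F : Finset E, weight p F * ind (F ∩ N = H) =
      (∏ e ∈ F, p * ind (e ∈ N → e ∈ H)) *
        ∏ e ∈ univ \ F, (1 - p) * ind (e ∉ H) := by
    intro F
    have h2 : weight p F = (∏ e ∈ F, p) * ∏ e ∈ univ \ F, (1 - p) := by
      rw [weight_eq, prod_const, prod_const, card_sdiff_of_subset (subset_univ F), card_univ]
    rw [h2, prod_mul_distrib, prod_mul_distrib]
    by_cases h : F ∩ N = H
    · rw [ind_true h]
      have h3 : ∏ e ∈ F, ind (e ∈ N → e ∈ H) = 1 := prod_eq_one fun e he => ind_true fun hN => by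
        rw [← h]; exact mem_inter.2 ⟨he, hN⟩
      have h4 : ∏ e ∈ univ \ F, ind (e ∉ H) = 1 := prod_eq_one fun e he => ind_true fun hN => by
        rw [← h] at hN
        exact (Finset.mem_sdiff.1 he).2 (mem_inter.1 hN).1
      rw [h3, h4]; ring
    · rw [ind_false h]
      by_cases h5 : ∀ e ∈ F, e ∈ N → e ∈ H
      · have h6 : ∃ e ∈ H, e ∉ F := by
          by_contra h7
          push Not at h7
          refine h (Subset.antisymm (fun e he => ?_) fun e he => mem_inter.2 ⟨h7 e he, hH he⟩)
          exact h5 e (mem_inter.1 he).1 (mem_inter.1 he).2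
        obtain ⟨e, he, heF⟩ := h6
        have h7 : ∏ e ∈ univ \ F, ind (e ∉ H) = 0 :=
          prod_eq_zero (Finset.mem_sdiff.2 ⟨mem_univ e, heF⟩) (ind_false (not_not.2 he))
        rw [h7]; ring
      · push Not at h5
        obtain ⟨e, he, heN, heH⟩ := h5
        have h7 : ∏ e ∈ F, ind (e ∈ N → e ∈ H) = 0 :=
          prod_eq_zero he (ind_false fun h => heH (h heN))
        rw [h7]; ring
  have h8 : ∀ e : E, p * ind (e ∈ N → e ∈ H) + (1 - p) * ind (e ∉ H) =
      (if e ∈ H then p else 1) * (if e ∈ N \ H then 1 - p else 1) := by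
    intro e
    by_cases he : e ∈ H
    · simp [ind, he]
    · by_cases hN : e ∈ N <;> simp [ind, he, hN]
  unfold prob mean
  rw [sum_congr rfl fun F _ => h1 F, ← powerset_univ, ← prod_add, prod_congr rfl fun e _ => h8 e,
    prod_mul_distrib, prod_ite_mem, prod_ite_mem, univ_inter, univ_inter, prod_const, prod_const]

end RandomSubset

namespace RandomCut

open Finset RandomSubset MeasureTheory

variable {V : Type*} [Fintype V] [DecidableEq V] {r : ℕ}

lemma measurableSingletonClass_simpleGraph : MeasurableSingletonClass (SimpleGraph V) where
  measurableSet_singleton G := by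
    have : {G} = SimpleGraph.edgeSet ⁻¹' {G.edgeSet} := by
      ext G'; simp
    rw [this]
    exact SimpleGraph.measurableEmbedding_edgeSet.measurable (Set.toFinite _).measurableSet

/-- The trace of `F` on the non-loops has the law of the random graph. The property `A` may depend
on loops, so this is an inequality, which suffices for bounding failure probabilities. -/
lemma binomialRandom_real_le (p : unitInterval) (S : Set (SimpleGraph V))
    (A : Finset (Sym2 V) → Prop)
    (h : ∀ F : Finset (Sym2 V), ∀ G ∈ S, (∀ u v, G.Adj u v ↔ s(u, v) ∈ F ∧ u ≠ v) → A F) :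
    (SimpleGraph.binomialRandom V p).real S ≤ prob (p : ℝ) A := by
  classical
  have := measurableSingletonClass_simpleGraph (V := V)
  have hp0 : (0 : ℝ) ≤ p := p.2.1
  have hp1 : (p : ℝ) ≤ 1 := p.2.2
  set N : Finset (Sym2 V) := univ.filter fun e => ¬ e.IsDiag with hN
  have hNcard : #N = (Fintype.card V).choose 2 := by
    rw [hN, ← Sym2.card_subtype_not_diag, Fintype.card_subtype]
  have hsingle : ∀ G : SimpleGraph V, (SimpleGraph.binomialRandom V p).real {G} =
      prob (p : ℝ) (fun F => F ∩ N = G.edgeFinset) := by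
    intro G
    have hsub : G.edgeFinset ⊆ N := fun e he => by
      rw [SimpleGraph.mem_edgeFinset] at he
      exact mem_filter.2 ⟨mem_univ _, G.not_isDiag_of_mem_edgeSet he⟩
    rw [prob_inter_eq hsub, measureReal_def, SimpleGraph.binomialRandom_singleton,
      card_sdiff_of_subset hsub, hNcard, ← SimpleGraph.coe_edgeFinset, Set.ncard_coe_finset,
      Nat.card_eq_fintype_card]
    simp [unitInterval.symm]
  rw [← (Set.toFinite S).coe_toFinset, ← sum_measureReal_singleton]
  rw [sum_congr rfl fun G _ => hsingle G]
  unfold prob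
  rw [← mean_sum]
  refine mean_mono hp0 hp1 fun F => ?_
  by_cases hex : ∃ G ∈ (Set.toFinite S).toFinset, F ∩ N = G.edgeFinset
  · obtain ⟨G, hG, hGF⟩ := hex
    have hA : A F := by
      refine h F G (by simpa using hG) fun u v => ?_
      rw [← SimpleGraph.mem_edgeSet, ← SimpleGraph.mem_edgeFinset, ← hGF]
      simp [hN]
    rw [ind_true hA, sum_eq_single_of_mem G hG fun G' _ hne => ind_false fun h' => hne ?_]
    · exact ind_le_one _
    · exact SimpleGraph.edgeFinset_inj.1 (h'.symm.trans hGF)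
  · push Not at hex
    rw [sum_eq_zero fun G hG => ind_false (hex G hG)]
    exact ind_nonneg _

section

variable {F : Finset (Sym2 V)} {G : SimpleGraph V}

lemma cutSize_eq (h : ∀ u v, G.Adj u v ↔ s(u, v) ∈ F ∧ u ≠ v) (Q : V → Fin r) :
    MaxCut.cutSize G Q = cut F Q := by
  rw [MaxCut.cutSize, cut, ← Set.ncard_coe_finset]
  congr 1
  ext e
  induction e with
  | _ u v =>
    simp only [MaxCut.crossingEdges, Set.mem_ofPred_eq, SimpleGraph.mem_edgeSet, h, coe_inter,
      Set.mem_inter_iff, mem_coe, mem_crossing]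
    constructor
    · rintro ⟨⟨h1, -⟩, u', v', he, hQ⟩
      refine ⟨h1, ?_⟩
      rcases Sym2.eq_iff.1 he with ⟨rfl, rfl⟩ | ⟨rfl, rfl⟩
      · exact hQ
      · exact hQ.symm
    · rintro ⟨h1, hQ⟩
      exact ⟨⟨h1, fun h => hQ (congrArg Q h)⟩, u, v, rfl, hQ⟩

lemma SplitsEvenly.splitsCommonNbhds {k : ℕ} {ε x : ℝ} (hF : SplitsEvenly k r ε x F)
    (h : ∀ u v, G.Adj u v ↔ s(u, v) ∈ F ∧ u ≠ v) : MaxCut.SplitsCommonNbhds G k r ε x := by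
  intro Q hQ W hW i
  have hnear : Near F 0 Q := fun Q' => by
    rw [← cutSize_eq h, ← cutSize_eq h]; exact hQ Q'
  have hset : MaxCut.commonNbhd G W ∩ MaxCut.part Q i = ↑(common F W ∩ cell Q i) := by
    ext z
    simp only [MaxCut.commonNbhd, MaxCut.part, Set.mem_inter_iff, Set.mem_iInter,
      SimpleGraph.mem_neighborSet, h, Set.mem_ofPred_eq, coe_inter, mem_coe, mem_common, mem_cell]
    refine and_congr_left fun _ => ⟨fun hz => ⟨fun hzW => (hz z hzW).2 rfl, fun w hw => (hz w hw).1⟩,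
      fun hz w hw => ⟨hz.2 w hw, fun hwz => hz.1 (hwz ▸ hw)⟩⟩
  rw [hset, Set.ncard_coe_finset]
  have h1 := abs_le.1 (hF Q hnear W hW i)
  have h2 : (1 / (r : ℝ) - ε) * x = x / r - ε * x := by ring
  have h3 : (1 / (r : ℝ) + ε) * x = x / r + ε * x := by ring
  rw [h2, h3]
  constructor <;> linarith

end

end RandomCut

theorem theorem1p3 (k r : ℕ) (hk : 1 ≤ k) (hr : 2 ≤ r) (ε : ℝ) (hε : 0 < ε) :
    ∃ C : ℝ, 0 < C ∧ ∀ p : ℕ → unitInterval,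
      (∀ᶠ n : ℕ in atTop, C * (Real.log n / n) ^ (1 / (k : ℝ)) ≤ (p n : ℝ)) →
      (fun n : ℕ => Real.log n ^ 2 / n) =o[atTop] (fun n : ℕ => (p n : ℝ)) →
      Tendsto
        (fun n : ℕ => SimpleGraph.binomialRandom (Fin n) (p n)
          {G | MaxCut.SplitsCommonNbhds G k r ε (n * (p n : ℝ) ^ k)})
        atTop (𝓝 1) := by
  have : NeZero r := ⟨by omega⟩
  obtain ⟨A, hA0, hsparse⟩ := RandomCut.exists_prob_not_splitsEvenly_le k r hε
  obtain ⟨η, hη0, hη1, hdense⟩ := RandomCut.exists_prob_not_splitsEvenly_le_of_dense k r hε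
  -- The lower bound 1 ensures that the `k`-th power of the constant is still at least `A`.
  refine ⟨max 1 A, by positivity, fun p hC hlog => ?_⟩
  have key : Tendsto (fun n : ℕ => SimpleGraph.binomialRandom (Fin n) (p n)
      {G | MaxCut.SplitsCommonNbhds G k r ε (n * (p n : ℝ) ^ k)}ᶜ) atTop (𝓝 0) := by
    rw [ENNReal.tendsto_nhds_zero]
    intro ζ' hζ'
    obtain ⟨ζ, hζ0, hζ⟩ : ∃ ζ : ℝ, 0 < ζ ∧ ENNReal.ofReal ζ ≤ ζ' := by
      obtain ⟨q, hq0, hq⟩ := ENNReal.lt_iff_exists_nnreal_btwn.1 hζ'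
      exact ⟨q, by exact_mod_cast hq0, by simpa using hq.le⟩
    obtain ⟨Ω, hΩ1, hΩ⟩ := hsparse η ζ hη0 hη1 hζ0
    obtain ⟨N, hN⟩ := hdense ζ hζ0
    have hL : ∀ᶠ n : ℕ in atTop, Ω ≤ Real.log n :=
      (Real.tendsto_log_atTop.comp tendsto_natCast_atTop_atTop).eventually_ge_atTop Ω
    have hNn : ∀ᶠ n : ℕ in atTop, N ≤ n := tendsto_natCast_atTop_atTop.eventually_ge_atTop N
    have hΩ0 : 0 < Ω := by linarith
    filter_upwards [hC, hlog.def (show 0 < 1 / Ω ^ 2 by positivity), hL, hNn,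
      eventually_gt_atTop 0] with n h1 h2 h3 h4 h5
    have hn0 : (0 : ℝ) < n := by exact_mod_cast h5
    have hL0 : 0 < Real.log n := by linarith
    have hp0 : (0 : ℝ) ≤ p n := (p n).2.1
    have hp1 : (p n : ℝ) ≤ 1 := (p n).2.2
    rw [Real.norm_of_nonneg (by positivity), Real.norm_of_nonneg hp0] at h2
    have h6 : (Ω * Real.log n) ^ 2 ≤ n * p n := by
      rw [div_le_iff₀ hn0, one_div_mul_eq_div, div_mul_eq_mul_div, le_div_iff₀ (by positivity)] at h2
      calc (Ω * Real.log n) ^ 2 = Real.log n ^ 2 * Ω ^ 2 := by ring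
        _ ≤ (p n : ℝ) * n := h2
        _ = _ := mul_comm _ _
    have h7 : (0 : ℝ) < p n := by
      have : 0 < (Ω * Real.log n) ^ 2 := by positivity
      exact pos_of_mul_pos_right (lt_of_lt_of_le this h6) hn0.le
    have h8 : A * Real.log n ≤ n * (p n : ℝ) ^ k := by
      have e1 : (max 1 A * (Real.log n / n) ^ (1 / (k : ℝ))) ^ k ≤ (p n : ℝ) ^ k := by
        gcongr
      rw [mul_pow, one_div, Real.rpow_inv_natCast_pow (by positivity) (by omega)] at e1
      have e2 : A ≤ max 1 A ^ k :=
        (le_max_right 1 A).trans (le_self_pow₀ (le_max_left 1 A) (by omega))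
      calc A * Real.log n = n * (A * (Real.log n / n)) := by field_simp
        _ ≤ n * (max 1 A ^ k * (Real.log n / n)) := by gcongr
        _ ≤ _ := by gcongr
    have h9 : RandomSubset.prob (p n : ℝ) (fun F : Finset (Sym2 (Fin n)) =>
        ¬ RandomCut.SplitsEvenly k r ε (n * (p n : ℝ) ^ k) F) ≤ ζ := by
      have hcard : (Fintype.card (Fin n) : ℝ) = n := by simp
      -- The case may vary with `n`, since `p` need not converge; both bounds hold with the same
      -- `ζ`.
      rcases le_total (p n : ℝ) (1 - η) with h | h
      · have := hΩ (Fin n) (p n) (Real.log n) h7 h (by rw [hcard, Real.exp_log hn0]) h3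
          (by rwa [hcard]) (by rwa [hcard])
        rwa [hcard] at this
      · have := hN (Fin n) (p n) h hp1 (by rwa [hcard])
        rwa [hcard] at this
    have h10 := (RandomCut.binomialRandom_real_le (p n)
      {G | MaxCut.SplitsCommonNbhds G k r ε (n * (p n : ℝ) ^ k)}ᶜ
      (fun F => ¬ RandomCut.SplitsEvenly k r ε (n * (p n : ℝ) ^ k) F)
      fun F G hG hadj hF => hG (hF.splitsCommonNbhds hadj)).trans h9
    refine le_trans ?_ hζ
    rw [← MeasureTheory.ofReal_measureReal]
    exact ENNReal.ofReal_le_ofReal h10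
  have h1 := ENNReal.Tendsto.sub (tendsto_const_nhds (x := (1 : ENNReal)) (f := atTop)) key
    (Or.inl ENNReal.one_ne_top)
  rw [tsub_zero] at h1
  refine h1.congr fun n => ?_
  have := RandomCut.measurableSingletonClass_simpleGraph (V := Fin n)
  rw [← MeasureTheory.prob_compl_eq_one_sub (Set.toFinite _).measurableSet, compl_compl]
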